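/- \textbf{Theorem 1.} In the problem \textsc{Multi-budgeted Cut} the input consists of a finite directed graph $G$ with at least one vertex, two disjoint sets $X,Y\subseteq V(G)$, an integer $\ell\ge 1$, and, for every $i\in\{1,\dots,\ell\}$, a set $E_i\subseteq E(G)$ of arcs (the arcs of color $i$; an arc may have several colors or none) and an integer $k_i\ge 1$. The question is whether there is a set of arcs $C\subseteq\bigcup_{i=1}^{\ell}E_i$ such that $G\setminus C$ has no directed path from a vertex of $X$ to a vertex of $Y$ and $|C\cap E_i|\le k_i$ for every $i\in\{1,\dots,\ell\}$. There is an algorithm (a program for a unit-cost random access machine) that, given such an input, returns such a set $C$ if one exists and otherwise reports that there is none, in time $$\mathcal{O}\bigl(2^{k^2\ell}\cdot k\cdot(|V(G)|+|E(G)|)\bigr),\qquad\text{where } k=\sum_{i=1}^{\ell}k_i ,$$ the constant hidden in the $\mathcal{O}$ being absolute. In particular, since $\ell\le k$, the problem is fixed-parameter tractable with respect to $k$. -/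

import Mathlib

/-! ## A random access machine with unit cost

Registers and array cells hold natural numbers.  The arithmetic instructions are copying,
the successor and the truncated subtraction only, so that one step raises the largest
number in the memory by at most one and nothing expensive hides behind a unit cost.
Programs are finite, hence each uses finitely many registers and finitely many arrays. -/

namespace RAM

/-- A memory: registers `reg x` and arrays `arr a`, all addressed by natural numbers. -/
structure State where
  reg : ℕ → ℕ
  arr : ℕ → ℕ → ℕ

/-- Primitive instructions. Register names `x y z` and array names `a` are part of the program
text; the index into an array is read from a register at run time (indirect addressing). -/
inductive Instr where
  /-- `x := c` for a literal `c` -/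
  | const (x c : ℕ)
  /-- `x := y` -/
  | copy (x y : ℕ)
  /-- `x := y + 1` -/
  | succ (x y : ℕ)
  /-- `x := y - z`, truncated at zero -/
  | sub (x y z : ℕ)
  /-- `x := a[y]` -/
  | load (x a y : ℕ)
  /-- `a[y] := x` -/
  | store (a y x : ℕ)

/-- `x := v` -/
def State.setReg (s : State) (x v : ℕ) : State :=
  { s with reg := Function.update s.reg x v }

/-- `a[j] := v` -/
def State.setArr (s : State) (a j v : ℕ) : State :=
  { s with arr := Function.update s.arr a (Function.update (s.arr a) j v) }

/-- The effect of a primitive instruction. -/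
def Instr.apply : Instr → State → State
  | .const x c, s => s.setReg x c
  | .copy x y, s => s.setReg x (s.reg y)
  | .succ x y, s => s.setReg x (s.reg y + 1)
  | .sub x y z, s => s.setReg x (s.reg y - s.reg z)
  | .load x a y, s => s.setReg x (s.arr a (s.reg y))
  | .store a y x, s => s.setArr a (s.reg y) (s.reg x)

/-- Tests: comparisons of two registers. -/
inductive Test where
  | eq (x y : ℕ)
  | ne (x y : ℕ)
  | lt (x y : ℕ)
  | le (x y : ℕ)

/-- The truth of a test in a memory. -/
def Test.Holds : Test → State → Prop
  | .eq x y, s => s.reg x = s.reg y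
  | .ne x y, s => s.reg x ≠ s.reg y
  | .lt x y, s => s.reg x < s.reg y
  | .le x y, s => s.reg x ≤ s.reg y

/-- Programs: `skip`, an instruction, `p; q`, `if b then p else q`, `while b do p`. -/
inductive Prog where
  | skip
  | instr (i : Instr)
  | seq (p q : Prog)
  | cond (b : Test) (p q : Prog)
  | loop (b : Test) (p : Prog)

/-- `Exec p s t s'`: started in the memory `s`, the program `p` halts in the memory `s'`
after exactly `t` steps. Every `skip`, every primitive instruction and every evaluation of a
test is one step. -/
inductive Exec : Prog → State → ℕ → State → Prop
  | skip (s : State) : Exec .skip s 1 s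
  | instr (i : Instr) (s : State) : Exec (.instr i) s 1 (i.apply s)
  | seq {p q : Prog} {s s' s'' : State} {t t' : ℕ} :
      Exec p s t s' → Exec q s' t' s'' → Exec (.seq p q) s (t + t') s''
  | cond_true {b : Test} {p q : Prog} {s s' : State} {t : ℕ} :
      b.Holds s → Exec p s t s' → Exec (.cond b p q) s (1 + t) s'
  | cond_false {b : Test} {p q : Prog} {s s' : State} {t : ℕ} :
      ¬ b.Holds s → Exec q s t s' → Exec (.cond b p q) s (1 + t) s'
  | loop_false {b : Test} {p : Prog} {s : State} :
      ¬ b.Holds s → Exec (.loop b p) s 1 s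
  | loop_true {b : Test} {p : Prog} {s s' s'' : State} {t t' : ℕ} :
      b.Holds s → Exec p s t s' → Exec (.loop b p) s' t' s'' →
      Exec (.loop b p) s (1 + t + t') s''

/-- A program has at most one halting run from a given memory. -/
theorem Exec.deterministic {p : Prog} {s s₁ : State} {t₁ : ℕ} (h₁ : Exec p s t₁ s₁) :
    ∀ {t₂ : ℕ} {s₂ : State}, Exec p s t₂ s₂ → t₁ = t₂ ∧ s₁ = s₂ := by
  induction h₁ with
  | skip s => intro t₂ s₂ h; cases h; exact ⟨rfl, rfl⟩
  | instr i s => intro t₂ s₂ h; cases h; exact ⟨rfl, rfl⟩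
  | seq _ _ ih ih' =>
    intro t₂ s₂ h
    cases h with
    | seq a b =>
      obtain ⟨rfl, rfl⟩ := ih a
      obtain ⟨rfl, rfl⟩ := ih' b
      exact ⟨rfl, rfl⟩
  | cond_true hb _ ih =>
    intro t₂ s₂ h
    cases h with
    | cond_true _ a => obtain ⟨rfl, rfl⟩ := ih a; exact ⟨rfl, rfl⟩
    | cond_false hb' _ => exact absurd hb hb'
  | cond_false hb _ ih =>
    intro t₂ s₂ h
    cases h with
    | cond_true hb' _ => exact absurd hb' hb
    | cond_false _ a => obtain ⟨rfl, rfl⟩ := ih a; exact ⟨rfl, rfl⟩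
  | loop_false hb =>
    intro t₂ s₂ h
    cases h with
    | loop_false _ => exact ⟨rfl, rfl⟩
    | loop_true hb' _ _ => exact absurd hb' hb
  | loop_true hb _ _ ih ih' =>
    intro t₂ s₂ h
    cases h with
    | loop_false hb' => exact absurd hb hb'
    | loop_true _ a b =>
      obtain ⟨rfl, rfl⟩ := ih a
      obtain ⟨rfl, rfl⟩ := ih' b
      exact ⟨rfl, rfl⟩

end RAM

/-! ## Multi-budgeted cut -/

/-- An instance: a finite directed graph with vertices `Fin n` and arcs `Fin m` (parallel arcs
and loops are allowed), disjoint vertex sets `X` and `Y`, and `ℓ` colors, the color `i` being a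
set of arcs with a positive budget. An arc may have several colors or none. -/
structure MultiBudgetedCut where
  /-- number of vertices -/
  n : ℕ
  /-- number of arcs -/
  m : ℕ
  /-- number of colors -/
  ℓ : ℕ
  src : Fin m → Fin n
  tgt : Fin m → Fin n
  X : Finset (Fin n)
  Y : Finset (Fin n)
  disjoint : Disjoint X Y
  color : Fin ℓ → Finset (Fin m)
  budget : Fin ℓ → ℕ
  budget_pos : ∀ i, 1 ≤ budget i

namespace MultiBudgetedCut

/-- The total budget `k`. -/
def k (I : MultiBudgetedCut) : ℕ := ∑ i, I.budget i

/-- Some arc outside `C` leads from `u` to `v`. -/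
def Step (I : MultiBudgetedCut) (C : Finset (Fin I.m)) (u v : Fin I.n) : Prop :=
  ∃ e, e ∉ C ∧ I.src e = u ∧ I.tgt e = v

/-- `C` is an `XY`-cut: after the removal of `C` no directed path leads from `X` to `Y`. -/
def IsCut (I : MultiBudgetedCut) (C : Finset (Fin I.m)) : Prop :=
  ∀ x ∈ I.X, ∀ y ∈ I.Y, ¬ Relation.ReflTransGen (I.Step C) x y

/-- `C` is an `XY`-cut that uses colored arcs only and respects all the budgets. -/
def IsSolution (I : MultiBudgetedCut) (C : Finset (Fin I.m)) : Prop :=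
  I.IsCut C ∧ (∀ e ∈ C, ∃ i, e ∈ I.color i) ∧ ∀ i, (C ∩ I.color i).card ≤ I.budget i

open Classical in
/-- The initial memory on an instance. Registers 0, 1, 2 hold the numbers of vertices, of arcs
and of colors. Arrays 0 and 1 hold the tails and the heads of the arcs, arrays 2 and 3 the
indicators of `X` and `Y`, array 4 the budgets, and array 5 the colors, its entry at `e * ℓ + i`
telling whether the arc `e` has the color `i`. All the rest is zero. -/
noncomputable def input (I : MultiBudgetedCut) : RAM.State where
  reg
    | 0 => I.n
    | 1 => I.m
    | 2 => I.ℓ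
    | _ => 0
  arr
    | 0, j => if h : j < I.m then (I.src ⟨j, h⟩ : ℕ) else 0
    | 1, j => if h : j < I.m then (I.tgt ⟨j, h⟩ : ℕ) else 0
    | 2, j => if ∃ v ∈ I.X, (v : ℕ) = j then 1 else 0
    | 3, j => if ∃ v ∈ I.Y, (v : ℕ) = j then 1 else 0
    | 4, j => if h : j < I.ℓ then I.budget ⟨j, h⟩ else 0
    | 5, j => if ∃ (i : Fin I.ℓ) (e : Fin I.m), e ∈ I.color i ∧ (e : ℕ) * I.ℓ + i = j then 1 else 0
    | _, _ => 0

/-- The set of arcs that a final memory describes: those marked by a `1` in array 6. -/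
def output (I : MultiBudgetedCut) (s : RAM.State) : Finset (Fin I.m) :=
  Finset.univ.filter fun e => s.arr 6 e = 1

/-- A final memory answers the instance: register 0 holds `1` and array 6 marks a solution, or
register 0 holds `0` and there is no solution. -/
def Answers (I : MultiBudgetedCut) (s : RAM.State) : Prop :=
  (s.reg 0 = 1 ∧ I.IsSolution (I.output s)) ∨ (s.reg 0 = 0 ∧ ¬ ∃ C, I.IsSolution C)

end MultiBudgetedCut

/-! The algorithm is randomized contraction of possibilities made exhaustive: it runs a
deterministic procedure on every bit string of length L = ∑_{r ≤ k} r ℓ. The procedure keeps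
capacities in which an arc costs 1 or k + 1; uncolored arcs cost k + 1 from the start, so a cut of
capacity at most k consists of colored arcs of capacity 1. A phase computes a flow that is maximum
or has value k + 1, together with a minimum cut in the former case, and decomposes the flow into c
labelled paths. If c ≤ k and the minimum cut respects the budgets, it is a solution
(`isSolution_of_fits`). Otherwise c ℓ bits are read, one for each label and color, and every
labelled arc having a color whose bit for that label is 0 is raised to capacity k + 1.

Suppose that Z is a solution. The right bit for label j and color i says whether Z has an arc with
label j and color i. Then no arc of Z is raised (`guess_spares`), so Z still contains a cut of
capacity at most k. Consider any cut whose capacity is still c after the raise. It has c arcs of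
capacity 1, and it meets every label, so the labels are distinct on it. If one of its arcs has color
i, the bit of its label for i is 1, so Z has an arc of color i with the same label. Hence the cut
has no more arcs of color i than Z, and it respects the budgets (`guarantee_guess`). So the next
phase either succeeds or finds a larger flow value. With the right bits the values are distinct
numbers up to k until success, so k + 1 phases and L bits suffice (`exists_guess`).

Flow conservation is never stated vertex by vertex. A flow is described by its net amount across
every set that contains X and avoids Y (`Net.Side`). While a path is being processed backwards from
its end, the amount depends on whether the current vertex lies in the set; this makes augmentation
and decomposition inductions along the path (`Net.Residual`, `Net.Labelled`). Weak duality and the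
set visited by the last, failing search give the minimum cut (`analysis_spec`).

To speak of "the" flow for given capacities, the work space is zeroed before each phase, and a run
depends only on the registers and arrays that the program names (`Exec.congr`); so the outcome is a
function of the capacities (`exists_outcome`), and success becomes a recursion on guesses
(`Succeeds`). Stores guarded by an address bound make it possible to clear the work space
completely.

An iteration costs O(k³(|V| + |E|)), and the bound k² 2^L ≤ 4 · 2^(k² ℓ) absorbs two of the three
factors k. -/

set_option linter.unusedSimpArgs false

/-! ## Reasoning about programs -/

namespace RAM

infixr:60 " ;; " => Prog.seq

section Updates

variable (s : State) (x y a b j v : ℕ)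

@[simp] theorem State.setReg_reg : (s.setReg x v).reg y = if y = x then v else s.reg y := by
  simp [State.setReg, Function.update_apply]

@[simp] theorem State.setReg_arr : (s.setReg x v).arr = s.arr := rfl

@[simp] theorem State.setArr_reg : (s.setArr a j v).reg = s.reg := rfl

@[simp] theorem State.setArr_arr :
    (s.setArr a j v).arr b = if b = a then Function.update (s.arr a) j v else s.arr b := by
  by_cases h : b = a
  · subst h; simp [State.setArr]
  · simp [State.setArr, h]

end Updates

instance (b : Test) (s : State) : Decidable (b.Holds s) := by
  cases b <;> (unfold Test.Holds; infer_instance)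

/-- The memory in which a program without loops ends. -/
def Prog.eval : Prog → State → State
  | .skip, s => s
  | .instr i, s => i.apply s
  | .seq p q, s => q.eval (p.eval s)
  | .cond b p q, s => if b.Holds s then p.eval s else q.eval s
  | .loop _ _, s => s

/-- A bound on the running time of a program without loops. -/
def Prog.cost : Prog → ℕ
  | .skip => 1
  | .instr _ => 1
  | .seq p q => p.cost + q.cost
  | .cond _ p q => 1 + max p.cost q.cost
  | .loop _ _ => 0

/-- The program contains no loop. -/
def Prog.loopFree : Prog → Bool
  | .skip => true
  | .instr _ => true
  | .seq p q => p.loopFree && q.loopFree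
  | .cond _ p q => p.loopFree && q.loopFree
  | .loop _ _ => false

theorem Prog.exec_eval (p : Prog) (h : p.loopFree = true) (s : State) :
    ∃ t ≤ p.cost, Exec p s t (p.eval s) := by
  induction p generalizing s with
  | skip => exact ⟨1, le_rfl, .skip s⟩
  | instr i => exact ⟨1, le_rfl, .instr i s⟩
  | seq p q ihp ihq =>
    simp only [Prog.loopFree, Bool.and_eq_true] at h
    obtain ⟨t, ht, e⟩ := ihp h.1 s
    obtain ⟨t', ht', e'⟩ := ihq h.2 (p.eval s)
    exact ⟨t + t', Nat.add_le_add ht ht', .seq e e'⟩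
  | cond b p q ihp ihq =>
    simp only [Prog.loopFree, Bool.and_eq_true] at h
    by_cases hb : b.Holds s
    · obtain ⟨t, ht, e⟩ := ihp h.1 s
      refine ⟨1 + t, ?_, ?_⟩
      · simp only [Prog.cost]; omega
      · simpa only [Prog.eval, if_pos hb] using Exec.cond_true hb e
    · obtain ⟨t, ht, e⟩ := ihq h.2 s
      refine ⟨1 + t, ?_, ?_⟩
      · simp only [Prog.cost]; omega
      · simpa only [Prog.eval, if_neg hb] using Exec.cond_false hb e
  | loop b p => simp [Prog.loopFree] at h

/-- The register written by an instruction is `x`. -/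
def Instr.writesReg : Instr → ℕ → Bool
  | .const y _, x => y == x
  | .copy y _, x => y == x
  | .succ y _, x => y == x
  | .sub y _ _, x => y == x
  | .load y _ _, x => y == x
  | .store _ _ _, _ => false

/-- The array written by an instruction is `a`. -/
def Instr.writesArr : Instr → ℕ → Bool
  | .store b _ _, a => b == a
  | _, _ => false

/-- Some instruction of the program writes the register `x`. -/
def Prog.writesReg : Prog → ℕ → Bool
  | .skip, _ => false
  | .instr i, x => i.writesReg x
  | .seq p q, x => p.writesReg x || q.writesReg x
  | .cond _ p q, x => p.writesReg x || q.writesReg x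
  | .loop _ p, x => p.writesReg x

/-- Some instruction of the program writes into the array `a`. -/
def Prog.writesArr : Prog → ℕ → Bool
  | .skip, _ => false
  | .instr i, a => i.writesArr a
  | .seq p q, a => p.writesArr a || q.writesArr a
  | .cond _ p q, a => p.writesArr a || q.writesArr a
  | .loop _ p, a => p.writesArr a

/-- The memories agree on everything that `p` does not write. -/
structure Frame (p : Prog) (s s' : State) : Prop where
  reg : ∀ x, p.writesReg x = false → s'.reg x = s.reg x
  arr : ∀ a, p.writesArr a = false → s'.arr a = s.arr a

theorem Frame.refl (p : Prog) (s : State) : Frame p s s := ⟨fun _ _ => rfl, fun _ _ => rfl⟩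

theorem Frame.trans {p : Prog} {s s' s'' : State} (h : Frame p s s') (h' : Frame p s' s'') :
    Frame p s s'' :=
  ⟨fun x hx => (h'.reg x hx).trans (h.reg x hx), fun x hx => (h'.arr x hx).trans (h.arr x hx)⟩

theorem Frame.mono {p q : Prog} {s s' : State} (h : Frame p s s')
    (hr : ∀ x, q.writesReg x = false → p.writesReg x = false)
    (ha : ∀ x, q.writesArr x = false → p.writesArr x = false) : Frame q s s' :=
  ⟨fun x hx => h.reg x (hr x hx), fun x hx => h.arr x (ha x hx)⟩

theorem Instr.frame (i : Instr) (s : State) : Frame (.instr i) s (i.apply s) := by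
  constructor
  · intro x hx
    cases i <;> simp_all [Prog.writesReg, Instr.writesReg, Instr.apply] <;>
      (intro h; exact absurd h.symm hx)
  · intro x hx
    cases i <;> simp_all [Prog.writesArr, Instr.writesArr, Instr.apply]
    intro h; exact absurd h.symm hx

/-- What a run leaves alone can be read off the program text. For a concrete program the side
condition is a Boolean computation, so later uses discharge it by `rfl`. -/
theorem Exec.frame {p : Prog} {s s' : State} {t : ℕ} (h : Exec p s t s') : Frame p s s' := by
  induction h with
  | skip s => exact Frame.refl _ _
  | instr i s => exact i.frame s
  | seq _ _ ih ih' =>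
    refine (ih.mono ?_ ?_).trans (ih'.mono ?_ ?_) <;>
      intro x hx <;> simp_all [Prog.writesReg, Prog.writesArr]
  | cond_true _ _ ih =>
    refine ih.mono ?_ ?_ <;> intro x hx <;> simp_all [Prog.writesReg, Prog.writesArr]
  | cond_false _ _ ih =>
    refine ih.mono ?_ ?_ <;> intro x hx <;> simp_all [Prog.writesReg, Prog.writesArr]
  | loop_false _ => exact Frame.refl _ _
  | loop_true _ _ _ ih ih' =>
    exact Frame.trans (ih.mono (fun _ h => h) (fun _ h => h)) ih'

/-- Started in `s`, the program halts within `T` steps in a memory with the property `Q`. -/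
def Runs (p : Prog) (s : State) (T : ℕ) (Q : State → Prop) : Prop :=
  ∃ t s', Exec p s t s' ∧ t ≤ T ∧ Q s'

/-! ### Rules for deriving time bounds and postconditions -/

namespace Runs

variable {p q : Prog} {b : Test} {s : State} {T T' : ℕ} {Q Q' : State → Prop}

theorem mono (h : Runs p s T Q) (hT : T ≤ T') (hQ : ∀ s', Frame p s s' → Q s' → Q' s') :
    Runs p s T' Q' := by
  obtain ⟨t, s', e, ht, h'⟩ := h
  exact ⟨t, s', e, ht.trans hT, hQ s' e.frame h'⟩

/-- Straight-line code needs no invariant: its final memory is computed by `Prog.eval`, so only a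
symbolic evaluation remains. -/
theorem of_loopFree (h : p.loopFree = true) (hT : p.cost ≤ T) (hQ : Q (p.eval s)) :
    Runs p s T Q := by
  obtain ⟨t, ht, e⟩ := p.exec_eval h s
  exact ⟨t, _, e, ht.trans hT, hQ⟩

theorem seq (h : Runs p s T (fun s' => Runs q s' T' Q)) : Runs (p ;; q) s (T + T') Q := by
  obtain ⟨t, s', e, ht, t', s'', e', ht', h'⟩ := h
  exact ⟨t + t', s'', .seq e e', Nat.add_le_add ht ht', h'⟩

theorem cond (h : b.Holds s → Runs p s T Q) (h' : ¬ b.Holds s → Runs q s T Q) :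
    Runs (.cond b p q) s (1 + T) Q := by
  by_cases hb : b.Holds s
  · obtain ⟨t, s', e, ht, h⟩ := h hb
    exact ⟨1 + t, s', .cond_true hb e, by omega, h⟩
  · obtain ⟨t, s', e, ht, h⟩ := h' hb
    exact ⟨1 + t, s', .cond_false hb e, by omega, h⟩

theorem skip (h : Q s) (hT : 1 ≤ T) : Runs .skip s T Q := ⟨1, s, .skip s, hT, h⟩

theorem instr {i : Instr} (h : Q (i.apply s)) (hT : 1 ≤ T) : Runs (.instr i) s T Q :=
  ⟨1, _, .instr i s, hT, h⟩

theorem step {i : Instr} (h : Runs q (i.apply s) T Q) : Runs (.instr i ;; q) s (T + 1) Q :=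
  ((Runs.instr (i := i) h le_rfl).seq).mono (by omega) fun _ _ h => h

/-- A loop whose body preserves the invariant `Inv c` with a smaller value of `c`. -/
theorem loop {N : ℕ} (Inv : ℕ → State → Prop) (h₀ : Inv N s)
    (hs : ∀ c s', Frame p s s' → Inv c s' → b.Holds s' →
      Runs p s' T (fun s'' => ∃ c' < c, Inv c' s'')) :
    Runs (.loop b p) s ((T + 1) * N + 1) (fun s' => (∃ c, Inv c s') ∧ ¬ b.Holds s') := by
  -- The induction is on an upper bound for the rank, since one round may lower the rank by more
  -- than one. The frame relative to the initial memory is carried along for the body.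
  suffices H : ∀ N c s', c ≤ N → Frame p s s' → Inv c s' →
      Runs (.loop b p) s' ((T + 1) * N + 1) (fun s'' => (∃ c, Inv c s'') ∧ ¬ b.Holds s'') from
    H _ _ s le_rfl (Frame.refl _ _) h₀
  intro N
  induction N with
  | zero =>
    intro c s' hN hF hI
    by_cases hb : b.Holds s'
    · obtain ⟨t, s'', e, ht, c', hμ, hI'⟩ := hs c s' hF hI hb
      omega
    · exact ⟨1, s', .loop_false hb, by omega, ⟨c, hI⟩, hb⟩
  | succ N ih =>
    intro c s' hN hF hI
    by_cases hb : b.Holds s'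
    · obtain ⟨t, s'', e, ht, c', hμ, hI'⟩ := hs c s' hF hI hb
      obtain ⟨t', s₃, e', ht', h'⟩ := ih c' s'' (by omega) (hF.trans e.frame) hI'
      exact ⟨1 + t + t', s₃, .loop_true hb e e', by rw [Nat.mul_succ]; omega, h'⟩
    · exact ⟨1, s', .loop_false hb, by omega, ⟨c, hI⟩, hb⟩

end Runs

/-- `for i := 0 to (reg b) - 1 do p` -/
def Prog.for (i b : ℕ) (p : Prog) : Prog :=
  .instr (.const i 0) ;; .loop (.lt i b) (p ;; .instr (.succ i i))

/-- A counting loop, with the invariant `Inv j` before the round `j`. -/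
theorem Runs.for {p : Prog} {i b N : ℕ} {s : State} {T : ℕ} (Inv : ℕ → State → Prop)
    (hi : p.writesReg i = false) (hb : p.writesReg b = false) (hib : i ≠ b)
    (hN : s.reg b = N) (h₀ : Inv 0 (s.setReg i 0))
    (hs : ∀ j s', j < N → s'.reg i = j → Frame (Prog.for i b p) s s' → Inv j s' →
      Runs p s' T (fun s'' => Inv (j + 1) (s''.setReg i (j + 1)))) :
    Runs (Prog.for i b p) s ((T + 2) * N + 2) (fun s' => Inv N s') := by
  have key := Runs.loop (b := .lt i b) (p := p ;; .instr (.succ i i)) (s := s.setReg i 0)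
    (T := T + 1) (N := N)
    (fun c s' => s'.reg i + c = N ∧ s'.reg b = N ∧ Inv (s'.reg i) s')
    (by refine ⟨by simp, ?_, by simpa using h₀⟩; simp [hib.symm, hN])
    (by
      rintro c s' hF ⟨hle, hbN, hI⟩ hlt
      simp only [Test.Holds, hbN] at hlt
      refine Runs.seq ?_
      have hF' : Frame (Prog.for i b p) s s' := by
        refine Frame.trans (s' := s.setReg i 0) ?_ (hF.mono ?_ ?_)
        · exact ((Instr.const i 0).frame s).mono
            (by intro x; simp only [Prog.for, Prog.writesReg, Bool.or_eq_false_iff]; exact And.left)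
            (by intro x; simp only [Prog.for, Prog.writesArr, Bool.or_eq_false_iff]; exact And.left)
        · intro x; simp only [Prog.for, Prog.writesReg, Bool.or_eq_false_iff]; exact And.right
        · intro x; simp only [Prog.for, Prog.writesArr, Bool.or_eq_false_iff]; exact And.right
      refine (hs _ s' hlt rfl hF' hI).mono le_rfl ?_
      intro s'' hF'' h''
      refine Runs.instr ⟨c - 1, by omega, ?_⟩ le_rfl
      have e := hF''.reg i hi
      have e' := hF''.reg b hb
      have : (Instr.succ i i).apply s'' = s''.setReg i (s'.reg i + 1) := by
        simp [Instr.apply, e]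
      rw [this]
      simp only [State.setReg_reg, if_true, if_neg hib.symm]
      exact ⟨by omega, by omega, h''⟩)
  refine (Runs.seq (T := 1) (Runs.instr (s := s) (i := .const i 0) key le_rfl)).mono ?_ ?_
  · ring_nf; omega
  · rintro s' hF ⟨⟨c, h1, h2, h3⟩, h4⟩
    simp only [Test.Holds, h2] at h4
    have : s'.reg i = N := by omega
    rwa [this] at h3

/-! ### Dependence on the memory -/

/-- The registers mentioned in an instruction. -/
def Instr.regs : Instr → List ℕ
  | .const x _ => [x]
  | .copy x y => [x, y]
  | .succ x y => [x, y]
  | .sub x y z => [x, y, z]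
  | .load x _ y => [x, y]
  | .store _ y x => [y, x]

/-- The arrays mentioned in an instruction. -/
def Instr.arrs : Instr → List ℕ
  | .load _ a _ => [a]
  | .store a _ _ => [a]
  | _ => []

/-- The registers mentioned in a test. -/
def Test.regs : Test → List ℕ
  | .eq x y => [x, y]
  | .ne x y => [x, y]
  | .lt x y => [x, y]
  | .le x y => [x, y]

/-- The registers mentioned in a program. -/
def Prog.regs : Prog → List ℕ
  | .skip => []
  | .instr i => i.regs
  | .seq p q => p.regs ++ q.regs
  | .cond b p q => b.regs ++ (p.regs ++ q.regs)
  | .loop b p => b.regs ++ p.regs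

/-- The arrays mentioned in a program. -/
def Prog.arrs : Prog → List ℕ
  | .skip => []
  | .instr i => i.arrs
  | .seq p q => p.arrs ++ q.arrs
  | .cond _ p q => p.arrs ++ q.arrs
  | .loop _ p => p.arrs

/-- The memories agree on the registers in `R` and on the arrays in `A`. -/
structure Agree (R A : List ℕ) (s s' : State) : Prop where
  reg : ∀ x ∈ R, s.reg x = s'.reg x
  arr : ∀ a ∈ A, s.arr a = s'.arr a

theorem Test.holds_congr {R A : List ℕ} {b : Test} {s s' : State} (hR : b.regs ⊆ R)
    (h : Agree R A s s') : b.Holds s ↔ b.Holds s' := by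
  cases b <;> simp_all [Test.regs, Test.Holds, h.reg]

theorem Instr.apply_congr {R A : List ℕ} {i : Instr} {s s' : State} (hR : i.regs ⊆ R)
    (hA : i.arrs ⊆ A) (h : Agree R A s s') : Agree R A (i.apply s) (i.apply s') := by
  constructor
  · intro x hx
    have := h.reg x hx
    cases i <;> simp_all [Instr.regs, Instr.arrs, Instr.apply, h.reg, h.arr]
  · intro x hx
    have := h.arr x hx
    cases i <;> simp_all [Instr.regs, Instr.arrs, Instr.apply, h.reg, h.arr]

/-- The run of a program depends on the registers and arrays mentioned in it only. -/
theorem Exec.congr {R A : List ℕ} {p : Prog} {s s' : State} {t : ℕ} (h : Exec p s t s') :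
    ∀ {r : State}, p.regs ⊆ R → p.arrs ⊆ A → Agree R A s r →
      ∃ r', Exec p r t r' ∧ Agree R A s' r' := by
  induction h with
  | skip s => intro r _ _ h; exact ⟨r, .skip r, h⟩
  | instr i s => intro r hR hA h; exact ⟨_, .instr i r, i.apply_congr hR hA h⟩
  | seq _ _ ih ih' =>
    intro r hR hA h
    simp only [Prog.regs, Prog.arrs, List.append_subset] at hR hA
    obtain ⟨r', e, h'⟩ := ih hR.1 hA.1 h
    obtain ⟨r'', e', h''⟩ := ih' hR.2 hA.2 h'
    exact ⟨r'', .seq e e', h''⟩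
  | cond_true hb _ ih =>
    intro r hR hA h
    simp only [Prog.regs, Prog.arrs, List.append_subset] at hR hA
    obtain ⟨r', e, h'⟩ := ih hR.2.1 hA.1 h
    exact ⟨r', .cond_true ((Test.holds_congr hR.1 h).1 hb) e, h'⟩
  | cond_false hb _ ih =>
    intro r hR hA h
    simp only [Prog.regs, Prog.arrs, List.append_subset] at hR hA
    obtain ⟨r', e, h'⟩ := ih hR.2.2 hA.2 h
    exact ⟨r', .cond_false (fun hb' => hb ((Test.holds_congr hR.1 h).2 hb')) e, h'⟩
  | loop_false hb =>
    intro r hR hA h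
    simp only [Prog.regs, Prog.arrs, List.append_subset] at hR hA
    exact ⟨r, .loop_false (fun hb' => hb ((Test.holds_congr hR.1 h).2 hb')), h⟩
  | loop_true hb _ _ ih ih' =>
    intro r hR hA h
    have hR' := hR
    have hA' := hA
    simp only [Prog.regs, Prog.arrs, List.append_subset] at hR hA
    obtain ⟨r', e, h'⟩ := ih hR.2 hA h
    obtain ⟨r'', e', h''⟩ := ih' hR' hA' h'
    exact ⟨r'', .loop_true ((Test.holds_congr hR.1 h).1 hb) e e', h''⟩

/-! ### Stores below a bound -/

/-- `if y < c then a[y] := x`, the register `c` holding a bound on the addresses in use. -/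
def Prog.storeBelow (c a y x : ℕ) : Prog :=
  .cond (.lt y c) (.instr (.store a y x)) .skip

/-- Every run of `p` leaves the register `c` and all array entries from `reg c` on unchanged. -/
def Prog.Bounded (c : ℕ) (p : Prog) : Prop :=
  ∀ s t s', Exec p s t s' → s'.reg c = s.reg c ∧ ∀ a j, s.reg c ≤ j → s'.arr a j = s.arr a j

namespace Prog.Bounded

variable {c : ℕ} {p q : Prog} {b : Test}

theorem skip : Prog.Bounded c .skip := by
  rintro s t s' ⟨⟩
  exact ⟨rfl, fun _ _ _ => rfl⟩

theorem instr {i : Instr} (h : i.writesReg c = false) (h' : ∀ a, i.writesArr a = false) :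
    Prog.Bounded c (.instr i) := by
  intro s t s' e
  have := e.frame
  exact ⟨this.reg c h, fun a j _ => by rw [this.arr a (h' a)]⟩

theorem storeBelow {a y x : ℕ} : Prog.Bounded c (Prog.storeBelow c a y x) := by
  rintro s t s' e
  unfold Prog.storeBelow at e
  cases e with
  | cond_true hb e =>
    cases e
    refine ⟨rfl, fun a' j hj => ?_⟩
    simp only [Test.Holds] at hb
    simp only [Instr.apply, State.setArr_arr]
    split_ifs with h
    · rw [Function.update_of_ne (by omega), h]
    · rfl
  | cond_false hb e => cases e; exact ⟨rfl, fun _ _ _ => rfl⟩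

theorem seq (hp : p.Bounded c) (hq : q.Bounded c) : (p ;; q).Bounded c := by
  intro s t s' e
  cases e with
  | seq e e' =>
    have h := hp _ _ _ e
    have h' := hq _ _ _ e'
    exact ⟨h'.1.trans h.1, fun a j hj => (h'.2 a j (by omega)).trans (h.2 a j hj)⟩

theorem cond (hp : p.Bounded c) (hq : q.Bounded c) : (Prog.cond b p q).Bounded c := by
  intro s t s' e
  cases e with
  | cond_true _ e => exact hp _ _ _ e
  | cond_false _ e => exact hq _ _ _ e

theorem loop (hp : p.Bounded c) : (Prog.loop b p).Bounded c := by
  intro s t s' e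
  generalize hl : Prog.loop b p = l at e
  induction e with
  | skip | instr | seq | cond_true | cond_false => cases hl
  | loop_false _ => exact ⟨rfl, fun _ _ _ => rfl⟩
  | loop_true _ e _ _ ih' =>
    cases hl
    have h := hp _ _ _ e
    have h' := ih' rfl
    exact ⟨h'.1.trans h.1, fun a j hj => (h'.2 a j (by omega)).trans (h.2 a j hj)⟩

end Prog.Bounded

end RAM

/-! ## The program -/

namespace RAM

namespace Prog

/-- `x := c` for a literal `c` -/
abbrev set (x c : ℕ) : Prog := .instr (.const x c)
/-- `x := y` -/
abbrev cpy (x y : ℕ) : Prog := .instr (.copy x y)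
/-- `x := y + 1` -/
abbrev suc (x y : ℕ) : Prog := .instr (.succ x y)
/-- `x := y - z` -/
abbrev sub (x y z : ℕ) : Prog := .instr (.sub x y z)
/-- `x := a[y]` -/
abbrev ld (x a y : ℕ) : Prog := .instr (.load x a y)
/-- `a[y] := x` -/
abbrev st (a y x : ℕ) : Prog := .instr (.store a y x)

end Prog

section Eval

variable (p q : Prog) (b : Test) (s : State) (a c x y z : ℕ)

@[simp] theorem eval_skip : Prog.skip.eval s = s := rfl
@[simp] theorem eval_seq : (p ;; q).eval s = q.eval (p.eval s) := rfl
@[simp] theorem eval_cond : (Prog.cond b p q).eval s = if b.Holds s then p.eval s else q.eval s := rfl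
@[simp] theorem eval_set : (Prog.instr (.const x c)).eval s = s.setReg x c := rfl
@[simp] theorem eval_cpy : (Prog.instr (.copy x y)).eval s = s.setReg x (s.reg y) := rfl
@[simp] theorem eval_suc : (Prog.instr (.succ x y)).eval s = s.setReg x (s.reg y + 1) := rfl
@[simp] theorem eval_sub : (Prog.instr (.sub x y z)).eval s = s.setReg x (s.reg y - s.reg z) := rfl
@[simp] theorem eval_ld : (Prog.instr (.load x a y)).eval s = s.setReg x (s.arr a (s.reg y)) := rfl
@[simp] theorem eval_st : (Prog.instr (.store a y x)).eval s = s.setArr a (s.reg y) (s.reg x) := rfl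
@[simp] theorem eval_storeBelow : (Prog.storeBelow c a y x).eval s =
    if s.reg y < s.reg c then s.setArr a (s.reg y) (s.reg x) else s := rfl
@[simp] theorem holds_eq : (Test.eq x y).Holds s ↔ s.reg x = s.reg y := Iff.rfl
@[simp] theorem holds_ne : (Test.ne x y).Holds s ↔ s.reg x ≠ s.reg y := Iff.rfl
@[simp] theorem holds_lt : (Test.lt x y).Holds s ↔ s.reg x < s.reg y := Iff.rfl

end Eval

end RAM

namespace CutProgram

open RAM RAM.Prog

/-! Registers that stay fixed after the setup: the numbers of vertices, arcs and colors, the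
numbers `0` and `1`, the total budget `k` and `k + 1`, twice the number of arcs, a bound on the
addresses used by the flow computation, and the number of bits in a guess. -/
notation "rN" => 0
notation "rM" => 1
notation "rL" => 2
notation "rZero" => 3
notation "rOne" => 4
notation "rK" => 5
notation "rK1" => 6
notation "rM2" => 7
notation "rB" => 8
notation "rLen" => 9

/-! The state of the search for a guess: whether it is finished, and the position of the next
unread bit. -/
notation "rDone" => 10
notation "rP" => 11

/-! Registers of the flow computation. -/
notation "rLam" => 12
notation "rFound" => 13
notation "rHead" => 14
notation "rTail" => 15
notation "rArc" => 16
notation "rCur" => 17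
notation "rGo" => 18
notation "rV" => 19
notation "rX" => 20
notation "rY" => 21
notation "rE" => 22
notation "rFlow" => 23
notation "rJ" => 24
notation "rTag" => 25

/-! Other registers. -/
notation "qE" => 30
notation "qI" => 31
notation "qX" => 32
notation "qY" => 33
notation "qZ" => 34
notation "qC" => 35
notation "qPos" => 36
notation "qR" => 37
notation "qJ" => 38
notation "qGo" => 39

/-! Arrays: the input, the output, the residual graph as linked lists, the capacities, the work
space of the flow computation, the counters per color, the first bit of every label, and the
guess. -/
notation "aSrc" => 0
notation "aTgt" => 1
notation "aX" => 2
notation "aY" => 3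
notation "aBudget" => 4
notation "aColor" => 5
notation "aOut" => 6
notation "aFrom" => 7
notation "aTo" => 8
notation "aRev" => 9
notation "aFirst" => 10
notation "aNext" => 11
notation "aCap" => 12
notation "aVis" => 13
notation "aPar" => 14
notation "aQue" => 15
notation "aRes" => 16
notation "aLab" => 17
notation "aSide" => 18
notation "aCnt" => 19
notation "aBase" => 20
notation "aBits" => 21

/-- `a[y] := x` inside the work space -/
abbrev put (a y x : ℕ) : Prog := Prog.storeBelow rB a y x

/-! ### Breadth-first search in the residual graph -/

/-- One root. -/
def rootBody : Prog :=
  ld rX aX rV ;; put aVis rV rX ;; put aPar rV rZero ;;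
  .cond (.ne rX rZero) (put aQue rTail rV ;; suc rTail rTail) .skip

/-- All vertices of `X` become roots. -/
def searchInit : Prog :=
  set rHead 0 ;; set rTail 0 ;; set rFound 0 ;; set rArc 0 ;; set rCur 0 ;; set rGo 1 ;;
  Prog.for rV rN rootBody

/-- Mark the head of the current arc as visited. -/
def visit : Prog :=
  put aVis rV rOne ;; put aPar rV rArc ;; put aQue rTail rV ;; suc rTail rTail ;;
  ld rX aY rV ;; .cond (.ne rX rZero) (suc rFound rV) .skip

/-- Scan the current arc. -/
def scan : Prog :=
  sub rE rArc rOne ;; ld rV aTo rE ;; ld rX aRes rE ;;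
  .cond (.ne rX rZero) (ld rX aVis rV ;; .cond (.eq rX rZero) visit .skip) .skip ;;
  ld rArc aNext rE

/-- Take the next vertex from the queue. -/
def pop : Prog :=
  .cond (.lt rHead rTail) (ld rCur aQue rHead ;; suc rHead rHead ;; ld rArc aFirst rCur)
    (set rGo 0)

/-- One round of the search. -/
def searchBody : Prog := .cond (.ne rArc rZero) scan pop

/-- Breadth-first search from `X` along the arcs with a positive residual capacity. -/
def search : Prog := searchInit ;; .loop (.ne rGo rZero) searchBody

/-- Walk back along the path that the search has found. -/
def trace (body : Prog) : Prog :=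
  sub rV rFound rOne ;; ld rArc aPar rV ;;
  .loop (.ne rArc rZero) (sub rE rArc rOne ;; body ;; ld rV aFrom rE ;; ld rArc aPar rV)

/-! ### Maximum flow and its decomposition -/

/-- Push a unit of flow through an arc. -/
def push : Prog :=
  ld rX aRes rE ;; sub rX rX rOne ;; put aRes rE rX ;;
  ld rY aRev rE ;; ld rX aRes rY ;; suc rX rX ;; put aRes rY rX

/-- Residual capacities of the zero flow. -/
def flowInit : Prog := Prog.for rE rM (ld rX aCap rE ;; put aRes rE rX)

/-- One augmentation. -/
def flowBody : Prog :=
  search ;; .cond (.eq rFound rZero) (set rFlow 0)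
    (trace push ;; suc rLam rLam ;; .cond (.lt rLam rK1) .skip (set rFlow 0))

/-- A maximum flow, or a flow of value `k + 1`. -/
def flow : Prog := set rLam 0 ;; flowInit ;; set rFlow 1 ;; .loop (.ne rFlow rZero) flowBody

/-- Save the set of visited vertices. -/
def record : Prog := Prog.for rV rN (ld rX aVis rV ;; put aSide rV rX)

/-- Replace the residual capacities by the flow. -/
def convert : Prog :=
  cpy rY rM ;;
  Prog.for rE rM (ld rX aRes rY ;; put aRes rE rX ;; put aRes rY rZero ;; suc rY rY)

/-- Remove a unit of flow from an arc and label the arc. -/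
def label : Prog := ld rX aRes rE ;; sub rX rX rOne ;; put aRes rE rX ;; put aLab rE rTag

/-- Decompose the flow into labelled paths. -/
def decompose : Prog := Prog.for rJ rLam (suc rTag rJ ;; search ;; trace label)

/-- The flow computation. -/
def analysis : Prog := flow ;; record ;; convert ;; decompose

/-- Clear the work space. -/
def clear : Prog :=
  Prog.for rV rB (put aVis rV rZero ;; put aPar rV rZero ;; put aQue rV rZero ;;
    put aRes rV rZero ;; put aLab rV rZero ;; put aSide rV rZero)

/-- Clear the work space and the registers of the flow computation. -/
def prepare : Prog :=
  clear ;; set rLam 0 ;; set rFound 0 ;; set rHead 0 ;; set rTail 0 ;; set rArc 0 ;; set rCur 0 ;;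
  set rGo 0 ;; set rV 0 ;; set rX 0 ;; set rY 0 ;; set rE 0 ;; set rFlow 0 ;; set rJ 0 ;;
  set rTag 0

/-! ### Checking a cut and reading a guess -/

/-- Count an arc for one of its colors. -/
def countColor : Prog :=
  ld qX aColor qPos ;; suc qPos qPos ;;
  .cond (.ne qC rZero) (.cond (.ne qX rZero) (ld qX aCnt qI ;; suc qX qX ;; st aCnt qI qX) .skip)
    .skip

/-- Whether an arc leaves the side of `X`. -/
def testArc : Prog :=
  ld qX aSrc qE ;; ld qX aSide qX ;; ld qY aTgt qE ;; ld qY aSide qY ;; set qC 0 ;;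
  .cond (.ne qX rZero) (.cond (.eq qY rZero) (set qC 1) .skip) .skip ;; st aOut qE qC

/-- Output the cut and count its arcs of every color. -/
def count : Prog :=
  Prog.for qI rL (st aCnt qI rZero) ;; set qPos 0 ;;
  Prog.for qE rM (testArc ;; Prog.for qI rL countColor)

/-- Compare the counters with the budgets. -/
def compareBudgets : Prog :=
  set qGo 1 ;; .cond (.lt rK rLam) (set qGo 0) .skip ;;
  Prog.for qI rL (ld qX aCnt qI ;; ld qY aBudget qI ;; .cond (.lt qY qX) (set qGo 0) .skip) ;;
  .cond (.ne qGo rZero) (set rDone 1) .skip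

/-- Output the cut and see whether it respects the budgets. -/
def check : Prog := count ;; compareBudgets

/-- The position of the first bit of every label; the labels after that are for later flows. -/
def bases : Prog :=
  Prog.for qJ rLam (st aBase qJ rP ;; Prog.for qI rL (suc rP rP))

/-- Raise the capacity of an arc with a color that is not guessed for its label. -/
def elevateColor : Prog :=
  ld qX aColor qPos ;; suc qPos qPos ;; ld qY aBits qZ ;; suc qZ qZ ;;
  .cond (.ne qC rZero)
    (.cond (.ne qX rZero) (.cond (.eq qY rZero) (st aCap qE rK1) .skip) .skip) .skip

/-- Raise the capacities according to the guess. -/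
def elevate : Prog :=
  bases ;; set qPos 0 ;;
  Prog.for qE rM (ld qC aLab qE ;; sub qZ qC rOne ;; ld qZ aBase qZ ;; Prog.for qI rL elevateColor)

/-- One phase: compute a maximum flow, check the cut, and raise capacities. -/
def phase : Prog := prepare ;; analysis ;; check ;; elevate

/-! ### All guesses -/

/-- See whether the current arc has the color. -/
def initColor : Prog :=
  ld qX aColor qPos ;; suc qPos qPos ;; .cond (.ne qX rZero) (set qC 1) .skip

/-- Initial capacities: `1` for the colored arcs and `k + 1` for the others. -/
def initCap : Prog :=
  set rP 0 ;; set qPos 0 ;;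
  Prog.for qE rM (cpy qC rK1 ;; Prog.for qI rL initColor ;; st aCap qE qC)

/-- One step of the carry propagation. -/
def carry : Prog :=
  .cond (.lt qJ rLen)
    (ld qX aBits qJ ;; .cond (.ne qX rZero) (st aBits qJ rZero ;; suc qJ qJ)
      (st aBits qJ rOne ;; set qGo 0))
    (set rDone 2 ;; set qGo 0)

/-- The next guess. -/
def increment : Prog := set qJ 0 ;; set qGo 1 ;; .loop (.ne qGo rZero) carry

/-- Follow one guess. -/
def iteration : Prog :=
  initCap ;; Prog.for qR rK1 (.cond (.eq rDone rZero) phase .skip) ;;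
  .cond (.eq rDone rZero) increment .skip

/-! ### Setup -/

/-- The total budget. -/
def setupBudget : Prog :=
  set rOne 1 ;;
  Prog.for qI rL (ld qX aBudget qI ;; Prog.for qJ qX (suc rK rK)) ;; suc rK1 rK

/-- Bounds on addresses. -/
def setupBounds : Prog :=
  cpy rM2 rM ;; Prog.for qJ rM (suc rM2 rM2) ;; cpy rB rM2 ;; Prog.for qJ rN (suc rB rB)

/-- The length of a guess. -/
def setupLength : Prog :=
  Prog.for qR rK1 (Prog.for qJ qR (Prog.for qI rL (suc rLen rLen)))

/-- The arcs of the residual graph. -/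
def setupArcs : Prog :=
  cpy qY rM ;;
  Prog.for qE rM (ld qX aSrc qE ;; ld qZ aTgt qE ;; st aFrom qE qX ;; st aTo qE qZ ;;
    st aFrom qY qZ ;; st aTo qY qX ;; st aRev qE qY ;; st aRev qY qE ;; suc qY qY)

/-- The linked lists of the residual graph. -/
def setupLists : Prog :=
  Prog.for qE rM2 (ld qX aFrom qE ;; ld qY aFirst qX ;; st aNext qE qY ;; suc qY qE ;;
    st aFirst qX qY)

/-- Everything that is computed once. -/
def setup : Prog := setupBudget ;; setupBounds ;; setupLength ;; setupArcs ;; setupLists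

/-- Translate the outcome into the required answer. -/
def finish : Prog := set rN 0 ;; .cond (.eq rDone rOne) (set rN 1) .skip

/-- The algorithm. -/
def main : Prog := setup ;; .loop (.eq rDone rZero) iteration ;; finish

end CutProgram

/-! ## Breadth-first search -/

namespace CutProgram

open RAM RAM.Prog

/-- `a = e + 1` for the last arc `e < b` that leaves `v`, or `a = 0` if there is none. -/
structure IsLast (src : ℕ → ℕ) (v b a : ℕ) : Prop where
  le : a ≤ b
  src_eq : a ≠ 0 → src (a - 1) = v
  src_ne : ∀ e, a ≤ e → e < b → src e ≠ v

/-- The graph, the residual capacities and the terminals that a search works on. -/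
structure Graph where
  n : ℕ
  M : ℕ
  src : ℕ → ℕ
  dst : ℕ → ℕ
  res : ℕ → ℕ
  xs : ℕ → ℕ
  ys : ℕ → ℕ

/-- The list heads and links describe the arcs of the graph. -/
structure Graph.Lists (G : Graph) (first next : ℕ → ℕ) : Prop where
  src_lt : ∀ e < G.M, G.src e < G.n
  dst_lt : ∀ e < G.M, G.dst e < G.n
  first : ∀ v < G.n, IsLast G.src v G.M (first v)
  next : ∀ e < G.M, IsLast G.src (G.src e) e (next e)

/-- The parent arcs form a forest rooted in `xs`. -/
def Graph.IsForest (G : Graph) (vis par rank : ℕ → ℕ) : Prop :=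
  ∀ v < G.n, vis v ≠ 0 → (par v = 0 ∧ G.xs v ≠ 0) ∨
    (par v ≠ 0 ∧ par v ≤ G.M ∧ G.dst (par v - 1) = v ∧ G.res (par v - 1) ≠ 0 ∧
      vis (G.src (par v - 1)) ≠ 0 ∧ rank (G.src (par v - 1)) < rank v)

/-- The outcome of a search. -/
structure Graph.Searched (G : Graph) (vis par : ℕ → ℕ) (found : ℕ) : Prop where
  roots : ∀ v < G.n, G.xs v ≠ 0 → vis v ≠ 0
  closed : ∀ e < G.M, vis (G.src e) ≠ 0 → G.res e ≠ 0 → vis (G.dst e) ≠ 0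
  not_found : found = 0 → ∀ v < G.n, vis v ≠ 0 → G.ys v = 0
  found : found ≠ 0 → found - 1 < G.n ∧ vis (found - 1) ≠ 0 ∧ G.ys (found - 1) ≠ 0
  forest : ∃ rank : ℕ → ℕ, G.IsForest vis par rank ∧ ∀ v < G.n, vis v ≠ 0 → rank v < G.n

/-- The state of a search: marks, parent arcs, queue, positions in the queue, front and back
of the queue, next arc (plus one) of the current vertex, current vertex, and target found. -/
structure Graph.Searching (G : Graph) (vis par que rank : ℕ → ℕ) (h t a cur found : ℕ) :
    Prop where
  roots : ∀ v < G.n, G.xs v ≠ 0 → vis v ≠ 0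
  que_spec : ∀ j < t, que j < G.n ∧ vis (que j) ≠ 0 ∧ rank (que j) = j
  rank_spec : ∀ v < G.n, vis v ≠ 0 → rank v < t ∧ que (rank v) = v
  forest : G.IsForest vis par rank
  le : h ≤ t
  cur_spec : a ≠ 0 → cur < G.n ∧ vis cur ≠ 0 ∧ rank cur < h ∧ a ≤ G.M ∧ G.src (a - 1) = cur
  closed : ∀ e < G.M, vis (G.src e) ≠ 0 → rank (G.src e) < h → ¬ (G.src e = cur ∧ e < a) →
    G.res e ≠ 0 → vis (G.dst e) ≠ 0
  not_found : found = 0 → ∀ v < G.n, vis v ≠ 0 → G.ys v = 0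
  found : found ≠ 0 → found - 1 < G.n ∧ vis (found - 1) ≠ 0 ∧ G.ys (found - 1) ≠ 0

open Classical in
/-- The arcs that are not scanned yet. -/
noncomputable def Graph.unscanned (G : Graph) (vis rank : ℕ → ℕ) (h a cur : ℕ) : Finset ℕ :=
  (Finset.range G.M).filter fun e =>
    ¬ (vis (G.src e) ≠ 0 ∧ rank (G.src e) < h ∧ ¬ (G.src e = cur ∧ e < a))

namespace Graph.Searching

variable {G : Graph} {vis par que rank first next : ℕ → ℕ} {h t a cur found : ℕ}

/-- The queue holds distinct visited vertices, `rank` being a left inverse of `que`. With all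
vertices as `F` this bounds the queue by n; with an unvisited vertex removed it leaves room for one
more entry, so the guarded queue store takes effect. -/
theorem card_image (H : G.Searching vis par que rank h t a cur found) {F : Finset ℕ}
    (hF : ∀ v < G.n, vis v ≠ 0 → v ∈ F) : t ≤ F.card := by
  have : (Finset.range t).card ≤ F.card := by
    refine Finset.card_le_card_of_injOn que ?_ ?_
    · intro j hj
      have := H.que_spec j (by simpa using hj)
      exact hF _ this.1 this.2.1
    · intro i hi j hj hij
      rw [← (H.que_spec i (by simpa using hi)).2.2, ← (H.que_spec j (by simpa using hj)).2.2, hij]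
  simpa using this

theorem tail_le (H : G.Searching vis par que rank h t a cur found) : t ≤ G.n := by
  simpa using H.card_image (F := Finset.range G.n) (fun v hv _ => by simpa using hv)

theorem tail_lt (H : G.Searching vis par que rank h t a cur found) {u : ℕ} (hu : u < G.n)
    (hv : vis u = 0) : t < G.n := by
  have := H.card_image (F := (Finset.range G.n).erase u) (fun v hv' h' => by
    simp only [Finset.mem_erase, Finset.mem_range]
    exact ⟨fun e => h' (e ▸ hv), hv'⟩)
  rw [Finset.card_erase_of_mem (by simpa using hu), Finset.card_range] at this
  omega

/-- Going on to the next arc, if the current one need not be followed. -/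
theorem advance (L : G.Lists first next) (H : G.Searching vis par que rank h t a cur found)
    (ha : a ≠ 0) (hd : G.res (a - 1) ≠ 0 → vis (G.dst (a - 1)) ≠ 0) :
    G.Searching vis par que rank h t (next (a - 1)) cur found ∧
      (G.unscanned vis rank h (next (a - 1)) cur).card < (G.unscanned vis rank h a cur).card := by
  obtain ⟨c1, c2, c3, c4, c5⟩ := H.cur_spec ha
  have N := L.next (a - 1) (by omega)
  have hle := N.le
  constructor
  · refine { H with cur_spec := ?_, closed := ?_ }
    · intro h0
      exact ⟨c1, c2, c3, by omega, (N.src_eq h0).trans c5⟩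
    · intro e he h1 h2 h3 h4
      by_cases hea : e < a
      · by_cases hs : G.src e = cur
        · by_cases hee : e = a - 1
          · subst hee; exact hd h4
          -- An arc strictly between the new and the old list position does not leave `cur`, so `a -
          -- 1` is the only arc that newly counts as scanned.
          · exact absurd (hs.trans c5.symm)
              (N.src_ne e (by by_contra hlt; exact h3 ⟨hs, by omega⟩) (by omega))
        · exact H.closed e he h1 h2 (fun h => hs h.1) h4
      · exact H.closed e he h1 h2 (fun h => hea h.2) h4
  · refine Finset.card_lt_card (Finset.ssubset_iff_subset_ne.2 ⟨?_, ?_⟩)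
    · intro e
      simp only [unscanned, Finset.mem_filter, Finset.mem_range]
      rintro ⟨h1, h2⟩
      refine ⟨h1, fun h3 => h2 ⟨h3.1, h3.2.1, fun h4 => h3.2.2 ⟨h4.1, by omega⟩⟩⟩
    · intro heq
      have : a - 1 ∈ G.unscanned vis rank h a cur := by
        simp only [unscanned, Finset.mem_filter, Finset.mem_range]
        exact ⟨by omega, fun h3 => h3.2.2 ⟨c5, by omega⟩⟩
      rw [← heq] at this
      simp only [unscanned, Finset.mem_filter, Finset.mem_range] at this
      refine this.2 ⟨by rwa [c5], by rwa [c5], fun h4 => by omega⟩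

/-- Marking the head of the current arc. -/
theorem visit (H : G.Searching vis par que rank h t a cur found)
    (L : G.Lists first next) (ha : a ≠ 0) {u : ℕ} (hu : G.dst (a - 1) = u) (hv : vis u = 0)
    (hr : G.res (a - 1) ≠ 0) :
    G.Searching (Function.update vis u 1) (Function.update par u a) (Function.update que t u)
      (Function.update rank u t) h (t + 1) a cur (if G.ys u ≠ 0 then u + 1 else found) ∧
      G.unscanned (Function.update vis u 1) (Function.update rank u t) h a cur =
        G.unscanned vis rank h a cur := by
  obtain ⟨c1, c2, c3, c4, c5⟩ := H.cur_spec ha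
  have hun : u < G.n := hu ▸ L.dst_lt _ (by omega)
  have hcu : cur ≠ u := fun e => c2 (e ▸ hv)
  have hle := H.le
  have mono : ∀ v, vis v ≠ 0 → Function.update vis u 1 v ≠ 0 := by
    intro v h
    by_cases e : v = u
    · subst e; simp
    · rwa [Function.update_of_ne e]
  constructor
  · constructor
    · intro v hv' hx; exact mono v (H.roots v hv' hx)
    · intro j hj
      by_cases e : j = t
      · subst e; simp [hun]
      · obtain ⟨q1, q2, q3⟩ := H.que_spec j (by omega)
        have : que j ≠ u := fun e' => q2 (e' ▸ hv)
        rw [Function.update_of_ne e, Function.update_of_ne this, Function.update_of_ne this]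
        exact ⟨q1, q2, q3⟩
    · intro v hv' hvis
      by_cases e : v = u
      · subst e; simp
      · rw [Function.update_of_ne e] at hvis ⊢
        obtain ⟨r1, r2⟩ := H.rank_spec v hv' hvis
        exact ⟨by omega, by rw [Function.update_of_ne (by omega), r2]⟩
    · intro v hv' hvis
      by_cases e : v = u
      · subst e
        right
        simp only [Function.update_self]
        rw [c5, Function.update_of_ne hcu, Function.update_of_ne hcu]
        exact ⟨ha, c4, hu, hr, c2, by omega⟩
      · rw [Function.update_of_ne e] at hvis ⊢
        refine (H.forest v hv' hvis).imp id ?_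
        rintro ⟨f1, f2, f3, f4, f5, f6⟩
        have : G.src (par v - 1) ≠ u := fun e' => f5 (e' ▸ hv)
        rw [Function.update_of_ne e, Function.update_of_ne this, Function.update_of_ne this]
        exact ⟨f1, f2, f3, f4, f5, f6⟩
    · omega
    · intro _
      rw [Function.update_of_ne hcu, Function.update_of_ne hcu]
      exact ⟨c1, c2, c3, c4, c5⟩
    · intro e he h1 h2 h3 h4
      by_cases e' : G.src e = u
      -- The new vertex has position `t ≥ h` in the queue, so none of its arcs counts as scanned
      -- yet.
      · rw [e', Function.update_self] at h2; omega
      · rw [Function.update_of_ne e'] at h1 h2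
        exact mono _ (H.closed e he h1 h2 h3 h4)
    · intro h0 v hv' hvis
      split_ifs at h0 with hy
      by_cases e : v = u
      · subst e; simpa using hy
      · rw [Function.update_of_ne e] at hvis
        exact H.not_found h0 v hv' hvis
    · intro h0
      split_ifs at h0 ⊢ with hy
      · simp [hun]; exact hy
      · obtain ⟨f1, f2, f3⟩ := H.found h0
        exact ⟨f1, mono _ f2, f3⟩
  · ext e
    simp only [unscanned, Finset.mem_filter, Finset.mem_range]
    by_cases e' : G.src e = u
    · rw [e', Function.update_self, Function.update_self]
      simp [hv]; intro; omega
    · rw [Function.update_of_ne e', Function.update_of_ne e']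

/-- Taking a vertex from the queue. -/
theorem pop (L : G.Lists first next) (H : G.Searching vis par que rank h t 0 cur found)
    (hlt : h < t) :
    G.Searching vis par que rank (h + 1) t (first (que h)) (que h) found ∧
      (G.unscanned vis rank (h + 1) (first (que h)) (que h)).card ≤
        (G.unscanned vis rank h 0 cur).card := by
  obtain ⟨q1, q2, q3⟩ := H.que_spec h hlt
  have N := L.first _ q1
  have key : ∀ e < G.M, vis (G.src e) ≠ 0 → rank (G.src e) < h + 1 → G.src e ≠ que h →
      rank (G.src e) < h := by
    intro e he h1 h2 h3
    by_contra h4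
    -- Raising the front to `h + 1` admits exactly one new vertex, the one at position `h` of the
    -- queue.
    have h5 : rank (G.src e) = h := by omega
    exact h3 (h5 ▸ (H.rank_spec _ (L.src_lt e he) h1).2.symm)
  constructor
  · refine { H with le := hlt, cur_spec := ?_, closed := ?_ }
    · intro h0
      exact ⟨q1, q2, by omega, N.le, N.src_eq h0⟩
    · intro e he h1 h2 h3 h4
      by_cases hs : G.src e = que h
      · exact absurd hs (N.src_ne e (by by_contra hlt'; exact h3 ⟨hs, by omega⟩) he)
      · exact H.closed e he h1 (key e he h1 h2 hs) (fun h => by omega) h4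
  · refine Finset.card_le_card ?_
    intro e
    simp only [unscanned, Finset.mem_filter, Finset.mem_range]
    rintro ⟨he, h2⟩
    exact ⟨he, fun h3 => h2 ⟨h3.1, by omega, fun h4 => by have := h3.2.1; rw [h4.1, q3] at this; omega⟩⟩

/-- With the queue used up every visited vertex has rank below `h`, and with the arc list used up
the exception in `closed` is void. The queue positions serve as ranks of the forest. -/
theorem finish (L : G.Lists first next) (H : G.Searching vis par que rank h t 0 cur found)
    (hlt : ¬ h < t) : G.Searched vis par found where
  roots := H.roots
  closed e he h1 h2 := H.closed e he h1
    (by have := (H.rank_spec _ (L.src_lt e he) h1).1; omega) (fun h => by omega) h2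
  not_found := H.not_found
  found := H.found
  forest := ⟨rank, H.forest, fun v hv h => by
    have := (H.rank_spec v hv h).1
    have := H.tail_le
    omega⟩

end Graph.Searching

/-- The graph in the memory. -/
def graphOf (s : State) : Graph where
  n := s.reg rN
  M := s.reg rM2
  src := s.arr aFrom
  dst := s.arr aTo
  res := s.arr aRes
  xs := s.arr aX
  ys := s.arr aY

/-- What a search needs to know about the memory. -/
structure Searchable (s : State) : Prop where
  zero : s.reg rZero = 0
  one : s.reg rOne = 1
  lists : (graphOf s).Lists (s.arr aFirst) (s.arr aNext)
  le : s.reg rN ≤ s.reg rB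
  no_target : ∀ v < s.reg rN, s.arr aX v ≠ 0 → s.arr aY v = 0

/-- The search state in the memory. -/
def SearchState (G : Graph) (s : State) (rank : ℕ → ℕ) : Prop :=
  G.Searching (s.arr aVis) (s.arr aPar) (s.arr aQue) rank (s.reg rHead) (s.reg rTail)
    (s.reg rArc) (s.reg rCur) (s.reg rFound)

end CutProgram

/-! ### Execution of the breadth-first search -/

namespace CutProgram

open RAM RAM.Prog

namespace Graph.Searching

variable {G : Graph} {vis par que rank first next : ℕ → ℕ} {h t a cur found : ℕ}

/-- Roots are entered vertex by vertex, so the search invariant is used for the graph truncated to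
its first `j` vertices. As `h = 0`, no arc is scanned and closure is vacuous. -/
theorem addRoot {j : ℕ}
    (H : { G with n := j }.Searching vis par que rank 0 t 0 cur 0) (hp : ∀ v < j, par v = 0)
    (hx : G.xs j ≠ 0) (hy : G.ys j = 0) :
    { G with n := j + 1 }.Searching (Function.update vis j (G.xs j)) (Function.update par j 0)
      (Function.update que t j) (Function.update rank j t) 0 (t + 1) 0 cur 0 := by
  refine ⟨?_, ?_, ?_, ?_, by omega, by simp, ?_, ?_, by simp⟩
  · intro v hv h0
    by_cases e : v = j
    · subst e; simpa using hx
    · rw [Function.update_of_ne e]; exact H.roots v (by simp at hv ⊢; omega) h0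
  · intro i hi
    by_cases e : i = t
    · subst e; simp [hx]
    · obtain ⟨q1, q2, q3⟩ := H.que_spec i (by omega)
      have : que i ≠ j := fun e' => by simp at q1; omega
      rw [Function.update_of_ne e, Function.update_of_ne this, Function.update_of_ne this]
      exact ⟨by simp at q1 ⊢; omega, q2, q3⟩
  · intro v hv hvis
    by_cases e : v = j
    · subst e; simp
    · rw [Function.update_of_ne e] at hvis ⊢
      obtain ⟨r1, r2⟩ := H.rank_spec v (by simp at hv ⊢; omega) hvis
      exact ⟨by omega, by rw [Function.update_of_ne (by omega), r2]⟩
  · intro v hv hvis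
    left
    by_cases e : v = j
    · subst e; simpa using hx
    · rw [Function.update_of_ne e] at hvis ⊢
      have hv' : v < j := by simp at hv; omega
      refine ⟨hp v hv', ?_⟩
      have := (H.forest v hv' hvis).resolve_right (fun h => h.1 (hp v hv'))
      exact this.2
  · intro e _ _ h2; omega
  · intro _ v hv hvis
    by_cases e : v = j
    · subst e; exact hy
    · rw [Function.update_of_ne e] at hvis
      exact H.not_found rfl v (by simp at hv ⊢; omega) hvis

theorem addNonRoot {j : ℕ}
    (H : { G with n := j }.Searching vis par que rank 0 t 0 cur 0) (hp : ∀ v < j, par v = 0)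
    (hx : G.xs j = 0) :
    { G with n := j + 1 }.Searching (Function.update vis j 0) (Function.update par j 0)
      que rank 0 t 0 cur 0 := by
  have lt : ∀ v < j + 1, Function.update vis j 0 v ≠ 0 → v < j ∧ v ≠ j ∧ vis v ≠ 0 := by
    intro v hv h
    by_cases e : v = j
    · subst e; simp at h
    · rw [Function.update_of_ne e] at h; exact ⟨by omega, e, h⟩
  refine ⟨?_, ?_, ?_, ?_, by omega, by simp, ?_, ?_, by simp⟩
  · intro v hv h0
    by_cases e : v = j
    · subst e; exact absurd hx h0
    · rw [Function.update_of_ne e]; exact H.roots v (by simp at hv ⊢; omega) h0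
  · intro i hi
    obtain ⟨q1, q2, q3⟩ := H.que_spec i hi
    have : que i ≠ j := fun e' => by simp at q1; omega
    rw [Function.update_of_ne this]
    exact ⟨by simp at q1 ⊢; omega, q2, q3⟩
  · intro v hv hvis
    exact H.rank_spec v (lt v hv hvis).1 (lt v hv hvis).2.2
  · intro v hv hvis
    obtain ⟨h1, h2, h3⟩ := lt v hv hvis
    rw [Function.update_of_ne h2]
    exact Or.inl ((H.forest v h1 h3).resolve_right fun h => h.1 (hp v h1))
  · intro e _ _ h2; omega
  · intro _ v hv hvis
    exact H.not_found rfl v (lt v hv hvis).1 (lt v hv hvis).2.2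

end Graph.Searching


theorem graphOf_of_frame {p : Prog} {s s' : State} (hF : Frame p s s')
    (h : ([rN, rM2].all fun x => !p.writesReg x) = true)
    (h' : ([aFrom, aTo, aRes, aX, aY].all fun a => !p.writesArr a) = true) :
    graphOf s' = graphOf s := by
  simp only [List.all_cons, List.all_nil, Bool.and_true, Bool.and_eq_true,
    Bool.not_eq_true'] at h h'
  simp only [graphOf, hF.reg _ h.1, hF.reg _ h.2, hF.arr _ h'.1, hF.arr _ h'.2.1,
    hF.arr _ h'.2.2.1, hF.arr _ h'.2.2.2.1, hF.arr _ h'.2.2.2.2]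

theorem Searchable.of_frame {p : Prog} {s s' : State} (h : Searchable s) (hF : Frame p s s')
    (hr : ([rN, rZero, rOne, rM2, rB].all fun x => !p.writesReg x) = true)
    (ha : ([aFrom, aTo, aFirst, aNext, aX, aY].all fun a => !p.writesArr a) = true) :
    Searchable s' := by
  simp only [List.all_cons, List.all_nil, Bool.and_true, Bool.and_eq_true,
    Bool.not_eq_true'] at hr ha
  obtain ⟨r1, r2, r3, r4, r5⟩ := hr
  obtain ⟨a1, a2, a3, a4, a5, a6⟩ := ha
  refine ⟨?_, ?_, ?_, ?_, ?_⟩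
  · rw [hF.reg _ r2, h.zero]
  · rw [hF.reg _ r3, h.one]
  · rw [hF.arr _ a3, hF.arr _ a4]
    have := h.lists
    constructor
    · simpa only [graphOf, hF.reg _ r1, hF.reg _ r4, hF.arr _ a1] using this.src_lt
    · simpa only [graphOf, hF.reg _ r1, hF.reg _ r4, hF.arr _ a2] using this.dst_lt
    · simpa only [graphOf, hF.reg _ r1, hF.reg _ r4, hF.arr _ a1] using this.first
    · simpa only [graphOf, hF.reg _ r4, hF.arr _ a1] using this.next
  · rw [hF.reg _ r1, hF.reg _ r5]; exact h.le
  · rw [hF.reg _ r1, hF.arr _ a5, hF.arr _ a6]; exact h.no_target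

/-- Marks and parents are overwritten for every vertex, so no assumption on the work space of an
earlier search is needed. Starting with nothing found is sound because no root is a target. -/
theorem searchInit_spec {s : State} (h : Searchable s) :
    Runs searchInit s (13 * s.reg rN + 8) fun s' =>
      s'.reg rGo = 1 ∧ s'.reg rArc = 0 ∧ ∃ rank, SearchState (graphOf s) s' rank := by
  let s₁ := (set rHead 0 ;; set rTail 0 ;; set rFound 0 ;; set rArc 0 ;; set rCur 0 ;;
    set rGo 1).eval s
  have key := Runs.for (p := rootBody) (i := rV) (b := rN) (N := s.reg rN) (s := s₁) (T := 11)
    (fun j s' => s'.reg rGo = 1 ∧ s'.reg rArc = 0 ∧ s'.reg rHead = 0 ∧ s'.reg rFound = 0 ∧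
      (∀ v < j, s'.arr aPar v = 0) ∧
      ∃ rank, SearchState { graphOf s with n := j } s' rank)
    rfl rfl (by decide) (by simp [s₁])
    (by
      refine ⟨by simp [s₁], by simp [s₁], by simp [s₁], by simp [s₁], by simp, fun _ => 0, ?_⟩
      constructor <;> simp [s₁, Graph.IsForest])
    (by
      rintro j s' hj hv hF ⟨hgo, harc, hhead, hfound, hpar, rank, hS⟩
      have r1 := hF.reg rN rfl
      have r2 := hF.reg rB rfl
      have r3 := hF.reg rZero rfl
      have a1 := hF.arr aX rfl
      have hle := h.le
      simp only [s₁, eval_seq, eval_set, State.setReg_reg] at r1 r2 r3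
      norm_num at r1 r2 r3
      rw [h.zero] at r3
      simp only [SearchState, hhead, hfound, harc] at hS
      have htj : s'.reg rTail ≤ j := hS.tail_le
      have a1' : s'.arr aX = (graphOf s).xs := by rw [a1]; simp [s₁, graphOf]
      refine Runs.of_loopFree rfl (by decide) ?_
      have g1 : j < s'.reg rB := by omega
      have g2 : s'.reg rTail < s'.reg rB := by omega
      by_cases hx : s'.arr aX j = 0
      · simp [rootBody, g1, hx, r3, hgo, harc, hhead, hfound, hv, SearchState]
        refine ⟨fun v hv => ?_, rank, ?_⟩
        · by_cases e : v = j
          · subst e; simp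
          · rw [Function.update_of_ne e]; exact hpar v (by omega)
        · exact hS.addNonRoot hpar (by rw [← a1']; exact hx)
      · simp [rootBody, g1, g2, hx, r3, hgo, harc, hhead, hfound, hv, SearchState]
        refine ⟨fun v hv => ?_, Function.update rank j (s'.reg rTail), ?_⟩
        · by_cases e : v = j
          · subst e; simp
          · rw [Function.update_of_ne e]; exact hpar v (by omega)
        · have := hS.addRoot hpar (by rw [← a1']; exact hx)
            (h.no_target j hj (by simpa [graphOf, a1'] using hx))
          rwa [show (graphOf s).xs j = s'.arr aX j by rw [a1']] at this)
  refine Runs.mono (T := _ + 1 + 1 + 1 + 1 + 1 + 1) (Runs.step <| Runs.step <| Runs.step <|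
    Runs.step <| Runs.step <| Runs.step key) (by omega) ?_
  rintro s' - ⟨h1, h2, -, -, -, rank, h6⟩
  exact ⟨h1, h2, rank, h6⟩

/-- The measure is the number of unscanned arcs, plus the vertices still to be popped, plus one
while the search is active. A scan lowers the first, a pop the second without raising the first, and
the end the third; this gives linear time. -/
theorem searchBody_spec {s : State} (h : Searchable s) (hgo : s.reg rGo ≠ 0) {rank : ℕ → ℕ}
    (hS : SearchState (graphOf s) s rank) :
    Runs searchBody s 20 fun s' =>
      ∃ rank', SearchState (graphOf s) s' rank' ∧
        (s'.reg rGo = 0 → s'.reg rArc = 0 ∧ ¬ s'.reg rHead < s'.reg rTail) ∧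
        ((graphOf s).unscanned (s'.arr aVis) rank' (s'.reg rHead) (s'.reg rArc)
          (s'.reg rCur)).card + (s.reg rN - s'.reg rHead) + (if s'.reg rGo = 0 then 0 else 1) <
        ((graphOf s).unscanned (s.arr aVis) rank (s.reg rHead) (s.reg rArc)
          (s.reg rCur)).card + (s.reg rN - s.reg rHead) + 1 := by
  have hz := h.zero
  have ho := h.one
  unfold SearchState at hS
  by_cases ha : s.reg rArc = 0
  · rw [ha] at hS
    refine Runs.of_loopFree rfl (by decide) ⟨rank, ?_⟩
    by_cases hlt : s.reg rHead < s.reg rTail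
    · have := hS.pop h.lists hlt
      have hn : s.reg rTail ≤ s.reg rN := hS.tail_le
      simp only [searchBody, pop, eval_cond, holds_ne, holds_lt, ha, hz, hlt, eval_seq, eval_ld,
        eval_suc, State.setReg_reg, State.setReg_arr, SearchState]
      norm_num [hgo, ha]
      refine ⟨this.1, ?_⟩
      have := this.2
      omega
    · simp [searchBody, pop, ha, hz, hlt, SearchState]
      exact hS
  · obtain ⟨c1, c2, c3, c4, c5⟩ := hS.cur_spec ha
    refine Runs.of_loopFree rfl (by decide) ?_
    by_cases hr : s.arr aRes (s.reg rArc - 1) = 0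
    · have := hS.advance h.lists ha (fun h => absurd hr h)
      refine ⟨rank, ?_⟩
      simp only [searchBody, scan, eval_cond, holds_ne, eval_seq, eval_ld, eval_sub,
        State.setReg_reg, State.setReg_arr, SearchState, ha, hz, ho, eval_skip]
      norm_num [hgo, ha, hz, ho, hr]
      exact ⟨this.1, by have := this.2; omega⟩
    · by_cases hv : s.arr aVis (s.arr aTo (s.reg rArc - 1)) = 0
      · have hu : s.arr aTo (s.reg rArc - 1) < s.reg rN := h.lists.dst_lt _ (by omega)
        have V := hS.visit h.lists ha rfl hv hr
        have := V.1.advance h.lists ha (fun _ => by simp [graphOf])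
        rw [V.2] at this
        have g1 : s.reg rTail < s.reg rN := hS.tail_lt hu hv
        have hle := h.le
        have g2 : s.reg rTail < s.reg rB := by omega
        have g3 : s.arr aTo (s.reg rArc - 1) < s.reg rB := by omega
        refine ⟨Function.update rank (s.arr aTo (s.reg rArc - 1)) (s.reg rTail), ?_⟩
        simp only [searchBody, scan, visit, put, eval_cond, holds_ne, holds_eq, eval_seq, eval_ld,
          eval_sub, eval_storeBelow, eval_suc, State.setReg_reg, State.setReg_arr, SearchState, ha,
          hz, ho, eval_skip]
        by_cases hy : s.arr aY (s.arr aTo (s.reg rArc - 1)) = 0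
        · simp [hgo, ha, hz, ho, hr, hv, g2, g3, hy]
          simp [graphOf, hy] at this
          exact ⟨this.1, by have := this.2; simp [graphOf]; omega⟩
        · simp [hgo, ha, hz, ho, hr, hv, g2, g3, hy]
          simp [graphOf, hy] at this
          exact ⟨this.1, by have := this.2; simp [graphOf]; omega⟩
      · have := hS.advance h.lists ha (fun _ => hv)
        refine ⟨rank, ?_⟩
        simp only [searchBody, scan, eval_cond, holds_ne, holds_eq, eval_seq, eval_ld, eval_sub,
          State.setReg_reg, State.setReg_arr, SearchState, ha, hz, ho, eval_skip]
        norm_num [hgo, ha, hz, ho, hr, hv]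
        exact ⟨this.1, by have := this.2; omega⟩

theorem search_spec {s : State} (h : Searchable s) :
    Runs search s (40 * (s.reg rN + s.reg rM2 + 1)) fun s' =>
      (graphOf s).Searched (s'.arr aVis) (s'.arr aPar) (s'.reg rFound) := by
  have key := fun s₁ => Runs.loop (s := s₁) (b := .ne rGo rZero) (p := searchBody) (T := 20)
    (N := s.reg rN + s.reg rM2 + 1)
    (fun c s' => ∃ rank, SearchState (graphOf s) s' rank ∧
        (s'.reg rGo = 0 → s'.reg rArc = 0 ∧ ¬ s'.reg rHead < s'.reg rTail) ∧
        ((graphOf s).unscanned (s'.arr aVis) rank (s'.reg rHead) (s'.reg rArc)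
          (s'.reg rCur)).card + (s.reg rN - s'.reg rHead) + (if s'.reg rGo = 0 then 0 else 1) ≤ c)
  refine ((searchInit_spec h).mono le_rfl ?_).seq.mono (T := (13 * s.reg rN + 8) +
    ((20 + 1) * (s.reg rN + s.reg rM2 + 1) + 1)) (by omega) fun _ _ h => h
  rintro s₁ hF₁ ⟨hgo, ha, rank, hS⟩
  refine (key s₁ ⟨rank, hS, by simp [hgo], ?_⟩ ?_).mono le_rfl ?_
  · have : ((graphOf s).unscanned (s₁.arr aVis) rank (s₁.reg rHead) (s₁.reg rArc)
        (s₁.reg rCur)).card ≤ s.reg rM2 := by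
      refine (Finset.card_filter_le _ _).trans ?_
      simp [graphOf]
    simp only [hgo, one_ne_zero, if_false]
    omega
  · rintro c s₂ hF₂ ⟨rank, hS, -, hc⟩ hb
    have G₁ : graphOf s₂ = graphOf s :=
      (graphOf_of_frame hF₂ rfl rfl).trans (graphOf_of_frame hF₁ rfl rfl)
    have R₁ : Searchable s₂ := (h.of_frame hF₁ rfl rfl).of_frame hF₂ rfl rfl
    have hn : s₂.reg rN = s.reg rN := congrArg Graph.n G₁
    simp only [holds_ne, R₁.zero] at hb
    rw [← G₁] at hS hc
    refine (searchBody_spec R₁ hb hS).mono le_rfl ?_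
    rintro s₃ - ⟨rank', hS', he, hlt⟩
    rw [if_neg hb] at hc
    rw [hn] at hlt
    rw [← G₁]
    exact ⟨_, by omega, rank', hS', he, le_rfl⟩
  · rintro s₂ hF₂ ⟨⟨c, rank, hS, he, -⟩, hb⟩
    have R₁ : Searchable s₂ := (h.of_frame hF₁ rfl rfl).of_frame hF₂ rfl rfl
    simp only [holds_ne, R₁.zero, not_not] at hb
    obtain ⟨e1, e2⟩ := he hb
    unfold SearchState at hS
    rw [e1] at hS
    exact hS.finish h.lists e2

end CutProgram

/-! ## Flows and cuts -/

namespace CutProgram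

open RAM RAM.Prog

/-- Walking back along a path of the search forest. -/
theorem trace_spec {s : State} {body : Prog} {T : ℕ} (h : Searchable s)
    (hD : (graphOf s).Searched (s.arr aVis) (s.arr aPar) (s.reg rFound)) (hf : s.reg rFound ≠ 0)
    (hk : ([rE, rOne, rZero, rN].all fun x => !body.writesReg x) = true)
    (hk' : ([aFrom, aPar].all fun x => !body.writesArr x) = true)
    {rank : ℕ → ℕ} (hF : (graphOf s).IsForest (s.arr aVis) (s.arr aPar) rank)
    (hr : ∀ v < s.reg rN, s.arr aVis v ≠ 0 → rank v < s.reg rN)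
    (Inv : ℕ → (ℕ → ℕ → ℕ) → Prop) (h₀ : Inv (s.reg rFound - 1) s.arr)
    (hs : ∀ v e s', Frame (trace body) s s' → v < s.reg rN → s.arr aVis v ≠ 0 →
      s.arr aPar v = e + 1 → e < s.reg rM2 → s.arr aTo e = v → s.arr aVis (s.arr aFrom e) ≠ 0 →
      rank (s.arr aFrom e) < rank v → s'.reg rE = e → Inv v s'.arr →
      Runs body s' T fun s'' => Inv (s.arr aFrom e) s''.arr) :
    Runs (trace body) s ((T + 5) * s.reg rN + 3)
      fun s' => ∃ v < s.reg rN, s.arr aX v ≠ 0 ∧ Inv v s'.arr := by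
  simp only [List.all_cons, List.all_nil, Bool.and_true, Bool.and_eq_true,
    Bool.not_eq_true'] at hk hk'
  obtain ⟨k1, k2, k3, k4⟩ := hk
  obtain ⟨k5, k6⟩ := hk'
  obtain ⟨y1, y2, y3⟩ := hD.found hf
  have hfr : ∀ {s₁ s₂ : State}, Frame (sub rE rArc rOne ;; body ;; ld rV aFrom rE ;;
      ld rArc aPar rV) s₁ s₂ → Frame (trace body) s₁ s₂ := by
    intro s₁ s₂ hF
    refine hF.mono (fun x => ?_) (fun x => ?_) <;>
      simp only [trace, Prog.writesReg, Prog.writesArr, Bool.or_eq_false_iff] <;> tauto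
  have h01 : Frame (trace body) s ((s.setReg rV (s.reg rFound - 1)).setReg rArc
      (s.arr aPar (s.reg rFound - 1))) := by
    constructor
    · intro x hx
      simp only [trace, Prog.writesReg, Instr.writesReg, Bool.or_eq_false_iff, beq_eq_false_iff_ne]
        at hx
      simp [hx.1.symm, hx.2.1.symm]
    · intro x hx; rfl
  -- Forest ranks fall along the parent arcs and lie below n, so the walk takes at most n rounds;
  -- the loop's rank is 0 exactly at a vertex without a parent arc.
  refine Runs.mono (T := (T + 3 + 1) * s.reg rN + 1 + 1 + 1)
    (Runs.step <| Runs.step <| (Runs.loop (T := T + 3) (N := s.reg rN)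
      (fun c s' => ∃ v < s.reg rN, s.arr aVis v ≠ 0 ∧ s'.reg rArc = s.arr aPar v ∧ Inv v s'.arr ∧
        (if s.arr aPar v = 0 then 0 else rank v + 1) ≤ c) ?_ ?_)) ?_ ?_
  · refine ⟨s.reg rFound - 1, y1, y2, ?_, ?_, ?_⟩
    · simp [Instr.apply, h.one]
    · simpa [Instr.apply] using h₀
    · have := hr _ y1 y2
      split_ifs <;> omega
  · rintro c s₂ hF₂ ⟨v, hv, hvis, ha, hI, hc⟩ hb
    have hF₂' : Frame (trace body) s s₂ := by
      refine h01.trans ?_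
      have := hfr hF₂
      simpa [Instr.apply, h.one] using this
    have e0 : s₂.reg rOne = 1 := by
      rw [hF₂'.reg rOne (by simp [trace, Prog.writesReg, Instr.writesReg, k2]), h.one]
    have e1 : s₂.reg rZero = 0 := by
      rw [hF₂'.reg rZero (by simp [trace, Prog.writesReg, Instr.writesReg, k3]), h.zero]
    have ea : s₂.arr aFrom = s.arr aFrom :=
      hF₂'.arr aFrom (by simp [trace, Prog.writesArr, Instr.writesArr, k5])
    have eb : s₂.arr aPar = s.arr aPar :=
      hF₂'.arr aPar (by simp [trace, Prog.writesArr, Instr.writesArr, k6])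
    simp only [holds_ne, e1, ha] at hb
    rw [if_neg hb] at hc
    obtain ⟨f1, f2, f3, f4, f5, f6⟩ := (hF v hv hvis).resolve_left (fun h => hb h.1)
    obtain ⟨e, he⟩ := Nat.exists_eq_succ_of_ne_zero hb
    have hsub : s.arr aPar v - 1 = e := by omega
    rw [hsub] at f3 f4 f5 f6
    have hM : e < s.reg rM2 := by
      have : s.arr aPar v ≤ s.reg rM2 := f2
      omega
    refine Runs.mono (T := (T + (1 + 1)) + 1) (Runs.step (Runs.seq ((hs v e _ ?_ hv hvis he hM f3 f5
      f6 ?_ ?_).mono le_rfl ?_))) (by omega) (fun _ _ h => h)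
    · refine hF₂'.trans (((Instr.sub rE rArc rOne).frame s₂).mono (fun x => ?_) (fun x => ?_)) <;>
      simp only [trace, Prog.writesReg, Prog.writesArr, Bool.or_eq_false_iff] <;> tauto
    · simp [Instr.apply, e0, ha, hsub]
    · simpa [Instr.apply] using hI
    · intro s₃ hF₃ hI'
      refine Runs.step (Runs.instr ?_ le_rfl)
      have g1 : s₃.reg rE = e := by
        rw [hF₃.reg rE k1]; simp [Instr.apply, e0, ha, hsub]
      have g2 : s₃.arr aFrom = s.arr aFrom := by
        rw [hF₃.arr aFrom k5]; simp [Instr.apply, ea]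
      have g3 : s₃.arr aPar = s.arr aPar := by
        rw [hF₃.arr aPar k6]; simp [Instr.apply, eb]
      refine ⟨if s.arr aPar (s.arr aFrom e) = 0 then 0 else rank (s.arr aFrom e) + 1, ?_,
        s.arr aFrom e, h.lists.src_lt e hM, f5, ?_, ?_, le_rfl⟩
      · change rank (s.arr aFrom e) < rank v at f6
        split_ifs <;> omega
      · simp [Instr.apply, g1, g2, g3]
      · simpa [Instr.apply] using hI'
  · ring_nf; omega
  · rintro s' hF' ⟨⟨c, v, hv, hvis, ha, hI, -⟩, hb⟩
    have e1 : s'.reg rZero = 0 := by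
      rw [hF'.reg rZero (by simp [trace, Prog.writesReg, Instr.writesReg, k3]), h.zero]
    simp only [holds_ne, e1, not_not, ha] at hb
    exact ⟨v, hv, ((hF v hv hvis).resolve_right (fun h => h.1 hb)).2, hI⟩

/-- A network: vertices, arcs, and the indicators of the two sets of terminals. -/
structure Net where
  n : ℕ
  m : ℕ
  tail : ℕ → ℕ
  head : ℕ → ℕ
  xs : ℕ → ℕ
  ys : ℕ → ℕ

/-! ### Cut values, residual states and labellings, apart from any memory -/

namespace Net

variable (N : Net)

/-- `S` contains the sources but no target. -/
structure Side (S : ℕ → Prop) : Prop where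
  source : ∀ v < N.n, N.xs v ≠ 0 → S v
  target : ∀ v < N.n, N.ys v ≠ 0 → ¬ S v

open Classical in
/-- The indicator of a proposition. -/
noncomputable def ind (p : Prop) : ℤ := if p then 1 else 0

/-- The net amount of flow that leaves `S`. -/
noncomputable def value (f : ℕ → ℕ) (S : ℕ → Prop) : ℤ :=
  ∑ e ∈ Finset.range N.m, (f e : ℤ) * (ind (S (N.tail e)) - ind (S (N.head e)))

open Classical in
/-- The arcs that leave `S`. -/
noncomputable def out (S : ℕ → Prop) : Finset ℕ :=
  (Finset.range N.m).filter fun e => S (N.tail e) ∧ ¬ S (N.head e)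

theorem mem_out {S : ℕ → Prop} {e : ℕ} :
    e ∈ N.out S ↔ e < N.m ∧ S (N.tail e) ∧ ¬ S (N.head e) := by
  simp [out]

variable {N}

theorem value_zero (S : ℕ → Prop) {f : ℕ → ℕ} (hf : ∀ e < N.m, f e = 0) : N.value f S = 0 := by
  refine Finset.sum_eq_zero fun e he => ?_
  rw [hf e (by simpa using he)]; simp

theorem value_congr (S : ℕ → Prop) {f g : ℕ → ℕ} (h : ∀ e < N.m, f e = g e) :
    N.value f S = N.value g S := by
  refine Finset.sum_congr rfl fun e he => ?_
  rw [h e (by simpa using he)]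

/-- The value is linear in the flow, so a change on one arc matters only to the sets that this arc
crosses, with a sign for the direction. All steps along a path reduce to this. -/
theorem value_update (S : ℕ → Prop) {f : ℕ → ℕ} {e c : ℕ} (he : e < N.m) :
    N.value (Function.update f e c) S =
      N.value f S + ((c : ℤ) - f e) * (ind (S (N.tail e)) - ind (S (N.head e))) := by
  have hm : e ∈ Finset.range N.m := by simpa using he
  unfold value
  rw [← Finset.add_sum_erase _ _ hm, ← Finset.add_sum_erase _ _ hm, Function.update_self]
  have : ∑ x ∈ (Finset.range N.m).erase e,
      ((Function.update f e c x : ℕ) : ℤ) * (ind (S (N.tail x)) - ind (S (N.head x))) =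
      ∑ x ∈ (Finset.range N.m).erase e,
        (f x : ℤ) * (ind (S (N.tail x)) - ind (S (N.head x))) := by
    refine Finset.sum_congr rfl fun x hx => ?_
    rw [Function.update_of_ne (Finset.ne_of_mem_erase hx)]
  rw [this]; ring

/-- Equality case of weak duality: outgoing arcs are saturated and incoming ones are empty, while
arcs inside or outside contribute nothing. -/
theorem value_eq_sum_out (S : ℕ → Prop) {f cap : ℕ → ℕ}
    (h₁ : ∀ e < N.m, S (N.tail e) → ¬ S (N.head e) → f e = cap e)
    (h₂ : ∀ e < N.m, ¬ S (N.tail e) → S (N.head e) → f e = 0) :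
    N.value f S = ∑ e ∈ N.out S, cap e := by
  classical
  unfold value out
  rw [Finset.sum_filter]
  push_cast
  refine Finset.sum_congr rfl fun e he => ?_
  have he : e < N.m := by simpa using he
  by_cases h : S (N.tail e) <;> by_cases h' : S (N.head e) <;> simp [ind, h, h']
  · exact h₁ e he h h'
  · exact h₂ e he h h'

theorem value_le_sum_out (S : ℕ → Prop) {f cap : ℕ → ℕ} (h : ∀ e < N.m, f e ≤ cap e) :
    N.value f S ≤ ∑ e ∈ N.out S, cap e := by
  classical
  unfold value out
  rw [Finset.sum_filter]
  push_cast
  refine Finset.sum_le_sum fun e he => ?_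
  have he := h e (by simpa using he)
  by_cases h : S (N.tail e) <;> by_cases h' : S (N.head e) <;> simp [ind, h, h']
  exact he

/-- This shows that a search along flow arcs cannot fail while flow remains: its visited set would
be a side that no flow leaves. -/
theorem value_nonpos (S : ℕ → Prop) {f : ℕ → ℕ}
    (h : ∀ e < N.m, S (N.tail e) → f e ≠ 0 → S (N.head e)) : N.value f S ≤ 0 := by
  refine Finset.sum_nonpos fun e he => ?_
  have he := h e (by simpa using he)
  by_cases h : S (N.tail e) <;> by_cases h' : S (N.head e) <;> simp_all [ind]

/-- A residual state of the capacities `cap`: entry `e` is the residual capacity of the arc `e`,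
and entry `m + e` its flow. The flow has value `c + 1` out of the sides that contain `v`, and value
`c` out of the other sides. -/
structure Residual (N : Net) (cap r : ℕ → ℕ) (c v : ℕ) : Prop where
  cap_eq : ∀ e < N.m, r e + r (N.m + e) = cap e
  value_eq : ∀ S, N.Side S → N.value (fun e => r (N.m + e)) S = c + ind (S v)

/-- Pushing a unit through a residual arc. -/
theorem Residual.push_forward {cap r : ℕ → ℕ} {c e : ℕ} (he : e < N.m)
    (h : N.Residual cap r c (N.head e)) (hr : r e ≠ 0) :
    N.Residual cap (Function.update (Function.update r e (r e - 1)) (N.m + e)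
      (r (N.m + e) + 1)) c (N.tail e) := by
  constructor
  · intro e' he'
    have := h.cap_eq e' he'
    by_cases hee : e' = e
    · subst hee
      rw [Function.update_of_ne (by omega), Function.update_self, Function.update_self]
      omega
    · rw [Function.update_of_ne (by omega), Function.update_of_ne hee,
        Function.update_of_ne (by omega), Function.update_of_ne (by omega), this]
  · intro S hS
    have hv := h.value_eq S hS
    have : N.value (fun e' => (Function.update (Function.update r e (r e - 1)) (N.m + e)
        (r (N.m + e) + 1)) (N.m + e')) S =
        N.value (Function.update (fun e => r (N.m + e)) e (r (N.m + e) + 1)) S := by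
      refine value_congr S fun e' he' => ?_
      by_cases hee : e' = e
      · subst hee; simp
      · rw [Function.update_of_ne (by omega), Function.update_of_ne (by omega),
          Function.update_of_ne hee]
    rw [this, value_update S he, hv]
    push_cast; ring

/-- The residual arc `m + e` runs from head to tail, and using it cancels a unit on `e`. Hence the
current vertex moves to the head. -/
theorem Residual.push_backward {cap r : ℕ → ℕ} {c e : ℕ} (he : e < N.m)
    (h : N.Residual cap r c (N.tail e)) (hr : r (N.m + e) ≠ 0) :
    N.Residual cap (Function.update (Function.update r (N.m + e) (r (N.m + e) - 1)) e
      (r e + 1)) c (N.head e) := by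
  constructor
  · intro e' he'
    have := h.cap_eq e' he'
    by_cases hee : e' = e
    · subst hee
      rw [Function.update_self, Function.update_of_ne (by omega), Function.update_self]
      omega
    · rw [Function.update_of_ne hee, Function.update_of_ne (by omega),
        Function.update_of_ne (by omega), Function.update_of_ne (by omega), this]
  · intro S hS
    have hv := h.value_eq S hS
    have : N.value (fun e' => (Function.update (Function.update r (N.m + e) (r (N.m + e) - 1)) e
        (r e + 1)) (N.m + e')) S =
        N.value (Function.update (fun e => r (N.m + e)) e (r (N.m + e) - 1)) S := by
      refine value_congr S fun e' he' => ?_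
      by_cases hee : e' = e
      · subst hee; rw [Function.update_of_ne (by omega)]; simp
      · rw [Function.update_of_ne (by omega), Function.update_of_ne (by omega),
          Function.update_of_ne hee]
    rw [this, value_update S he, hv]
    push_cast [Nat.one_le_iff_ne_zero.2 hr]; ring

/-- A decomposition of a flow after `j` paths: `r` is the flow that remains, of value `c` out of
the sides that do not contain `v` and `c - 1` out of those that do. -/
structure Labelled (N : Net) (cap r lab : ℕ → ℕ) (c : ℤ) (j v : ℕ) : Prop where
  le_cap : ∀ e < N.m, r e ≤ cap e
  value_eq : ∀ S, N.Side S → N.value r S = c - ind (S v)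
  used : ∀ e < N.m, cap e = 1 → lab e ≠ 0 → r e = 0
  lab_le : ∀ e < N.m, lab e ≤ j
  crossing : ∀ S, N.Side S → ∀ i, 1 ≤ i → i < j → ∃ e ∈ N.out S, lab e = i ∨ cap e ≠ 1
  last : ∀ S, N.Side S → S v → ∃ e ∈ N.out S, lab e = j ∨ cap e ≠ 1

/-- A labelled arc of capacity 1 carries no flow any more, so no path found later can relabel it.
Arcs of larger capacity may lose labels, which the alternative `cap e ≠ 1` permits. A side
containing the tail is crossed by `e` itself or, if it contains the head too, by the part of the
path already treated. -/
theorem Labelled.step {cap r lab : ℕ → ℕ} {c : ℤ} {j e : ℕ} (he : e < N.m)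
    (h : N.Labelled cap r lab c j (N.head e)) (hr : r e ≠ 0) :
    N.Labelled cap (Function.update r e (r e - 1)) (Function.update lab e j) c j (N.tail e) := by
  have keep : ∀ S, ∀ i, 1 ≤ i → (∃ e ∈ N.out S, lab e = i ∨ cap e ≠ 1) →
      ∃ e' ∈ N.out S, Function.update lab e j e' = i ∨ cap e' ≠ 1 := by
    rintro S i hi ⟨e', h1, h2⟩
    refine ⟨e', h1, ?_⟩
    by_cases hee : e' = e
    · subst hee
      right
      intro hc
      refine hr (h.used _ he hc ?_)
      have := h2.resolve_right (fun h => h hc)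
      -- Labels start at 1, so an arc with label `i ≥ 1` is labelled and `used` applies.
      omega
    · rwa [Function.update_of_ne hee]
  constructor
  · intro e' he'
    have := h.le_cap e' he'
    by_cases hee : e' = e
    · subst hee; rw [Function.update_self]; omega
    · rwa [Function.update_of_ne hee]
  · intro S hS
    rw [value_update S he, h.value_eq S hS]
    push_cast [Nat.one_le_iff_ne_zero.2 hr]; ring
  · intro e' he' hc hl
    have h1 := h.le_cap e' he'
    by_cases hee : e' = e
    · subst hee; rw [Function.update_self]; omega
    · rw [Function.update_of_ne hee] at hl ⊢
      exact h.used e' he' hc hl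
  · intro e' he'
    by_cases hee : e' = e
    · subst hee; rw [Function.update_self]
    · rw [Function.update_of_ne hee]; exact h.lab_le e' he'
  · intro S hS i hi hij
    exact keep S i hi (h.crossing S hS i hi hij)
  · intro S hS hv
    by_cases hh : S (N.head e)
    · by_cases hj : 1 ≤ j
      · exact keep S j hj (h.last S hS hh)
      · obtain ⟨e', h1, h2⟩ := h.last S hS hh
        refine ⟨e', h1, ?_⟩
        by_cases hee : e' = e
        · subst hee; left; rw [Function.update_self]
        · rwa [Function.update_of_ne hee]
    · exact ⟨e, (mem_out N).2 ⟨he, hv, hh⟩, Or.inl (by rw [Function.update_self])⟩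

/-- What the flow computation finds out about the capacities `cap`, with the bound `k` on the
value: the value `c`, a minimum cut `side`, and labels `1, …, c` such that every cut contains an
arc with each label, apart from arcs with large capacities. -/
structure Analyzed (N : Net) (k : ℕ) (cap side lab : ℕ → ℕ) (c : ℕ) : Prop where
  le_sum : ∀ S, N.Side S → c ≤ ∑ e ∈ N.out S, cap e
  is_side : c ≤ k → N.Side fun v => side v ≠ 0
  sum_eq : c ≤ k → ∑ e ∈ N.out (fun v => side v ≠ 0), cap e = c
  lab_le : ∀ e < N.m, lab e ≤ c
  crossing : ∀ S, N.Side S → ∀ i, 1 ≤ i → i ≤ c → ∃ e ∈ N.out S, lab e = i ∨ cap e ≠ 1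
  le_succ : c ≤ k + 1

end Net

end CutProgram

/-! ## The flow computation -/

namespace CutProgram

open RAM RAM.Prog

/-- The memory holds the network `N` and its residual graph. -/
structure HoldsNet (N : Net) (s : State) : Prop where
  search : Searchable s
  n_eq : s.reg rN = N.n
  m_eq : s.reg rM = N.m
  M_eq : s.reg rM2 = 2 * N.m
  le : s.reg rM2 ≤ s.reg rB
  xs_eq : s.arr aX = N.xs
  ys_eq : s.arr aY = N.ys
  forward : ∀ e < N.m, s.arr aFrom e = N.tail e ∧ s.arr aTo e = N.head e ∧ s.arr aRev e = N.m + e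
  backward : ∀ e < N.m, s.arr aFrom (N.m + e) = N.head e ∧ s.arr aTo (N.m + e) = N.tail e ∧
    s.arr aRev (N.m + e) = e

/-- The program preserves the registers and arrays of the setup. -/
def keeps (p : Prog) : Bool :=
  ([rN, rM, rL, rZero, rOne, rK, rK1, rM2, rB, rLen].all fun x => !p.writesReg x) &&
  ([aSrc, aTgt, aX, aY, aBudget, aColor, aFrom, aTo, aRev, aFirst, aNext].all
    fun a => !p.writesArr a)

/-- The memories agree on the registers and arrays of the setup. -/
structure SameSetup (s s' : State) : Prop where
  reg : ∀ x ∈ [rN, rM, rL, rZero, rOne, rK, rK1, rM2, rB, rLen], s'.reg x = s.reg x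
  arr : ∀ a ∈ [aSrc, aTgt, aX, aY, aBudget, aColor, aFrom, aTo, aRev, aFirst, aNext],
    s'.arr a = s.arr a

theorem SameSetup.of_frame {p : Prog} {s s' : State} (hF : Frame p s s') (h : keeps p = true) :
    SameSetup s s' := by
  simp only [keeps, Bool.and_eq_true, List.all_eq_true, Bool.not_eq_true'] at h
  exact ⟨fun x hx => hF.reg x (h.1 x hx), fun a ha => hF.arr a (h.2 a ha)⟩

theorem SameSetup.refl (s : State) : SameSetup s s := ⟨fun _ _ => rfl, fun _ _ => rfl⟩

theorem SameSetup.trans {s s' s'' : State} (h : SameSetup s s') (h' : SameSetup s' s'') :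
    SameSetup s s'' :=
  ⟨fun x hx => (h'.reg x hx).trans (h.reg x hx), fun x hx => (h'.arr x hx).trans (h.arr x hx)⟩

theorem HoldsNet.congr {N : Net} {s s' : State} (h : HoldsNet N s) (hs : SameSetup s s') :
    HoldsNet N s' := by
  obtain ⟨hr, ha⟩ := hs
  have r0 := hr rN (by decide)
  have r1 := hr rM (by decide)
  have r3 := hr rZero (by decide)
  have r4 := hr rOne (by decide)
  have r7 := hr rM2 (by decide)
  have r8 := hr rB (by decide)
  have a2 := ha aX (by decide)
  have a3 := ha aY (by decide)
  have a7 := ha aFrom (by decide)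
  have a8 := ha aTo (by decide)
  have a9 := ha aRev (by decide)
  have a10 := ha aFirst (by decide)
  have a11 := ha aNext (by decide)
  obtain ⟨⟨h1, h2, ⟨l1, l2, l3, l4⟩, h4, h5⟩, h6, h7, h8, h9, h10, h11, h12, h13⟩ := h
  simp only [graphOf] at l1 l2 l3 l4
  refine ⟨⟨?_, ?_, ⟨?_, ?_, ?_, ?_⟩, ?_, ?_⟩, ?_, ?_, ?_, ?_, ?_, ?_, ?_, ?_⟩ <;>
    simpa only [graphOf, r0, r1, r3, r4, r7, r8, a2, a3, a7, a8, a9, a10, a11]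

theorem HoldsNet.of_frame {N : Net} {p : Prog} {s s' : State} (h : HoldsNet N s)
    (hF : Frame p s s') (hp : keeps p = true) : HoldsNet N s' :=
  h.congr (.of_frame hF hp)

/-- A residual state of a flow of value `c`. -/
structure Net.Flow (N : Net) (cap r : ℕ → ℕ) (c : ℕ) : Prop where
  cap_eq : ∀ e < N.m, r e + r (N.m + e) = cap e
  value_eq : ∀ S, N.Side S → N.value (fun e => r (N.m + e)) S = c

/-- When the walk is at `v`, a unit has been pushed from `v` to the target found, so exactly the
sides that contain `v` have gained one. No side contains the target and every side contains the
root, which turns `c` into `c + 1`. The second half of the invariant keeps the rest of the path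
usable. -/
theorem augment_spec {N : Net} {s : State} {cap : ℕ → ℕ} {c : ℕ} (h : HoldsNet N s)
    (hD : (graphOf s).Searched (s.arr aVis) (s.arr aPar) (s.reg rFound)) (hf : s.reg rFound ≠ 0)
    (hR : N.Flow cap (s.arr aRes) c) :
    Runs (trace push) s (17 * N.n + 3) fun s' => N.Flow cap (s'.arr aRes) (c + 1) := by
  obtain ⟨rank, hF, hr⟩ := hD.forest
  obtain ⟨y1, y2, y3⟩ := hD.found hf
  have hle := h.le
  have hM := h.M_eq
  refine (trace_spec (T := 12) h.search hD hf rfl rfl hF hr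
    (fun v A => N.Residual cap (A aRes) c v ∧ ∀ u < s.reg rN, s.arr aVis u ≠ 0 →
      rank u ≤ rank v → s.arr aPar u ≠ 0 → A aRes (s.arr aPar u - 1) ≠ 0) ?_ ?_).mono ?_ ?_
  · refine ⟨⟨hR.cap_eq, fun S hS => ?_⟩, fun u hu hv _ hp => ?_⟩
    · have : ¬ S (s.reg rFound - 1) :=
        hS.target _ (by rw [← h.n_eq]; exact y1) (by rw [← h.ys_eq]; exact y3)
      rw [hR.value_eq S hS]; simp [Net.ind, this]
    · exact ((hF u hu hv).resolve_left (fun h => hp h.1)).2.2.2.1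
  · rintro v e s' hF' hv hvis hpar heM hto hvis' hrank hE ⟨hI, hI'⟩
    have hre : s'.arr aRes e ≠ 0 := by
      have := hI' v hv hvis le_rfl (by omega)
      rwa [hpar, Nat.add_sub_cancel] at this
    have b1 : s'.reg rB = s.reg rB := hF'.reg rB rfl
    have b2 : s'.reg rOne = 1 := (hF'.reg rOne rfl).trans h.search.one
    have b3 : s'.arr aRev = s.arr aRev := hF'.arr aRev rfl
    obtain ⟨f, hfM, hfe, hrev, hres⟩ : ∃ f < s.reg rM2, f ≠ e ∧ s.arr aRev e = f ∧
        N.Residual cap (Function.update (Function.update (s'.arr aRes) e (s'.arr aRes e - 1)) f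
          (s'.arr aRes f + 1)) c (s.arr aFrom e) := by
      by_cases he : e < N.m
      · obtain ⟨f1, f2, f3⟩ := h.forward e he
        refine ⟨N.m + e, by omega, by omega, f3, ?_⟩
        rw [f1]
        refine Net.Residual.push_forward he ?_ hre
        rwa [← f2, hto]
      · obtain ⟨e', rfl⟩ := Nat.exists_eq_add_of_le (not_lt.1 he)
        obtain ⟨f1, f2, f3⟩ := h.backward e' (by omega)
        refine ⟨e', by omega, by omega, f3, ?_⟩
        rw [f1]
        refine Net.Residual.push_backward (by omega) ?_ hre
        rwa [← f2, hto]
    refine Runs.of_loopFree rfl (by decide) ?_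
    have g1 : e < s.reg rB := by omega
    have g2 : f < s.reg rB := by omega
    have ev : (push.eval s').arr aRes = Function.update (Function.update (s'.arr aRes) e
        (s'.arr aRes e - 1)) f (s'.arr aRes f + 1) := by
      simp [push, hE, b1, b2, b3, g1, g2, hrev, hfe]
    rw [ev]
    refine ⟨hres, fun u hu hvu hru hpu => ?_⟩
    have hru' : rank u < rank v := lt_of_le_of_lt hru hrank
    -- The arc `e` enters `v`, so it is not the parent arc of a vertex of smaller rank. The only
    -- other change raises a residual capacity.
    have hne : s.arr aPar u - 1 ≠ e := by
      intro he
      have : s.arr aTo (s.arr aPar u - 1) = u :=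
        ((hF u hu hvu).resolve_left (fun h => hpu h.1)).2.2.1
      rw [he, hto] at this
      subst this; exact lt_irrefl _ hru'
    by_cases hf' : s.arr aPar u - 1 = f
    · rw [hf', Function.update_self]; omega
    · rw [Function.update_of_ne hf', Function.update_of_ne hne]
      exact hI' u hu hvu hru'.le hpu
  · rw [h.n_eq]
  · rintro s' - ⟨v, hv, hx, hI, -⟩
    refine ⟨hI.cap_eq, fun S hS => ?_⟩
    have : S v := hS.source v (by rw [← h.n_eq]; exact hv) (by rw [← h.xs_eq]; exact hx)
    rw [hI.value_eq S hS]; simp [Net.ind, this]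

theorem flowInit_spec {N : Net} {s : State} (h : HoldsNet N s) (hres : s.arr aRes = 0) :
    Runs flowInit s (5 * N.m + 2) fun s' => N.Flow (s.arr aCap) (s'.arr aRes) 0 := by
  have hle := h.le
  have hM := h.M_eq
  refine (Runs.for (T := 3) (N := N.m) (fun j s' => ∀ e, s'.arr aRes e =
    if e < j then s.arr aCap e else 0) rfl rfl (by decide) h.m_eq ?_ ?_).mono le_rfl ?_
  · simp [hres]
  · rintro j s' hj hv hF hI
    have b1 : s'.reg rB = s.reg rB := hF.reg rB rfl
    have b2 : s'.arr aCap = s.arr aCap := hF.arr aCap rfl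
    refine Runs.of_loopFree rfl (by decide) ?_
    have g1 : j < s.reg rB := by omega
    intro e
    simp only [put, eval_seq, eval_ld, eval_storeBelow, State.setReg_reg, State.setReg_arr]
    simp [hv, b1, g1, b2, Function.update_apply, hI]
    split_ifs <;> first | rfl | omega | simp_all
  · rintro s' - hI
    refine ⟨fun e he => by simp [hI, he], fun S _ => ?_⟩
    rw [Net.value_zero S fun e he => by simp [hI]]; simp

/-- The search has shown that the flow is maximum. -/
def Blocked (s : State) : Prop :=
  (graphOf s).Searched (s.arr aVis) (s.arr aPar) (s.reg rFound) ∧ s.reg rFound = 0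

theorem flowBody_spec {N : Net} {s : State} {cap : ℕ → ℕ} (h : HoldsNet N s)
    (hR : N.Flow cap (s.arr aRes) (s.reg rLam)) (hlt : s.reg rLam < s.reg rK1)
    (hgo : s.reg rFlow ≠ 0) :
    Runs flowBody s (100 * (N.n + N.m + 1)) fun s' =>
      N.Flow cap (s'.arr aRes) (s'.reg rLam) ∧
      (s'.reg rFlow = 0 ∧ s'.reg rLam = s.reg rLam ∧ Blocked s' ∨
       s'.reg rFlow = 0 ∧ s'.reg rLam = s.reg rLam + 1 ∧ s'.reg rLam = s.reg rK1 ∨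
       s'.reg rFlow ≠ 0 ∧ s'.reg rLam = s.reg rLam + 1 ∧ s'.reg rLam < s.reg rK1) := by
  refine Runs.mono (T := 40 * (s.reg rN + s.reg rM2 + 1) + (1 + (17 * N.n + 3 + (2 + 1))))
    (Runs.seq ((search_spec h.search).mono le_rfl ?_)) (by rw [h.n_eq, h.M_eq]; omega)
    (fun _ _ h => h)
  intro s₁ hF₁ hD
  have h₁ := h.of_frame hF₁ rfl
  have hG : graphOf s₁ = graphOf s := graphOf_of_frame hF₁ rfl rfl
  have hR₁ : s₁.arr aRes = s.arr aRes := hF₁.arr _ rfl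
  have hl₁ : s₁.reg rLam = s.reg rLam := hF₁.reg _ rfl
  have hk₁ : s₁.reg rK1 = s.reg rK1 := hF₁.reg _ rfl
  have hf₁ : s₁.reg rFlow = s.reg rFlow := hF₁.reg _ rfl
  rw [← hG] at hD
  rw [← hR₁, ← hl₁] at hR
  refine Runs.cond ?_ ?_
  · intro hb
    simp only [holds_eq, h₁.search.zero] at hb
    refine Runs.instr ⟨?_, Or.inl ⟨?_, ?_, ?_⟩⟩ (by omega)
    · simpa [Instr.apply] using hR
    · simp [Instr.apply]
    · simp [Instr.apply, hl₁]
    · exact ⟨by simpa [Instr.apply, graphOf] using hD, by simpa [Instr.apply] using hb⟩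
  · intro hb
    simp only [holds_eq, h₁.search.zero] at hb
    refine Runs.seq ((augment_spec h₁ hD hb hR).mono le_rfl ?_)
    intro s₂ hF₂ hR₂
    have hl₂ : s₂.reg rLam = s.reg rLam := (hF₂.reg _ rfl).trans hl₁
    have hk₂ : s₂.reg rK1 = s.reg rK1 := (hF₂.reg _ rfl).trans hk₁
    have hf₂ : s₂.reg rFlow = s.reg rFlow := (hF₂.reg _ rfl).trans hf₁
    refine Runs.step (Runs.of_loopFree rfl (by decide) ?_)
    rw [hl₁] at hR₂
    by_cases hc : s.reg rLam + 1 < s.reg rK1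
    · simp [Instr.apply, hl₂, hk₂, hc, hR₂, hf₂, hgo]
    · simp [Instr.apply, hl₂, hk₂, hc, hR₂]
      omega

/-- Augmentation stops at value k + 1, because a larger flow value only needs to be recognized. This
limits the number of searches in terms of k. -/
theorem flow_spec {N : Net} {s : State} (h : HoldsNet N s) (hres : s.arr aRes = 0)
    (hK : 1 ≤ s.reg rK1) :
    Runs flow s (101 * (N.n + N.m + 1) * (s.reg rK1 + 2)) fun s' =>
      N.Flow (s.arr aCap) (s'.arr aRes) (s'.reg rLam) ∧ s'.reg rLam ≤ s.reg rK1 ∧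
      (s'.reg rLam < s.reg rK1 → Blocked s') := by
  have e0 := h.n_eq
  refine Runs.mono (T := ((5 * N.m + 2) + (((100 * (N.n + N.m + 1)) + 1) * (s.reg rK1 + 1) + 1 + 1))
    + 1) (Runs.step (Runs.seq ((flowInit_spec (h.of_frame (Instr.frame _ _) rfl)
      (by simpa [Instr.apply] using hres)).mono le_rfl ?_))) ?_ (fun _ _ h => h)
  · intro s₁ hF₁ hI
    have h₁ := (h.of_frame (Instr.frame (.const rLam 0) _) rfl).of_frame hF₁ rfl
    have hl₁ : s₁.reg rLam = 0 := (hF₁.reg _ rfl).trans (by simp [Instr.apply])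
    have hk₁ : s₁.reg rK1 = s.reg rK1 := (hF₁.reg _ rfl).trans (by simp [Instr.apply])
    refine Runs.step ((Runs.loop (T := 100 * (N.n + N.m + 1)) (N := s.reg rK1 + 1) (fun c s' =>
      N.Flow (s.arr aCap) (s'.arr aRes) (s'.reg rLam) ∧ s'.reg rLam ≤ s.reg rK1 ∧
      (s'.reg rFlow = 0 → s'.reg rLam < s.reg rK1 → Blocked s') ∧
      (s'.reg rFlow ≠ 0 → s'.reg rLam < s.reg rK1) ∧
      (s.reg rK1 - s'.reg rLam) + (if s'.reg rFlow = 0 then 0 else 1) ≤ c) ?_ ?_).mono le_rfl ?_)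
    · simp [Instr.apply, hl₁]
      exact ⟨by simpa [Instr.apply] using hI, by omega⟩
    · rintro c s₂ hF₂ ⟨hR, hle, -, hlt, hc⟩ hb
      have h₂ := (h₁.of_frame (Instr.frame (.const rFlow 1) _) rfl).of_frame hF₂ rfl
      have hk₂ : s₂.reg rK1 = s.reg rK1 := (hF₂.reg _ rfl).trans (by simp [Instr.apply, hk₁])
      simp only [holds_ne, h₂.search.zero] at hb
      have hlt' := hlt hb
      rw [if_neg hb] at hc
      refine (flowBody_spec h₂ hR (by omega) hb).mono le_rfl ?_
      rintro s₃ - ⟨hR₃, (⟨c1, c2, c3⟩ | ⟨c1, c2, c3⟩ | ⟨c1, c2, c3⟩)⟩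
      · exact ⟨_, by rw [c1, if_pos rfl]; omega, hR₃, by omega, fun _ _ => c3,
          fun h => absurd c1 h, le_rfl⟩
      · exact ⟨_, by rw [c1, if_pos rfl]; omega, hR₃, by omega, fun _ h => by omega,
          fun h => absurd c1 h, le_rfl⟩
      · exact ⟨_, by rw [if_neg c1]; omega, hR₃, by omega, fun h => absurd h c1,
          fun _ => by omega, le_rfl⟩
    · rintro s₂ hF₂ ⟨⟨c, hR, hle, h1, -, -⟩, hb⟩
      have h₂ := (h₁.of_frame (Instr.frame (.const rFlow 1) _) rfl).of_frame hF₂ rfl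
      simp only [holds_ne, h₂.search.zero, not_not] at hb
      exact ⟨hR, hle, h1 hb⟩
  · have : 0 ≤ (N.n + N.m) * (s.reg rK1) := Nat.zero_le _
    nlinarith

end CutProgram

/-! ### Minimum cut and path labels from a maximum flow -/

namespace CutProgram

open RAM RAM.Prog

theorem record_spec {N : Net} {s : State} (h : HoldsNet N s) :
    Runs record s (5 * N.n + 2) fun s' => ∀ v < N.n, s'.arr aSide v = s.arr aVis v := by
  have hle := h.search.le
  have hn := h.n_eq
  refine (Runs.for (T := 3) (N := N.n) (fun j s' => ∀ v < j, s'.arr aSide v = s.arr aVis v)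
    rfl rfl (by decide) h.n_eq (by simp) ?_).mono le_rfl fun _ _ h => h
  rintro j s' hj hv hF hI
  have b1 : s'.reg rB = s.reg rB := hF.reg rB rfl
  have b2 : s'.arr aVis = s.arr aVis := hF.arr aVis rfl
  have g1 : j < s.reg rB := by omega
  refine Runs.of_loopFree rfl (by decide) ?_
  intro v hv'
  simp [hv, b1, b2, g1, Function.update_apply]
  split_ifs with e
  · rw [e]
  · exact hI v (by omega)

/-- With the flow as residual capacity of the forward arcs and 0 on the backward ones, the same
search program finds paths that carry flow. -/
theorem convert_spec {N : Net} {s : State} (h : HoldsNet N s) :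
    Runs convert s (8 * N.m + 3) fun s' =>
      (∀ e < N.m, s'.arr aRes e = s.arr aRes (N.m + e)) ∧ ∀ e < N.m, s'.arr aRes (N.m + e) = 0 := by
  have hle := h.le
  have hM := h.M_eq
  have hm := h.m_eq
  refine Runs.mono (T := (6 + 2) * N.m + 2 + 1) (Runs.step (Runs.for (T := 6) (N := N.m)
    (fun j s' => s'.reg rY = N.m + j ∧ (∀ e < j, s'.arr aRes e = s.arr aRes (N.m + e) ∧
      s'.arr aRes (N.m + e) = 0) ∧ ∀ e < N.m, j ≤ e → s'.arr aRes (N.m + e) = s.arr aRes (N.m + e))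
    rfl rfl (by decide) (by simpa [Instr.apply] using h.m_eq) (by simp [Instr.apply, hm]) ?_))
    (by omega) ?_
  · rintro j s' hj hv hF ⟨hy, h1, h2⟩
    have b1 : s'.reg rB = s.reg rB := (hF.reg rB rfl).trans (by simp [Instr.apply])
    have b2 : s'.reg rZero = 0 := (hF.reg rZero rfl).trans (by simp [Instr.apply, h.search.zero])
    have g1 : j < s.reg rB := by omega
    have g2 : N.m + j < s.reg rB := by omega
    refine Runs.of_loopFree rfl (by decide) ?_
    simp [hv, b1, b2, g1, g2, hy]
    refine ⟨by omega, fun e he => ?_, fun e he hje => ?_⟩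
    · by_cases hej : e = j
      · subst hej
        simp [Function.update_apply]
        rw [if_neg (by omega), h2 e hj le_rfl]
      · have := h1 e (by omega)
        simp [Function.update_apply, hej]
        rw [if_neg (by omega), if_neg (by omega)]
        exact this
    · simp [Function.update_apply]
      rw [if_neg (by omega), if_neg (by omega)]
      exact h2 e he (by omega)
  · rintro s' - ⟨-, h1, -⟩
    exact ⟨fun e he => (h1 e he).1, fun e he => (h1 e he).2⟩

/-- A decomposition after `j` complete paths. -/
structure Net.Decomposed (N : Net) (cap r lab : ℕ → ℕ) (c j : ℕ) : Prop where
  le_cap : ∀ e < N.m, r e ≤ cap e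
  value_eq : ∀ S, N.Side S → N.value r S = (c : ℤ) - j
  used : ∀ e < N.m, cap e = 1 → lab e ≠ 0 → r e = 0
  lab_le : ∀ e < N.m, lab e ≤ j
  crossing : ∀ S, N.Side S → ∀ i, 1 ≤ i → i ≤ j → ∃ e ∈ N.out S, lab e = i ∨ cap e ≠ 1
  back : ∀ e < N.m, r (N.m + e) = 0

theorem labelPath_spec {N : Net} {s : State} {cap : ℕ → ℕ} {c j : ℕ} (h : HoldsNet N s)
    (hD : (graphOf s).Searched (s.arr aVis) (s.arr aPar) (s.reg rFound)) (hf : s.reg rFound ≠ 0)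
    (ht : s.reg rTag = j + 1) (hR : N.Decomposed cap (s.arr aRes) (s.arr aLab) c j) :
    Runs (trace label) s (11 * N.n + 3) fun s' =>
      N.Decomposed cap (s'.arr aRes) (s'.arr aLab) c (j + 1) := by
  obtain ⟨rank, hF, hr⟩ := hD.forest
  obtain ⟨y1, y2, y3⟩ := hD.found hf
  have hle := h.le
  have hM := h.M_eq
  refine (trace_spec (T := 6) h.search hD hf rfl rfl hF hr
    (fun v A => N.Labelled cap (A aRes) (A aLab) ((c : ℤ) - j) (j + 1) v ∧
      (∀ e < N.m, A aRes (N.m + e) = 0) ∧ ∀ u < s.reg rN, s.arr aVis u ≠ 0 →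
      rank u ≤ rank v → s.arr aPar u ≠ 0 → A aRes (s.arr aPar u - 1) ≠ 0) ?_ ?_).mono ?_ ?_
  · have hS' : ∀ S, N.Side S → ¬ S (s.reg rFound - 1) := fun S hS =>
      hS.target _ (by rw [← h.n_eq]; exact y1) (by rw [← h.ys_eq]; exact y3)
    refine ⟨⟨hR.le_cap, fun S hS => ?_, hR.used, fun e he => (hR.lab_le e he).trans (by omega),
      fun S hS i hi hij => hR.crossing S hS i hi (by omega), fun S hS hy => absurd hy (hS' S hS)⟩,
      hR.back, fun u hu hv _ hp => ?_⟩
    · rw [hR.value_eq S hS]; simp [Net.ind, hS' S hS]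
    · exact ((hF u hu hv).resolve_left (fun h => hp h.1)).2.2.2.1
  · rintro v e s' hF' hv hvis hpar heM hto hvis' hrank hE ⟨hI, hback, hI'⟩
    have hre : s'.arr aRes e ≠ 0 := by
      have := hI' v hv hvis le_rfl (by omega)
      rwa [hpar, Nat.add_sub_cancel] at this
    have b1 : s'.reg rB = s.reg rB := hF'.reg rB rfl
    have b2 : s'.reg rOne = 1 := (hF'.reg rOne rfl).trans h.search.one
    have b3 : s'.reg rTag = j + 1 := (hF'.reg rTag rfl).trans ht
    -- Backward arcs have residual capacity 0 here, so the path uses original arcs only.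
    have he : e < N.m := by
      by_contra he
      obtain ⟨e', rfl⟩ := Nat.exists_eq_add_of_le (not_lt.1 he)
      exact hre (hback e' (by omega))
    obtain ⟨f1, f2, f3⟩ := h.forward e he
    refine Runs.of_loopFree rfl (by decide) ?_
    have g1 : e < s.reg rB := by omega
    have ev : (label.eval s').arr aRes = Function.update (s'.arr aRes) e (s'.arr aRes e - 1) := by
      simp [label, hE, b1, b2, b3, g1]
    have ev' : (label.eval s').arr aLab = Function.update (s'.arr aLab) e (j + 1) := by
      simp [label, hE, b1, b2, b3, g1]
    rw [ev, ev', f1]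
    refine ⟨Net.Labelled.step he ?_ hre, fun e' he' => ?_, fun u hu hvu hru hpu => ?_⟩
    · rwa [← f2, hto]
    · rw [Function.update_of_ne (by omega)]; exact hback e' he'
    · rw [← f1] at hru
      have hru' : rank u < rank v := lt_of_le_of_lt hru hrank
      have hne : s.arr aPar u - 1 ≠ e := by
        intro he
        have : s.arr aTo (s.arr aPar u - 1) = u :=
          ((hF u hu hvu).resolve_left (fun h => hpu h.1)).2.2.1
        rw [he, hto] at this
        subst this; exact lt_irrefl _ hru'
      rw [Function.update_of_ne hne]
      exact hI' u hu hvu hru'.le hpu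
  · rw [h.n_eq]
  · rintro s' - ⟨v, hv, hx, hI, hback, -⟩
    have hS' : ∀ S, N.Side S → S v := fun S hS =>
      hS.source v (by rw [← h.n_eq]; exact hv) (by rw [← h.xs_eq]; exact hx)
    refine ⟨hI.le_cap, fun S hS => ?_, hI.used, hI.lab_le, fun S hS i hi hij => ?_, hback⟩
    · rw [hI.value_eq S hS]; simp [Net.ind, hS' S hS]; ring
    · by_cases hi' : i = j + 1
      · rw [hi']; exact hI.last S hS (hS' S hS)
      · exact hI.crossing S hS i hi (by omega)

/-- Before path `j + 1` a flow of value `c - j > 0` remains, so a target is reached. Cycles of flow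
may survive; they contribute nothing to the value across a side and need no treatment. -/
theorem decompose_spec {N : Net} {s : State} {cap : ℕ → ℕ} {c : ℕ} (h : HoldsNet N s)
    (hc : s.reg rLam = c) (hR : N.Decomposed cap (s.arr aRes) (s.arr aLab) c 0) :
    Runs decompose s ((100 * (N.n + N.m + 1)) * c + 2) fun s' =>
      N.Decomposed cap (s'.arr aRes) (s'.arr aLab) c c := by
  refine (Runs.for (T := (40 * (N.n + 2 * N.m + 1) + (11 * N.n + 3)) + 1) (N := c)
    (fun j s' => N.Decomposed cap (s'.arr aRes) (s'.arr aLab) c j) rfl rfl (by decide) hc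
    (by simpa using hR) ?_).mono ?_ fun _ _ h => h
  · rintro j s₁ hj hv hF₁ hI
    have h₁ := h.of_frame hF₁ rfl
    refine Runs.step (Runs.seq ?_)
    have h₂ := h₁.of_frame (Instr.frame (.succ rTag rJ) _) rfl
    have := search_spec h₂.search
    rw [h₂.n_eq, h₂.M_eq] at this
    refine this.mono le_rfl ?_
    intro s₃ hF₃ hD
    have h₃ := h₂.of_frame hF₃ rfl
    rw [← graphOf_of_frame hF₃ rfl rfl] at hD
    have e1 : s₃.arr aRes = s₁.arr aRes := (hF₃.arr _ rfl).trans (by simp [Instr.apply])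
    have e2 : s₃.arr aLab = s₁.arr aLab := (hF₃.arr _ rfl).trans (by simp [Instr.apply])
    have e3 : s₃.reg rTag = j + 1 := (hF₃.reg _ rfl).trans (by simp [Instr.apply, hv])
    rw [← e1, ← e2] at hI
    have hf : s₃.reg rFound ≠ 0 := by
      intro hf
      -- If no target were found, the visited set would be a side with no flow leaving it,
      -- contradicting the positive value that remains.
      have hS : N.Side fun v => s₃.arr aVis v ≠ 0 := by
        constructor
        · intro v hv hx
          exact hD.roots v (lt_of_lt_of_eq hv h₃.n_eq.symm) (by rw [← h₃.xs_eq] at hx; exact hx)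
        · intro v hv hy hvis
          refine hy ?_
          rw [← h₃.ys_eq]
          exact hD.not_found hf v (lt_of_lt_of_eq hv h₃.n_eq.symm) hvis
      have v1 := hI.value_eq _ hS
      have v2 := Net.value_nonpos (N := N) (fun v => s₃.arr aVis v ≠ 0) (f := s₃.arr aRes)
        (by
          intro e he ht hr
          obtain ⟨f1, f2, -⟩ := h₃.forward e he
          rw [← f2]
          refine hD.closed e ?_ ?_ hr
          · have := h₃.M_eq; simp only [graphOf]; omega
          · simp only [graphOf]; rwa [f1])
      omega
    refine (labelPath_spec h₃ hD hf e3 hI).mono le_rfl ?_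
    intro s₄ _ h₄
    simpa using h₄
  · exact Nat.add_le_add_right (Nat.mul_le_mul_right _ (by omega)) _

/-- Weak duality bounds every cut from below. For `c ≤ k` the recorded set, visited by the failing
search, attains the bound; the decomposition supplies the labels in either case. -/
theorem analysis_spec {N : Net} {s : State} {k : ℕ} (h : HoldsNet N s) (hres : s.arr aRes = 0)
    (hlab : s.arr aLab = 0) (hk : s.reg rK1 = k + 1) :
    Runs analysis s (220 * (N.n + N.m + 1) * (k + 3)) fun s' =>
      N.Analyzed k (s.arr aCap) (s'.arr aSide) (s'.arr aLab) (s'.reg rLam) := by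
  refine Runs.mono (T := 101 * (N.n + N.m + 1) * (s.reg rK1 + 2) + ((5 * N.n + 2) +
    ((8 * N.m + 3) + ((100 * (N.n + N.m + 1)) * (k + 1) + 2)))) (Runs.seq
    ((flow_spec h hres (by omega)).mono le_rfl ?_)) ?_ (fun _ _ h => h)
  · rintro s₁ hF₁ ⟨hR, hle, hB⟩
    have h₁ := h.of_frame hF₁ rfl
    refine Runs.seq ((record_spec h₁).mono le_rfl ?_)
    intro s₂ hF₂ hside
    have h₂ := h₁.of_frame hF₂ rfl
    refine Runs.seq ((convert_spec h₂).mono le_rfl ?_)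
    rintro s₃ hF₃ ⟨hr, hr'⟩
    have h₃ := h₂.of_frame hF₃ rfl
    have e1 : s₂.arr aRes = s₁.arr aRes := hF₂.arr _ rfl
    have e2 : s₃.arr aLab = 0 := by
      rw [hF₃.arr aLab rfl, hF₂.arr aLab rfl, hF₁.arr aLab rfl, hlab]
    have e3 : s₃.reg rLam = s₁.reg rLam := by rw [hF₃.reg rLam rfl, hF₂.reg rLam rfl]
    have e4 : s₃.arr aSide = s₂.arr aSide := hF₃.arr _ rfl
    rw [e1] at hr
    have hcap : ∀ e < N.m, s₁.arr aRes (N.m + e) ≤ s.arr aCap e := fun e he => by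
      have := hR.cap_eq e he; omega
    refine (decompose_spec (cap := s.arr aCap) h₃ e3 ?_).mono
      (Nat.add_le_add_right (Nat.mul_le_mul_left _ (by omega)) _) ?_
    · rw [e2]
      refine ⟨fun e he => by rw [hr e he]; exact hcap e he, fun S hS => ?_, by simp, by simp, ?_, hr'⟩
      · rw [Net.value_congr S hr, hR.value_eq S hS]; simp
      · intro S hS i hi hi'; omega
    · intro s₄ hF₄ hD
      have e5 : s₄.reg rLam = s₁.reg rLam := (hF₄.reg _ rfl).trans e3
      have e6 : s₄.arr aSide = s₂.arr aSide := (hF₄.arr _ rfl).trans e4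
      rw [e5, e6]
      have hside' : s₁.reg rLam ≤ k → N.Side fun v => s₂.arr aSide v ≠ 0 := by
        intro hlt
        obtain ⟨B1, B2⟩ := hB (by omega)
        constructor
        · intro v hv hx
          show s₂.arr aSide v ≠ 0
          rw [hside v hv]
          exact B1.roots v (lt_of_lt_of_eq hv h₁.n_eq.symm) (by rw [← h₁.xs_eq] at hx; exact hx)
        · intro v hv hy
          show ¬ s₂.arr aSide v ≠ 0
          rw [hside v hv]
          intro hvis
          refine hy ?_
          rw [← h₁.ys_eq]
          exact B1.not_found B2 v (lt_of_lt_of_eq hv h₁.n_eq.symm) hvis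
      refine ⟨fun S hS => ?_, hside', fun hlt => ?_, hD.lab_le, hD.crossing, by omega⟩
      · have := Net.value_le_sum_out S hcap
        rw [hR.value_eq S hS] at this
        exact_mod_cast this
      · obtain ⟨B1, B2⟩ := hB (by omega)
        have hl := h₁.search.lists
        have hM := h₁.M_eq
        have hval := hR.value_eq _ (hside' hlt)
        have ht : ∀ e < N.m, N.tail e < N.n := fun e he => by
          rw [← (h₁.forward e he).1, ← h₁.n_eq]
          exact hl.src_lt e (by simp only [graphOf]; omega)
        have hh : ∀ e < N.m, N.head e < N.n := fun e he => by
          rw [← (h₁.forward e he).2.1, ← h₁.n_eq]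
          exact hl.dst_lt e (by simp only [graphOf]; omega)
        -- An unsaturated arc leaving the visited set, or a flow-carrying arc entering it, would
        -- give a residual arc to an unvisited vertex.
        rw [Net.value_eq_sum_out (cap := s.arr aCap)] at hval
        · exact_mod_cast hval
        · intro e he h1 h2
          rw [hside _ (ht e he)] at h1
          rw [hside _ (hh e he)] at h2
          have := hR.cap_eq e he
          obtain ⟨f1, f2, -⟩ := h₁.forward e he
          by_contra hne
          refine h2 ?_
          rw [← f2]
          refine B1.closed e (by simp only [graphOf]; omega) (by simp only [graphOf]; rwa [f1]) ?_
          simp only [graphOf]; omega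
        · intro e he h1 h2
          rw [hside _ (ht e he)] at h1
          rw [hside _ (hh e he)] at h2
          obtain ⟨f1, f2, -⟩ := h₁.backward e he
          by_contra hne
          refine h1 ?_
          rw [← f2]
          exact B1.closed (N.m + e) (by simp only [graphOf]; omega)
            (by simp only [graphOf]; rwa [f1]) hne
  · rw [hk]
    have : 0 ≤ (N.n + N.m) * k := Nat.zero_le _
    nlinarith

end CutProgram

/-! ## Capacities, checks and guesses -/

namespace CutProgram

open RAM RAM.Prog

/-- The network of an instance. -/
noncomputable def netOf (I : MultiBudgetedCut) : Net where
  n := I.n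
  m := I.m
  tail := I.input.arr aSrc
  head := I.input.arr aTgt
  xs := I.input.arr aX
  ys := I.input.arr aY

/-- The arc `e` has the color `i`. -/
def HasColor (I : MultiBudgetedCut) (e i : ℕ) : Prop := I.input.arr aColor (e * I.ℓ + i) ≠ 0

/-- The setup for the instance is complete. -/
structure Ready (I : MultiBudgetedCut) (s : State) : Prop where
  net : HoldsNet (netOf I) s
  l_eq : s.reg rL = I.ℓ
  k_eq : s.reg rK = I.k
  k1_eq : s.reg rK1 = I.k + 1
  len_eq : s.reg rLen = ∑ r ∈ Finset.range (I.k + 1), r * I.ℓ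
  src_eq : s.arr aSrc = I.input.arr aSrc
  tgt_eq : s.arr aTgt = I.input.arr aTgt
  budget_eq : s.arr aBudget = I.input.arr aBudget
  color_eq : s.arr aColor = I.input.arr aColor

theorem Ready.congr {I : MultiBudgetedCut} {s s' : State} (h : Ready I s) (hs : SameSetup s s') :
    Ready I s' where
  net := h.net.congr hs
  l_eq := (hs.reg rL (by decide)).trans h.l_eq
  k_eq := (hs.reg rK (by decide)).trans h.k_eq
  k1_eq := (hs.reg rK1 (by decide)).trans h.k1_eq
  len_eq := (hs.reg rLen (by decide)).trans h.len_eq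
  src_eq := (hs.arr aSrc (by decide)).trans h.src_eq
  tgt_eq := (hs.arr aTgt (by decide)).trans h.tgt_eq
  budget_eq := (hs.arr aBudget (by decide)).trans h.budget_eq
  color_eq := (hs.arr aColor (by decide)).trans h.color_eq

theorem Ready.of_frame {I : MultiBudgetedCut} {p : Prog} {s s' : State} (h : Ready I s)
    (hF : Frame p s s') (hp : keeps p = true) : Ready I s' :=
  h.congr (.of_frame hF hp)

variable {I : MultiBudgetedCut}

theorem Ready.m_eq {s : State} (h : Ready I s) : s.reg rM = I.m := h.net.m_eq

theorem exists_lt_succ_iff {p : ℕ → Prop} {j : ℕ} :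
    (∃ i < j + 1, p i) ↔ (∃ i < j, p i) ∨ p j := by
  constructor
  · rintro ⟨i, hi, h⟩
    by_cases e : i = j
    · exact Or.inr (e ▸ h)
    · exact Or.inl ⟨i, by omega, h⟩
  · rintro (⟨i, hi, h⟩ | h)
    · exact ⟨i, by omega, h⟩
    · exact ⟨j, by omega, h⟩

open Classical in
/-- The initial capacities. -/
noncomputable def initialCap (I : MultiBudgetedCut) (e : ℕ) : ℕ :=
  if e < I.m then if ∃ i < I.ℓ, HasColor I e i then 1 else I.k + 1 else 0

/-- The whole array is determined, also beyond the arcs: flow outcomes are indexed by capacity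
functions, so equality on the arcs alone would not suffice. -/
theorem initCap_spec {s : State} (h : Ready I s) (hcap : ∀ e, I.m ≤ e → s.arr aCap e = 0) :
    Runs initCap s (((8 * I.ℓ + 4) + 2) * I.m + 4) fun s' =>
      s'.arr aCap = initialCap I ∧ s'.reg rP = 0 := by
  classical
  refine Runs.mono (T := (((6 + 2) * I.ℓ + 2 + 1) + 1 + 2) * I.m + 2 + 1 + 1)
    (Runs.step (Runs.step (Runs.for (N := I.m) (T := ((6 + 2) * I.ℓ + 2 + 1) + 1)
    (fun j s' => s'.reg qPos = j * I.ℓ ∧ s'.reg rP = 0 ∧ ∀ e, s'.arr aCap e =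
      if e < j then initialCap I e else s.arr aCap e)
    rfl rfl (by decide) (by simpa [Instr.apply] using h.m_eq) (by simp [Instr.apply]) ?_)))
    (by ring_nf; omega) ?_
  · rintro j s₁ hj hv hF₁ ⟨hpos, hp, hI⟩
    have b1 : s₁.reg rK1 = I.k + 1 := (hF₁.reg _ rfl).trans (by simp [Instr.apply, h.k1_eq])
    have b2 : s₁.reg rL = I.ℓ := (hF₁.reg _ rfl).trans (by simp [Instr.apply, h.l_eq])
    have b3 : s₁.arr aColor = I.input.arr aColor :=
      (hF₁.arr _ rfl).trans (by simp [Instr.apply, h.color_eq])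
    have b4 : s₁.reg rZero = 0 :=
      (hF₁.reg _ rfl).trans (by simp [Instr.apply, h.net.search.zero])
    refine Runs.step (Runs.seq (T := (6 + 2) * I.ℓ + 2) (T' := 1) ((Runs.for (N := I.ℓ) (T := 6) (fun i s' =>
      s'.reg qPos = j * I.ℓ + i ∧
      s'.reg qC = if ∃ i' < i, HasColor I j i' then 1 else I.k + 1)
      rfl rfl (by decide) (by simpa [Instr.apply] using b2)
      (by simp [Instr.apply, hpos, b1]) ?_).mono le_rfl ?_))
    · rintro i s₂ hi hvi hF₂ ⟨hpos₂, hC⟩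
      have c3 : s₂.arr aColor = I.input.arr aColor :=
        (hF₂.arr _ rfl).trans (by simp [Instr.apply, b3])
      have c4 : s₂.reg rZero = 0 := (hF₂.reg _ rfl).trans (by simp [Instr.apply, b4])
      have key : (initColor.eval s₂).reg qPos = j * I.ℓ + i + 1 ∧
          (initColor.eval s₂).reg qC = if HasColor I j i then 1 else s₂.reg qC := by
        by_cases hc : HasColor I j i <;> have hc' := hc <;>
          simp only [HasColor, not_not] at hc' <;>
          simp [initColor, hpos₂, c3, c4, hc', hc]
      refine Runs.of_loopFree rfl (by decide) ⟨?_, ?_⟩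
      · simp only [State.setReg_reg]
        rw [if_neg (by decide), key.1]; ring
      · simp only [State.setReg_reg]
        rw [if_neg (by decide), key.2, hC]
        by_cases hc : HasColor I j i <;> simp only [exists_lt_succ_iff, hc, or_true, or_false,
          if_true, if_false]
    · rintro s₂ hF₂ ⟨hpos₂, hC⟩
      have c1 : s₂.reg qE = j := (hF₂.reg _ rfl).trans (by simp [Instr.apply, hv])
      have c2 : s₂.reg rP = 0 := (hF₂.reg _ rfl).trans (by simp [Instr.apply, hp])
      have c3 : s₂.arr aCap = s₁.arr aCap := (hF₂.arr _ rfl).trans (by simp [Instr.apply])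
      refine Runs.instr ?_ le_rfl
      simp [Instr.apply, c1, c2, c3, hpos₂, hC]
      refine ⟨by ring, fun e => ?_⟩
      rw [Function.update_apply]
      by_cases he : e = j
      · subst he
        simp [initialCap, hj]
      · rw [if_neg he, hI e]
        by_cases he' : e < j
        · rw [if_pos he', if_pos (by omega)]
        · rw [if_neg he', if_neg (by omega)]
  · rintro s' - ⟨-, hp, hI⟩
    refine ⟨funext fun e => ?_, hp⟩
    rw [hI e]
    split_ifs with he
    · rfl
    · rw [hcap e (by omega), initialCap, if_neg he]

/-- The cut that belongs to a side fits into the budgets. -/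
def Fits (I : MultiBudgetedCut) (S : ℕ → Prop) : Prop :=
  ∀ (i : ℕ) (F : Finset ℕ), i < I.ℓ → F ⊆ (netOf I).out S → (∀ e ∈ F, HasColor I e i) →
    F.card ≤ I.input.arr aBudget i

open Classical in
/-- The number of arcs `e < j` of the cut with the color `i`. -/
noncomputable def cutCount (I : MultiBudgetedCut) (S : ℕ → Prop) (j i : ℕ) : ℕ :=
  (((netOf I).out S).filter fun e => e < j ∧ HasColor I e i).card

theorem cutCount_succ (S : ℕ → Prop) (j i : ℕ) [Decidable (j ∈ (netOf I).out S ∧ HasColor I j i)] :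
    cutCount I S (j + 1) i =
      cutCount I S j i + if j ∈ (netOf I).out S ∧ HasColor I j i then 1 else 0 := by
  classical
  unfold cutCount
  split_ifs with h
  · rw [← Finset.card_insert_of_notMem (s := ((netOf I).out S).filter
      fun e => e < j ∧ HasColor I e i) (a := j) (by simp)]
    congr 1
    ext e
    simp only [Finset.mem_filter, Finset.mem_insert]
    constructor
    · rintro ⟨h1, h2, h3⟩
      by_cases he : e = j
      · exact Or.inl he
      · exact Or.inr ⟨h1, by omega, h3⟩
    · rintro (rfl | ⟨h1, h2, h3⟩)
      · exact ⟨h.1, by omega, h.2⟩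
      · exact ⟨h1, by omega, h3⟩
  · rw [add_zero]
    congr 1
    ext e
    simp only [Finset.mem_filter]
    constructor
    · rintro ⟨h1, h2, h3⟩
      refine ⟨h1, ?_, h3⟩
      by_contra hlt
      have : e = j := by omega
      subst this; exact h ⟨h1, h3⟩
    · rintro ⟨h1, h2, h3⟩
      exact ⟨h1, by omega, h3⟩

/-- Bounding every monochromatic subset amounts to bounding the largest one. The subset form suits
the correctness argument, the counting form the program. -/
theorem fits_iff (S : ℕ → Prop) :
    Fits I S ↔ ∀ i < I.ℓ, cutCount I S I.m i ≤ I.input.arr aBudget i := by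
  classical
  constructor
  · intro h i hi
    exact h i _ hi (Finset.filter_subset _ _) (fun e he => (Finset.mem_filter.1 he).2.2)
  · intro h i F hi hF hc
    refine (Finset.card_le_card fun e he => ?_).trans (h i hi)
    exact Finset.mem_filter.2 ⟨hF he, ((Net.mem_out _).1 (hF he)).1, hc e he⟩

-- The color table is traversed row by row with one running position, since the machine has no
-- multiplication to compute `e * ℓ + i`.
open Classical in
theorem count_spec {s : State} (h : Ready I s) :
    Runs count s ((9 * I.ℓ + 14) * (I.m + 1)) fun s' =>
      (∀ i < I.ℓ, s'.arr aCnt i = cutCount I (fun v => s.arr aSide v ≠ 0) I.m i) ∧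
      ∀ e < I.m, s'.arr aOut e = if e ∈ (netOf I).out (fun v => s.arr aSide v ≠ 0) then 1 else 0 := by
  classical
  set S : ℕ → Prop := fun v => s.arr aSide v ≠ 0 with hS
  refine Runs.mono (T := ((1 + 2) * I.ℓ + 2) + ((9 + ((7 + 2) * I.ℓ + 2) + 2) * I.m + 2 + 1))
    (Runs.seq ((Runs.for (N := I.ℓ) (T := 1) (fun j s' => ∀ i < j, s'.arr aCnt i = 0)
    rfl rfl (by decide) h.l_eq (by simp) ?_).mono le_rfl ?_)) (by ring_nf; omega) (fun _ _ h => h)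
  · rintro j s₁ hj hv hF₁ hI
    have b1 : s₁.reg rZero = 0 := (hF₁.reg _ rfl).trans h.net.search.zero
    refine Runs.instr ?_ le_rfl
    intro i hi
    simp [Instr.apply, hv, b1, Function.update_apply]
    intro hij
    exact hI i (by omega)
  · rintro s₁ hF₁ hcnt
    have h₁ := h.of_frame hF₁ rfl
    have d1 : s₁.arr aSide = s.arr aSide := hF₁.arr _ rfl
    refine Runs.step ((Runs.for (N := I.m) (T := 9 + ((7 + 2) * I.ℓ + 2)) (fun j s' =>
      s'.reg qPos = j * I.ℓ ∧ (∀ i < I.ℓ, s'.arr aCnt i = cutCount I S j i) ∧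
      ∀ e < j, s'.arr aOut e = if e ∈ (netOf I).out S then 1 else 0)
      rfl rfl (by decide) (by simpa [Instr.apply] using h₁.m_eq) ?_ ?_).mono le_rfl ?_)
    · simp [Instr.apply]
      intro i hi
      rw [hcnt i hi, cutCount]
      simp
    · rintro j s₂ hj hv hF₂ ⟨hpos, hc, ho⟩
      have h₂ := (h₁.of_frame (Instr.frame (.const qPos 0) _) rfl).of_frame hF₂ rfl
      have d2 : s₂.arr aSide = s.arr aSide := (hF₂.arr _ rfl).trans (by simp [Instr.apply, d1])
      have hz := h₂.net.search.zero
      have hio : j ∈ (netOf I).out S ↔ s.arr aSide (I.input.arr aSrc j) ≠ 0 ∧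
          s.arr aSide (I.input.arr aTgt j) = 0 := by
        rw [Net.mem_out]; simp [netOf, hj, hS]
      have ev : Runs testArc s₂ 9 fun s' => s'.reg qC = (if j ∈ (netOf I).out S then 1 else 0) ∧
          s'.arr aOut = Function.update (s₂.arr aOut) j (if j ∈ (netOf I).out S then 1 else 0) := by
        refine Runs.of_loopFree rfl (by decide) ?_
        by_cases c1 : s.arr aSide (I.input.arr aSrc j) = 0
        · simp [testArc, hv, d2, h₂.src_eq, h₂.tgt_eq, hz, c1, hio]
        · by_cases c2 : s.arr aSide (I.input.arr aTgt j) = 0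
          · simp [testArc, hv, d2, h₂.src_eq, h₂.tgt_eq, hz, c1, c2, hio]
          · simp [testArc, hv, d2, h₂.src_eq, h₂.tgt_eq, hz, c1, c2, hio]
      refine Runs.seq (ev.mono le_rfl ?_)
      rintro s₃ hF₃ ⟨hC, hO⟩
      have h₃ := h₂.of_frame hF₃ rfl
      have e1 : s₃.reg qPos = j * I.ℓ := (hF₃.reg _ rfl).trans hpos
      have e2 : s₃.arr aCnt = s₂.arr aCnt := hF₃.arr _ rfl
      have e3 : s₃.reg qE = j := (hF₃.reg _ rfl).trans hv
      refine (Runs.for (N := I.ℓ) (T := 7) (fun i s' => s'.reg qPos = j * I.ℓ + i ∧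
        ∀ i' < I.ℓ, s'.arr aCnt i' = if i' < i then cutCount I S (j + 1) i'
          else cutCount I S j i') rfl rfl (by decide) h₃.l_eq ?_ ?_).mono le_rfl ?_
      · simp [e1, e2]; exact hc
      · rintro i s₄ hi hvi hF₄ ⟨hpos₄, hc₄⟩
        have h₄ := h₃.of_frame hF₄ rfl
        have hz₄ := h₄.net.search.zero
        have f1 : s₄.reg qC = if j ∈ (netOf I).out S then 1 else 0 := (hF₄.reg _ rfl).trans hC
        have f2 : s₄.arr aCnt i = cutCount I S j i := by rw [hc₄ i hi]; simp
        have key : (countColor.eval s₄).reg qPos = j * I.ℓ + i + 1 ∧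
            ∀ i', (countColor.eval s₄).arr aCnt i' =
              if i' = i then cutCount I S (j + 1) i else s₄.arr aCnt i' := by
          rw [cutCount_succ]
          by_cases c1 : j ∈ (netOf I).out S
          · by_cases c2 : HasColor I j i
            · have c2' := c2
              unfold HasColor at c2'
              simp [countColor, hpos₄, h₄.color_eq, hz₄, f1, f2, c1, c2, c2', hvi,
                Function.update_apply]
            · have c2' := c2
              simp only [HasColor, not_not] at c2'
              simp [countColor, hpos₄, h₄.color_eq, hz₄, f1, f2, c1, c2, c2', hvi]
          · simp [countColor, hpos₄, h₄.color_eq, hz₄, f1, f2, c1, hvi]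
        refine Runs.of_loopFree rfl (by decide) ?_
        refine ⟨by simp only [State.setReg_reg]; rw [if_neg (by decide), key.1]; ring,
          fun i' hi' => ?_⟩
        simp only [State.setReg_arr]
        rw [key.2 i', hc₄ i' hi']
        by_cases e : i' = i
        · subst e; simp
        · rw [if_neg e]
          by_cases e' : i' < i
          · rw [if_pos e', if_pos (by omega)]
          · rw [if_neg e', if_neg (by omega)]
      · rintro s₄ hF₄ ⟨hpos₄, hc₄⟩
        have f1 : s₄.arr aOut = s₃.arr aOut := hF₄.arr _ rfl
        simp only [State.setReg_reg, State.setReg_arr]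
        refine ⟨by rw [if_neg (by decide), hpos₄]; ring, fun i hi => ?_, fun e he => ?_⟩
        · rw [hc₄ i hi, if_pos hi]
        · rw [f1, hO, Function.update_apply]
          by_cases ee : e = j
          · rw [if_pos ee, ee]
          · rw [if_neg ee, ho e (by omega)]
    · rintro s' - ⟨-, h1, h2⟩
      exact ⟨h1, h2⟩

end CutProgram

/-! ### Testing the budgets and raising capacities -/

namespace CutProgram

open RAM RAM.Prog

variable {I : MultiBudgetedCut}

open Classical in
theorem check_spec {s : State} (h : Ready I s) :
    Runs check s ((9 * I.ℓ + 14) * (I.m + 1) + 7 * I.ℓ + 10) fun s' =>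
      s'.reg rDone = (if s.reg rLam ≤ I.k ∧ Fits I (fun v => s.arr aSide v ≠ 0) then 1
        else s.reg rDone) ∧
      ∀ e < I.m, s'.arr aOut e = if e ∈ (netOf I).out (fun v => s.arr aSide v ≠ 0) then 1 else 0 := by
  rw [fits_iff]
  refine Runs.mono (T := (9 * I.ℓ + 14) * (I.m + 1) + ((1 + 1 + (((5 + 2) * I.ℓ + 2) + 2)) + 1))
    (Runs.seq ((count_spec h).mono le_rfl ?_)) (by ring_nf; omega) (fun _ _ h => h)
  rintro s₁ hF₁ ⟨hc, ho⟩
  have h₁ := h.of_frame hF₁ rfl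
  have e1 : s₁.reg rLam = s.reg rLam := hF₁.reg _ rfl
  have e2 : s₁.reg rDone = s.reg rDone := hF₁.reg _ rfl
  have ev : Runs (.cond (.lt rK rLam) (set qGo 0) .skip) (s₁.setReg qGo 1) (1 + 1) fun s' =>
      s'.reg qGo = if s.reg rLam ≤ I.k then 1 else 0 := by
    refine Runs.of_loopFree rfl (by decide) ?_
    by_cases hl : s.reg rLam ≤ I.k
    · simp [h₁.k_eq, e1, hl, not_lt.2 hl]
    · simp [h₁.k_eq, e1, hl, not_le.1 hl]
  refine Runs.step (Runs.seq (ev.mono le_rfl ?_))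
  rintro s₂ hF₂ hgo
  have h₂ := (h₁.of_frame (Instr.frame (.const qGo 1) s₁) rfl).of_frame hF₂ rfl
  have f1 : s₂.reg rDone = s.reg rDone := (hF₂.reg _ rfl).trans (by simp [e2])
  have f2 : s₂.arr aCnt = s₁.arr aCnt := hF₂.arr _ rfl
  have f3 : s₂.arr aOut = s₁.arr aOut := hF₂.arr _ rfl
  refine Runs.seq ((Runs.for (N := I.ℓ) (T := 5) (fun j s' => s'.reg qGo =
    if s.reg rLam ≤ I.k ∧ ∀ i < j, s₂.arr aCnt i ≤ I.input.arr aBudget i then 1 else 0)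
    rfl rfl (by decide) h₂.l_eq (by simp [hgo]) ?_).mono le_rfl ?_)
  · rintro j s₃ hj hv hF₃ hI
    have h₃ := h₂.of_frame hF₃ rfl
    have g1 : s₃.arr aCnt = s₂.arr aCnt := hF₃.arr _ rfl
    refine Runs.of_loopFree rfl (by decide) ?_
    have key : (∀ i < j + 1, s₂.arr aCnt i ≤ I.input.arr aBudget i) ↔
        (∀ i < j, s₂.arr aCnt i ≤ I.input.arr aBudget i) ∧
          s₂.arr aCnt j ≤ I.input.arr aBudget j :=
      ⟨fun h => ⟨fun i hi => h i (by omega), h j (by omega)⟩, fun h i hi => by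
        by_cases e : i = j
        · exact e ▸ h.2
        · exact h.1 i (by omega)⟩
    simp only [key, State.setReg_reg]
    rw [if_neg (by decide)]
    by_cases hc : s₂.arr aCnt j ≤ I.input.arr aBudget j
    · simp [hv, g1, h₃.budget_eq, hI, hc, not_lt.2 hc]
    · simp [hv, g1, h₃.budget_eq, hI, hc, not_le.1 hc]
  · rintro s₃ hF₃ hgo₃
    have h₃ := h₂.of_frame hF₃ rfl
    have g1 : s₃.reg rDone = s.reg rDone := (hF₃.reg _ rfl).trans f1
    have g3 : s₃.arr aOut = s₁.arr aOut := (hF₃.arr _ rfl).trans f3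
    have hz := h₃.net.search.zero
    have hiff : (∀ i < I.ℓ, s₂.arr aCnt i ≤ I.input.arr aBudget i) ↔
        ∀ i < I.ℓ, cutCount I (fun v => s.arr aSide v ≠ 0) I.m i ≤ I.input.arr aBudget i := by
      rw [f2]
      exact forall₂_congr fun i hi => by rw [hc i hi]
    simp only [hiff] at hgo₃
    refine Runs.of_loopFree rfl (by decide) ?_
    split_ifs at hgo₃ ⊢ with hfit
    · simp [hgo₃, hz, g3]; exact ho
    · simp [hgo₃, hz, g3, g1]; exact ho

open Classical in
/-- The capacities after a guess: an arc with the label `j + 1` gets a large capacity if it has a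
color `i` with the bit `p + j ℓ + i` equal to zero. -/
noncomputable def raisedCap (I : MultiBudgetedCut) (lab β : ℕ → ℕ) (p : ℕ) (cap : ℕ → ℕ) (e : ℕ) :
    ℕ :=
  if e < I.m ∧ lab e ≠ 0 ∧ ∃ i < I.ℓ, HasColor I e i ∧ β (p + (lab e - 1) * I.ℓ + i) = 0
    then I.k + 1 else cap e

/-- Tabulating the start of the bits for each label replaces a multiplication by ℓ for each arc; the
read position ends where the bits of the next phase begin. -/
theorem bases_spec {s : State} (h : Ready I s) :
    Runs bases s ((3 * I.ℓ + 5) * s.reg rLam + 2) fun s' =>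
      (∀ j < s.reg rLam, s'.arr aBase j = s.reg rP + j * I.ℓ) ∧
      s'.reg rP = s.reg rP + s.reg rLam * I.ℓ := by
  refine (Runs.for (N := s.reg rLam) (T := (1 + 2) * I.ℓ + 2 + 1) (fun j s' =>
    (∀ j' < j, s'.arr aBase j' = s.reg rP + j' * I.ℓ) ∧ s'.reg rP = s.reg rP + j * I.ℓ)
    rfl rfl (by decide) rfl (by simp) ?_).mono ?_ ?_
  · rintro j s₁ hj hv hF₁ ⟨hb, hp⟩
    have h₁ := h.of_frame hF₁ rfl
    refine Runs.step ((Runs.for (N := I.ℓ) (T := 1) (fun i s' => s'.reg rP = s.reg rP + j * I.ℓ + i)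
      rfl rfl (by decide) (by simpa [Instr.apply] using h₁.l_eq) (by simp [Instr.apply, hp])
      ?_).mono le_rfl ?_)
    · rintro i s₂ hi hvi hF₂ hI
      refine Runs.instr ?_ le_rfl
      simp [Instr.apply, hI]; ring
    · rintro s₂ hF₂ hI
      have e1 : s₂.arr aBase = Function.update (s₁.arr aBase) j (s.reg rP + j * I.ℓ) :=
        (hF₂.arr _ rfl).trans (by simp [Instr.apply, hv, hp])
      refine ⟨fun j' hj' => ?_, ?_⟩
      · simp only [State.setReg_arr]
        rw [e1, Function.update_apply]
        split_ifs with e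
        · rw [e]
        · exact hb j' (by omega)
      · simp only [State.setReg_reg]
        rw [if_neg (by decide), hI]; ring
  · ring_nf; omega
  · exact fun _ _ h => h

theorem elevate_spec {s : State} (h : Ready I s)
    (hlab : ∀ e < I.m, s.arr aLab e ≤ s.reg rLam) :
    Runs elevate s ((3 * I.ℓ + 5) * s.reg rLam + (10 * I.ℓ + 8) * I.m + 5) fun s' =>
      s'.arr aCap = raisedCap I (s.arr aLab) (s.arr aBits) (s.reg rP) (s.arr aCap) ∧
      s'.reg rP = s.reg rP + s.reg rLam * I.ℓ := by
  classical
  refine Runs.mono (T := ((3 * I.ℓ + 5) * s.reg rLam + 2) +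
    (((((8 + 2) * I.ℓ + 2) + 1 + 1 + 1) + 2) * I.m + 2 + 1))
    (Runs.seq ((bases_spec h).mono le_rfl ?_)) (by ring_nf; omega) (fun _ _ h => h)
  rintro s₁ hF₁ ⟨hb, hp⟩
  have h₁ := h.of_frame hF₁ rfl
  have d1 : s₁.arr aLab = s.arr aLab := hF₁.arr _ rfl
  have d2 : s₁.arr aCap = s.arr aCap := hF₁.arr _ rfl
  have d3 : s₁.arr aBits = s.arr aBits := hF₁.arr _ rfl
  set R := raisedCap I (s.arr aLab) (s.arr aBits) (s.reg rP) (s.arr aCap) with hR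
  refine Runs.step ((Runs.for (N := I.m) (T := (((8 + 2) * I.ℓ + 2) + 1 + 1 + 1)) (fun j s' =>
    s'.reg qPos = j * I.ℓ ∧ s'.arr aCap = fun e => if e < j then R e else s.arr aCap e)
    rfl rfl (by decide) (by simpa [Instr.apply] using h₁.m_eq) (by simp [Instr.apply, d2])
    ?_).mono le_rfl ?_)
  · rintro j s₂ hj hv hF₂ ⟨hpos, hcap⟩
    have h₂ := (h₁.of_frame (Instr.frame (.const qPos 0) _) rfl).of_frame hF₂ rfl
    have e1 : s₂.arr aLab = s.arr aLab := (hF₂.arr _ rfl).trans (by simp [Instr.apply, d1])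
    have e2 : s₂.arr aBits = s.arr aBits := (hF₂.arr _ rfl).trans (by simp [Instr.apply, d3])
    have e3 : s₂.arr aBase = s₁.arr aBase := (hF₂.arr _ rfl).trans (by simp [Instr.apply])
    have ho := h₂.net.search.one
    refine Runs.step (Runs.step (Runs.step ?_))
    let P : ℕ → Prop := fun i => s.arr aLab j ≠ 0 ∧
      ∃ i' < i, HasColor I j i' ∧ s.arr aBits (s.reg rP + (s.arr aLab j - 1) * I.ℓ + i') = 0
    -- For an unlabelled arc the truncated `0 - 1` selects the entry of the first label. Nothing is
    -- claimed about `qZ` then, and the test on `qC` discards the bits read.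
    refine (Runs.for (N := I.ℓ) (T := 8) (fun i s' =>
      s'.reg qPos = j * I.ℓ + i ∧
      (s.arr aLab j ≠ 0 → s'.reg qZ = s.reg rP + (s.arr aLab j - 1) * I.ℓ + i) ∧
      s'.arr aCap = if P i then Function.update (s₂.arr aCap) j (I.k + 1) else s₂.arr aCap)
      rfl rfl (by decide) (by simpa [Instr.apply] using h₂.l_eq) ?_ ?_).mono le_rfl ?_
    · simp [Instr.apply, hpos, hv, e1, ho, e3, P]
      intro hl
      exact hb _ (by have := hlab j hj; omega)
    · rintro i s₃ hi hvi hF₃ ⟨hpos₃, hz₃, hcap₃⟩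
      have f0 : SameSetup s₂ s₃ := by
        have : SameSetup (((((Instr.load qC aLab qE).apply s₂)).setReg qZ 0).setReg qZ 0) s₃ := by
          refine SameSetup.trans (s' := (Instr.load qZ aBase qZ).apply
            ((Instr.sub qZ qC rOne).apply ((Instr.load qC aLab qE).apply s₂))) ?_
            (.of_frame hF₃ rfl)
          constructor <;> intro x hx <;> fin_cases hx <;> simp [Instr.apply]
        refine SameSetup.trans ?_ this
        constructor <;> intro x hx <;> fin_cases hx <;> simp [Instr.apply]
      have h₃ := h₂.congr f0
      have hz := h₃.net.search.zero
      have f1 : s₃.reg qC = s.arr aLab j := (hF₃.reg _ rfl).trans (by simp [Instr.apply, hv, e1])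
      have f2 : s₃.reg qE = j := (hF₃.reg _ rfl).trans (by simp [Instr.apply, hv])
      have f3 : s₃.arr aBits = s.arr aBits := (hF₃.arr _ rfl).trans (by simp [Instr.apply, e2])
      have hP : P (i + 1) ↔ P i ∨ (s.arr aLab j ≠ 0 ∧ HasColor I j i ∧
          s.arr aBits (s.reg rP + (s.arr aLab j - 1) * I.ℓ + i) = 0) := by
        simp only [P, exists_lt_succ_iff, and_or_left]
      have key : (elevateColor.eval s₃).reg qPos = j * I.ℓ + i + 1 ∧
          (elevateColor.eval s₃).reg qZ = s₃.reg qZ + 1 ∧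
          (elevateColor.eval s₃).arr aCap = if s.arr aLab j ≠ 0 ∧ HasColor I j i ∧
            s.arr aBits (s.reg rP + (s.arr aLab j - 1) * I.ℓ + i) = 0 then
            Function.update (s₃.arr aCap) j (I.k + 1) else s₃.arr aCap := by
        by_cases c1 : s.arr aLab j = 0
        · simp [elevateColor, hpos₃, f1, c1, hz]
        · have hz₃' := hz₃ c1
          by_cases c2 : HasColor I j i
          · have c2' := c2
            unfold HasColor at c2'
            by_cases c3 : s.arr aBits (s.reg rP + (s.arr aLab j - 1) * I.ℓ + i) = 0
            · simp [elevateColor, hpos₃, f1, c1, hz, c2, c2', c3, f3, hz₃', h₃.color_eq, f2,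
                h₃.k1_eq]
            · simp [elevateColor, hpos₃, f1, c1, hz, c2, c2', c3, f3, hz₃', h₃.color_eq, f2,
                h₃.k1_eq]
          · have c2' := c2
            simp only [HasColor, not_not] at c2'
            simp [elevateColor, hpos₃, f1, c1, hz, c2, c2', h₃.color_eq]
      refine Runs.of_loopFree rfl (by decide) ⟨?_, fun hl => ?_, ?_⟩
      · simp only [State.setReg_reg]
        rw [if_neg (by decide), key.1]; ring
      · simp only [State.setReg_reg]
        rw [if_neg (by decide), key.2.1, hz₃ hl]; ring
      · simp only [State.setReg_arr]
        rw [key.2.2, hcap₃]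
        by_cases c1 : P i
        · rw [if_pos c1, if_pos (hP.2 (Or.inl c1))]
          split_ifs <;> simp
        · rw [if_neg c1]
          split_ifs with c2 c3 c3
          · rfl
          · exact absurd (hP.2 (Or.inr c2)) c3
          · exact absurd ((hP.1 c3).resolve_left c1) c2
          · rfl
    · rintro s₃ hF₃ ⟨hpos₃, -, hcap₃⟩
      refine ⟨?_, ?_⟩
      · simp only [State.setReg_reg]
        rw [if_neg (by decide), hpos₃]; ring
      · simp only [State.setReg_arr]
        rw [hcap₃, hcap]
        funext e
        have hRj : R j = if P I.ℓ then I.k + 1 else s.arr aCap j := by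
          simp only [hR, raisedCap, P, hj, true_and]
        by_cases e' : e = j
        · subst e'
          rw [if_pos (show e < e + 1 by omega), hRj]
          split_ifs <;> simp
        · by_cases e'' : e < j
          · rw [if_pos (show e < j + 1 by omega)]
            split_ifs <;> simp [Function.update_of_ne e', e'']
          · rw [if_neg (show ¬ e < j + 1 by omega)]
            split_ifs <;> simp [Function.update_of_ne e', e'']
  · rintro s₂ hF₂ ⟨-, hcap⟩
    refine ⟨?_, ?_⟩
    · rw [hcap]
      funext e
      split_ifs with he
      · rfl
      · simp [hR, raisedCap, he]
    · exact (hF₂.reg _ rfl).trans (by simp [Instr.apply, hp])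

end CutProgram

/-! ## Correctness of the guesses -/

namespace CutProgram

open RAM RAM.Prog

variable {I : MultiBudgetedCut}

theorem input_tail {e : ℕ} (he : e < I.m) : (netOf I).tail e = I.src ⟨e, he⟩ := by
  simp [netOf, MultiBudgetedCut.input, he]

theorem input_head {e : ℕ} (he : e < I.m) : (netOf I).head e = I.tgt ⟨e, he⟩ := by
  simp [netOf, MultiBudgetedCut.input, he]

theorem input_xs (v : Fin I.n) : (netOf I).xs v ≠ 0 ↔ v ∈ I.X := by
  simp only [netOf, MultiBudgetedCut.input]
  constructor
  · intro h
    split_ifs at h with hx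
    · obtain ⟨u, hu, huv⟩ := hx
      rwa [← Fin.ext huv]
    · exact absurd rfl h
  · intro h
    rw [if_pos ⟨v, h, rfl⟩]; exact one_ne_zero

theorem input_ys (v : Fin I.n) : (netOf I).ys v ≠ 0 ↔ v ∈ I.Y := by
  simp only [netOf, MultiBudgetedCut.input]
  constructor
  · intro h
    split_ifs at h with hx
    · obtain ⟨u, hu, huv⟩ := hx
      rwa [← Fin.ext huv]
    · exact absurd rfl h
  · intro h
    rw [if_pos ⟨v, h, rfl⟩]; exact one_ne_zero

/-- Since `i < ℓ`, the pair `(e, i)` is recovered from `e * ℓ + i` by division with remainder, so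
distinct pairs do not share a table entry. -/
theorem hasColor_iff (e : Fin I.m) (i : Fin I.ℓ) : HasColor I e i ↔ e ∈ I.color i := by
  simp only [HasColor, MultiBudgetedCut.input]
  constructor
  · intro h
    split_ifs at h with hx
    · obtain ⟨i', e', h1, h2⟩ := hx
      have hi : (i' : ℕ) = i := by
        have := congrArg (· % I.ℓ) h2
        simpa [Nat.mul_add_mod_of_lt, Nat.add_mod, Nat.mod_eq_of_lt i'.2, Nat.mod_eq_of_lt i.2]
          using this
      have he : (e' : ℕ) = e := by
        have hl : 0 < I.ℓ := lt_of_le_of_lt (Nat.zero_le _) i.2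
        rw [hi] at h2
        exact Nat.eq_of_mul_eq_mul_right hl (Nat.add_right_cancel h2)
      rwa [← Fin.ext hi, ← Fin.ext he]
    · exact absurd rfl h
  · intro h
    rw [if_pos ⟨i, e, h, rfl⟩]; exact one_ne_zero

theorem input_budget (i : Fin I.ℓ) : I.input.arr aBudget i = I.budget i := by
  simp [MultiBudgetedCut.input]

/-- The arcs that leave a side which fits the budgets form a solution. -/
theorem isSolution_of_fits {S : ℕ → Prop} (hS : (netOf I).Side S) (hfit : Fits I S)
    (hcol : ∀ e ∈ (netOf I).out S, ∃ i < I.ℓ, HasColor I e i) {C : Finset (Fin I.m)}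
    (hC : ∀ e : Fin I.m, e ∈ C ↔ (e : ℕ) ∈ (netOf I).out S) : I.IsSolution C := by
  refine ⟨?_, ?_, ?_⟩
  · intro x hx y hy hxy
    have hin : ∀ v, Relation.ReflTransGen (I.Step C) x v → S v := by
      intro v hv
      induction hv with
      | refl => exact hS.source x x.2 ((input_xs x).2 hx)
      | tail _ hst ih =>
        obtain ⟨e, he, rfl, rfl⟩ := hst
        by_contra hn
        exact he ((hC e).2 ((Net.mem_out _).2 ⟨e.2, by rwa [input_tail e.2], by rwa [input_head e.2]⟩))
    exact hS.target y y.2 ((input_ys y).2 hy) (hin y hxy)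
  · intro e he
    obtain ⟨i, hi, h⟩ := hcol e ((hC e).1 he)
    exact ⟨⟨i, hi⟩, (hasColor_iff e ⟨i, hi⟩).1 h⟩
  · intro i
    have := hfit i ((C ∩ I.color i).map Fin.valEmbedding) i.2
      (by
        intro e he
        obtain ⟨e', he', rfl⟩ := Finset.mem_map.1 he
        exact (hC e').1 (Finset.mem_inter.1 he').1)
      (by
        intro e he
        obtain ⟨e', he', rfl⟩ := Finset.mem_map.1 he
        exact (hasColor_iff e' i).2 (Finset.mem_inter.1 he').2)
    rwa [Finset.card_map, input_budget] at this

/-- What the guesses need to know about a solution `Z`. -/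
structure Target (I : MultiBudgetedCut) (Z : Finset ℕ) : Prop where
  side : ∃ S, (netOf I).Side S ∧ (netOf I).out S ⊆ Z
  lt : ∀ e ∈ Z, e < I.m
  colored : ∀ e ∈ Z, ∃ i < I.ℓ, HasColor I e i
  budget : ∀ i < I.ℓ, ∀ F ⊆ Z, (∀ e ∈ F, HasColor I e i) → F.card ≤ I.input.arr aBudget i
  card_le : Z.card ≤ I.k

/-- The side is the set of vertices reachable from X without `C`: an arc leaving it must be in `C`.
The bound by k holds because every arc of `C` is counted for at least one color. -/
theorem target_of_isSolution {C : Finset (Fin I.m)} (h : I.IsSolution C) :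
    Target I (C.map Fin.valEmbedding) := by
  classical
  obtain ⟨h1, h2, h3⟩ := h
  refine ⟨⟨fun v => ∃ x ∈ I.X, ∃ u : Fin I.n, (u : ℕ) = v ∧ Relation.ReflTransGen (I.Step C) x u,
    ⟨?_, ?_⟩, ?_⟩, ?_, ?_, ?_, ?_⟩
  · intro v hv hx
    exact ⟨⟨v, hv⟩, (input_xs ⟨v, hv⟩).1 hx, ⟨v, hv⟩, rfl, .refl⟩
  · rintro v hv hy ⟨x, hx, u, rfl, hxu⟩
    exact h1 x hx u ((input_ys u).1 hy) hxu
  · intro e he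
    obtain ⟨he, ⟨x, hx, u, hu, hxu⟩, hh⟩ := (Net.mem_out _).1 he
    rw [input_tail he] at hu
    refine Finset.mem_map.2 ⟨⟨e, he⟩, ?_, rfl⟩
    by_contra hn
    refine hh ⟨x, hx, I.tgt ⟨e, he⟩, (input_head he).symm, hxu.tail ⟨⟨e, he⟩, hn, ?_, rfl⟩⟩
    exact (Fin.ext hu).symm
  · intro e he
    obtain ⟨e', -, rfl⟩ := Finset.mem_map.1 he
    exact e'.2
  · intro e he
    obtain ⟨e', he', rfl⟩ := Finset.mem_map.1 he
    obtain ⟨i, hi⟩ := h2 e' he'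
    exact ⟨i, i.2, (hasColor_iff e' i).2 hi⟩
  · intro i hi F hF hc
    rw [show i = ((⟨i, hi⟩ : Fin I.ℓ) : ℕ) from rfl, input_budget]
    refine le_trans ?_ (h3 ⟨i, hi⟩)
    rw [← Finset.card_map Fin.valEmbedding]
    refine Finset.card_le_card fun e he => ?_
    obtain ⟨e', he', rfl⟩ := Finset.mem_map.1 (hF he)
    exact Finset.mem_map.2 ⟨e', Finset.mem_inter.2 ⟨he', (hasColor_iff e' ⟨i, hi⟩).1 (hc _ he)⟩, rfl⟩
  · rw [Finset.card_map]
    calc C.card ≤ (Finset.univ.biUnion fun i => C ∩ I.color i).card := by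
          refine Finset.card_le_card fun e he => ?_
          obtain ⟨i, hi⟩ := h2 e he
          exact Finset.mem_biUnion.2 ⟨i, Finset.mem_univ _, Finset.mem_inter.2 ⟨he, hi⟩⟩
      _ ≤ ∑ i, (C ∩ I.color i).card := Finset.card_biUnion_le
      _ ≤ I.k := Finset.sum_le_sum fun i _ => h3 i

/-- The result of a flow computation. -/
structure Outcome where
  side : ℕ → ℕ
  lab : ℕ → ℕ
  lam : ℕ

/-- Colored arcs have capacity `1` or `k + 1`, and the others `k + 1`. -/
def Admissible (I : MultiBudgetedCut) (cap : ℕ → ℕ) : Prop :=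
  ∀ e < I.m, (cap e = 1 ∧ ∃ i < I.ℓ, HasColor I e i) ∨ cap e = I.k + 1

/-- The cut found by the flow computation respects the budgets. -/
def Outcome.Success (I : MultiBudgetedCut) (o : Outcome) : Prop :=
  o.lam ≤ I.k ∧ Fits I fun v => o.side v ≠ 0

/-- With the guess `β`, one of the next `r` phases succeeds. -/
def Succeeds (I : MultiBudgetedCut) (F : (ℕ → ℕ) → Outcome) (β : ℕ → ℕ) :
    ℕ → (ℕ → ℕ) → ℕ → Prop
  | 0, _, _ => False
  | r + 1, cap, p => (F cap).Success I ∨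
      Succeeds I F β r (raisedCap I (F cap).lab β p cap) (p + (F cap).lam * I.ℓ)

/-- Every cut has capacity at least `μ`, and those of capacity `μ` respect the budgets. -/
def Guarantee (I : MultiBudgetedCut) (cap : ℕ → ℕ) (μ : ℕ) : Prop :=
  ∀ S, (netOf I).Side S → μ ≤ ∑ e ∈ (netOf I).out S, cap e ∧
    (∑ e ∈ (netOf I).out S, cap e = μ → Fits I S)

theorem Admissible.one_le {cap : ℕ → ℕ} (h : Admissible I cap) {e : ℕ} (he : e < I.m) :
    1 ≤ cap e := by
  rcases h e he with ⟨h, -⟩ | h <;> omega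

theorem admissible_initialCap : Admissible I (initialCap I) := by
  classical
  intro e he
  by_cases h : ∃ i < I.ℓ, HasColor I e i
  · left; exact ⟨by rw [initialCap, if_pos he, if_pos h], h⟩
  · right; rw [initialCap, if_pos he, if_neg h]

theorem Admissible.raisedCap {cap lab β : ℕ → ℕ} {p : ℕ} (h : Admissible I cap) :
    Admissible I (raisedCap I lab β p cap) := by
  intro e he
  unfold CutProgram.raisedCap
  split_ifs
  · exact Or.inr rfl
  · exact h e he

/-- All capacities on arcs are positive, so a cut of capacity 0 is empty. -/
theorem guarantee_initialCap : Guarantee I (initialCap I) 0 := by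
  refine fun S hS => ⟨Nat.zero_le _, fun h0 i F hi hF hc => ?_⟩
  have : F = ∅ := by
    refine Finset.eq_empty_of_forall_notMem fun e he => ?_
    have h1 := (Finset.sum_eq_zero_iff.1 h0) e (hF he)
    have h2 := (admissible_initialCap (I := I)).one_le ((Net.mem_out _).1 (hF he)).1
    omega
  simp [this]

/-- A minimum cut of value at most `k` consists of colored arcs of capacity `1`. -/
theorem colored_of_sum_le {cap : ℕ → ℕ} (hcap : Admissible I cap) {S : ℕ → Prop}
    (h : ∑ e ∈ (netOf I).out S, cap e ≤ I.k) {e : ℕ} (he : e ∈ (netOf I).out S) :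
    cap e = 1 ∧ ∃ i < I.ℓ, HasColor I e i := by
  have h1 : cap e ≤ I.k :=
    (Finset.single_le_sum (f := cap) (fun _ _ => Nat.zero_le _) he).trans h
  exact (hcap e ((Net.mem_out _).1 he).1).resolve_right (by omega)

open Classical in
/-- The bits from position `p` on are replaced by the colors that `Z` has on the labels. -/
noncomputable def guess (I : MultiBudgetedCut) (Z : Finset ℕ) (lab : ℕ → ℕ) (p c : ℕ)
    (β : ℕ → ℕ) (x : ℕ) : ℕ :=
  if p ≤ x ∧ x < p + c * I.ℓ then
    if ∃ e ∈ Z, lab e = (x - p) / I.ℓ + 1 ∧ HasColor I e ((x - p) % I.ℓ) then 1 else 0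
  else β x

theorem guess_ne_zero_iff {Z : Finset ℕ} {lab β : ℕ → ℕ} {p c j i : ℕ} (hj : j < c)
    (hi : i < I.ℓ) :
    guess I Z lab p c β (p + j * I.ℓ + i) ≠ 0 ↔ ∃ e ∈ Z, lab e = j + 1 ∧ HasColor I e i := by
  have h1 : j * I.ℓ + i < c * I.ℓ := by nlinarith
  have h2 : p + j * I.ℓ + i - p = i + I.ℓ * j := by rw [Nat.mul_comm]; omega
  rw [guess, if_pos ⟨by omega, by omega⟩, h2, Nat.add_mul_div_left _ _ (by omega),
    Nat.div_eq_of_lt hi, Nat.add_mul_mod_self_left, Nat.mod_eq_of_lt hi, zero_add]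
  simp

/-- A phase reads no bit from `p + c ℓ` on, so bits chosen for later phases cannot disturb it. -/
theorem raisedCap_congr {lab β β' cap : ℕ → ℕ} {p c : ℕ} (hlab : ∀ e < I.m, lab e ≤ c)
    (h : ∀ x < p + c * I.ℓ, β x = 0 ↔ β' x = 0) :
    raisedCap I lab β p cap = raisedCap I lab β' p cap := by
  classical
  funext e
  unfold raisedCap
  by_cases he : e < I.m ∧ lab e ≠ 0
  · have key : ∀ i < I.ℓ, β (p + (lab e - 1) * I.ℓ + i) = 0 ↔
        β' (p + (lab e - 1) * I.ℓ + i) = 0 := by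
      intro i hi
      refine h _ ?_
      have h1 := hlab e he.1
      obtain ⟨j, hj⟩ := Nat.exists_eq_succ_of_ne_zero he.2
      rw [hj, Nat.succ_sub_one]
      have : j + 1 ≤ c := by omega
      nlinarith
    refine if_congr (and_congr_right fun _ => and_congr_right fun _ =>
      exists_congr fun i => and_congr_right fun hi => and_congr_right fun _ => key i hi) rfl rfl
  · rw [if_neg (fun h => he ⟨h.1, h.2.1⟩), if_neg (fun h => he ⟨h.1, h.2.1⟩)]

theorem le_raisedCap {lab β cap : ℕ → ℕ} {p e : ℕ} (h : Admissible I cap) (he : e < I.m) :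
    cap e ≤ raisedCap I lab β p cap e := by
  unfold raisedCap
  split_ifs
  · rcases h e he with ⟨h, -⟩ | h <;> omega
  · exact le_rfl

/-- An arc of `Z` is itself a witness for all its colors at its own label, so none of the bits that
could raise it is 0. -/
theorem guess_spares {Z : Finset ℕ} {cap lab β : ℕ → ℕ} {p c : ℕ} (hlab : ∀ e < I.m, lab e ≤ c)
    (hZ : ∀ e ∈ Z, cap e = 1) {e : ℕ} (he : e ∈ Z) :
    raisedCap I lab (guess I Z lab p c β) p cap e = 1 := by
  unfold raisedCap
  split_ifs with h
  · obtain ⟨h1, h2, i, hi, hc, h0⟩ := h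
    have := hlab e h1
    refine absurd h0 ((guess_ne_zero_iff (by omega) hi).2 ⟨e, he, by omega, hc⟩)
  · exact hZ e he

/-- After a correct guess, the cuts of the same capacity respect the budgets. -/
theorem guarantee_guess {Z : Finset ℕ} {cap side lab β : ℕ → ℕ} {p c : ℕ} (hT : Target I Z)
    (hcap : Admissible I cap) (hA : (netOf I).Analyzed I.k cap side lab c) (hc : c ≤ I.k)
    (hc1 : 1 ≤ c) : Guarantee I (raisedCap I lab (guess I Z lab p c β) p cap) c := by
  classical
  intro S hS
  set cap' := raisedCap I lab (guess I Z lab p c β) p cap with hcap'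
  have hle : ∑ e ∈ (netOf I).out S, cap e ≤ ∑ e ∈ (netOf I).out S, cap' e :=
    Finset.sum_le_sum fun e he => le_raisedCap hcap ((Net.mem_out _).1 he).1
  refine ⟨(hA.le_sum S hS).trans hle, fun hsum i F hi hF hcol => ?_⟩
  have hadm : Admissible I cap' := hcap.raisedCap
  have one : ∀ e ∈ (netOf I).out S, cap' e = 1 := fun e he =>
    (colored_of_sum_le hadm (by omega) he).1
  have one' : ∀ e ∈ (netOf I).out S, cap e = 1 := fun e he =>
    (colored_of_sum_le hcap (by omega) he).1
  have hcard : ((netOf I).out S).card = c := by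
    rw [← hsum, Finset.sum_congr rfl one]; simp
  -- A cut of capacity `c ≤ k` has unit capacities only, hence `c` arcs, and `crossing` yields all
  -- `c` labels. So the labels are a bijection from the cut to `1, …, c`.
  have hsub : Finset.Icc 1 c ⊆ ((netOf I).out S).image lab := by
    intro j hj
    obtain ⟨h1, h2⟩ := Finset.mem_Icc.1 hj
    obtain ⟨e, he, h⟩ := hA.crossing S hS j h1 h2
    exact Finset.mem_image.2 ⟨e, he, h.resolve_right (fun h => h (one' e he))⟩
  have hcard' : (Finset.Icc 1 c).card = c := by simp
  have himg : ((netOf I).out S).image lab = Finset.Icc 1 c := by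
    refine (Finset.eq_of_subset_of_card_le hsub ?_).symm
    rw [hcard', ← hcard]; exact Finset.card_image_le
  have hinj : Set.InjOn lab ((netOf I).out S) :=
    Finset.card_image_iff.1 (by rw [himg, hcard', hcard])
  -- An arc of `F` was not raised, so the bit of its label for `i` is not 0, and this bit was set by
  -- an arc of `Z` with the same label and color.
  have hmem : F.image lab ⊆ (Z.filter fun e => HasColor I e i).image lab := by
    intro j hj
    obtain ⟨e, he, rfl⟩ := Finset.mem_image.1 hj
    have hout := hF he
    have hem := ((Net.mem_out _).1 hout).1
    have hl := Finset.mem_Icc.1 (himg ▸ Finset.mem_image_of_mem lab hout)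
    have hne : guess I Z lab p c β (p + (lab e - 1) * I.ℓ + i) ≠ 0 := by
      intro h0
      have h1 := one e hout
      rw [hcap', raisedCap, if_pos ⟨hem, by omega, i, hi, hcol e he, h0⟩] at h1
      omega
    obtain ⟨e', h1, h2, h3⟩ := (guess_ne_zero_iff (by omega) hi).1 hne
    exact Finset.mem_image.2 ⟨e', Finset.mem_filter.2 ⟨h1, h3⟩, by omega⟩
  calc F.card = (F.image lab).card :=
        (Finset.card_image_iff.2 (hinj.mono (by exact_mod_cast hF))).symm
    _ ≤ ((Z.filter fun e => HasColor I e i).image lab).card := Finset.card_le_card hmem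
    _ ≤ (Z.filter fun e => HasColor I e i).card := Finset.card_image_le
    _ ≤ I.input.arr aBudget i := hT.budget i hi _ (Finset.filter_subset _ _)
        fun e he => (Finset.mem_filter.1 he).2

/-- If there is a solution, some guess succeeds. -/
theorem exists_guess {F : (ℕ → ℕ) → Outcome} {Z : Finset ℕ} {L : ℕ}
    (hF : ∀ cap, Admissible I cap →
      (netOf I).Analyzed I.k cap (F cap).side (F cap).lab (F cap).lam)
    (hT : Target I Z) (r : ℕ) : ∀ (μ p : ℕ) (cap β : ℕ → ℕ), Admissible I cap →
      (∀ e ∈ Z, cap e = 1) → Guarantee I cap μ → I.k < r + μ →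
      p + ∑ q ∈ (Finset.range (I.k + 1)).filter (μ < ·), q * I.ℓ ≤ L →
      ∃ β' : ℕ → ℕ, (∀ x < p, β' x = β x) ∧
        ∀ γ : ℕ → ℕ, (∀ x < L, γ x = 0 ↔ β' x = 0) → Succeeds I F γ r cap p := by
  classical
  obtain ⟨S, hS, hSZ⟩ := hT.side
  have hZk : ∀ cap : ℕ → ℕ, (∀ e ∈ Z, cap e = 1) → ∑ e ∈ (netOf I).out S, cap e ≤ I.k := by
    intro cap h
    rw [Finset.sum_congr rfl fun e he => h e (hSZ he)]
    simpa using (Finset.card_le_card hSZ).trans hT.card_le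
  induction r with
  | zero =>
    intro μ p cap β _ hZ hG hk _
    -- With no phase left, every cut would have capacity above k, but the cut inside `Z` has at most
    -- k.
    have := (hG S hS).1
    have := hZk cap hZ
    omega
  | succ r ih =>
    intro μ p cap β hcap hZ hG hk hL
    have hA := hF cap hcap
    have hck : (F cap).lam ≤ I.k := (hA.le_sum S hS).trans (hZk cap hZ)
    obtain ⟨g1, g2⟩ := hG _ (hA.is_side hck)
    rw [hA.sum_eq hck] at g1 g2
    -- If the value has not grown, the guarantee applies to the minimum cut that was found;
    -- otherwise the value has grown and a new guess is written.
    by_cases hμ : (F cap).lam = μ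
    · exact ⟨β, fun _ _ => rfl, fun γ _ => Or.inl ⟨hck, g2 hμ⟩⟩
    · have hc1 : μ < (F cap).lam := by omega
      have hL' : p + (F cap).lam * I.ℓ +
          ∑ q ∈ (Finset.range (I.k + 1)).filter ((F cap).lam < ·), q * I.ℓ ≤ L := by
        refine le_trans ?_ hL
        rw [add_assoc]
        refine Nat.add_le_add_left ?_ _
        -- The values found in successive phases increase strictly, so they are charged to distinct
        -- summands of the length.
        rw [← Finset.sum_insert (f := fun q => q * I.ℓ) (a := (F cap).lam) (by simp)]
        refine Finset.sum_le_sum_of_subset fun q hq => ?_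
        simp only [Finset.mem_insert, Finset.mem_filter, Finset.mem_range] at hq ⊢
        omega
      obtain ⟨β', h1, h2⟩ := ih (F cap).lam (p + (F cap).lam * I.ℓ)
        (raisedCap I (F cap).lab (guess I Z (F cap).lab p (F cap).lam β) p cap)
        (guess I Z (F cap).lab p (F cap).lam β) hcap.raisedCap
        (fun e he => guess_spares hA.lab_le hZ he)
        (guarantee_guess hT hcap hA hck (by omega)) (by omega) hL'
      refine ⟨β', fun x hx => ?_, fun γ hγ => Or.inr ?_⟩
      · rw [h1 x (by omega), guess, if_neg (by omega)]
      · have := raisedCap_congr (I := I) (cap := cap) (β := γ)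
          (β' := guess I Z (F cap).lab p (F cap).lam β) (p := p) hA.lab_le
          (fun x hx => by rw [hγ x (by omega), h1 x hx])
        rw [this]
        exact h2 γ hγ

end CutProgram

/-! ## One phase -/

namespace CutProgram

open RAM RAM.Prog

variable {I : MultiBudgetedCut}

/-- The registers of the flow computation. -/
def workRegs : List ℕ :=
  [rLam, rFound, rHead, rTail, rArc, rCur, rGo, rV, rX, rY, rE, rFlow, rJ, rTag]

/-- The arrays of the flow computation. -/
def workArrs : List ℕ := [aVis, aPar, aQue, aRes, aLab, aSide]

/-- The work space is zero above the bound on the addresses. -/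
def Clean (s : State) : Prop := ∀ a ∈ workArrs, ∀ x, s.reg rB ≤ x → s.arr a x = 0

theorem Clean.of_bounded {p : Prog} {s s' : State} {t : ℕ} (h : Clean s) (hp : p.Bounded rB)
    (e : Exec p s t s') : Clean s' := by
  obtain ⟨h1, h2⟩ := hp s t s' e
  intro a ha x hx
  rw [h1] at hx
  rw [h2 a x hx, h a ha x hx]

theorem Clean.of_frame {p : Prog} {s s' : State} (h : Clean s) (hF : Frame p s s')
    (hk : keeps p = true) (hp : (workArrs.all fun a => !p.writesArr a) = true) : Clean s' := by
  intro a ha x hx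
  rw [(SameSetup.of_frame hF hk).reg rB (by decide)] at hx
  rw [hF.arr a (by simpa using List.all_eq_true.1 hp a ha), h a ha x hx]

/-- Every store in the search carries the guard, so the claim follows from the syntax without any
knowledge of the addresses. -/
theorem bounded_search : search.Bounded rB := by
  unfold search searchInit rootBody searchBody scan visit pop
  repeat' first
    | exact Prog.Bounded.storeBelow
    | apply Prog.Bounded.seq
    | exact Prog.Bounded.instr rfl fun _ => rfl
    | exact Prog.Bounded.skip
    | apply Prog.Bounded.cond
    | apply Prog.Bounded.loop

theorem bounded_analysis : analysis.Bounded rB := by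
  unfold analysis flow flowInit flowBody record convert decompose trace push label
  repeat' first
    | exact bounded_search
    | exact Prog.Bounded.storeBelow
    | apply Prog.Bounded.seq
    | exact Prog.Bounded.instr rfl fun _ => rfl
    | exact Prog.Bounded.skip
    | apply Prog.Bounded.cond
    | apply Prog.Bounded.loop

/-- Clearing reaches addresses below the bound, and `Clean` covers the others. Together the arrays
vanish identically, as `exists_outcome` requires. -/
theorem prepare_spec {s : State} (h : Ready I s) (hs : Clean s) :
    Runs prepare s (14 * s.reg rB + 16) fun s' =>
      (∀ x ∈ workRegs, s'.reg x = 0) ∧ ∀ a ∈ workArrs, s'.arr a = 0 := by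
  refine Runs.mono (T := ((12 + 2) * s.reg rB + 2) + 14) (Runs.seq ((Runs.for (N := s.reg rB)
    (T := 12) (fun j s' => ∀ a ∈ workArrs, ∀ x, x < j ∨ s.reg rB ≤ x → s'.arr a x = 0)
    rfl rfl (by decide) rfl (fun a ha x hx => hs a ha x (by omega)) ?_).mono le_rfl ?_)) (by omega) fun _ _ h => h
  · intro j s₁ hj hv hF hI
    have b1 : s₁.reg rB = s.reg rB := hF.reg _ rfl
    have b2 : s₁.reg rZero = 0 := (hF.reg _ rfl).trans h.net.search.zero
    refine Runs.of_loopFree rfl (by decide) ?_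
    intro a ha x hx
    have key : ∀ a ∈ workArrs, ((put aVis rV rZero ;; put aPar rV rZero ;; put aQue rV rZero ;;
        put aRes rV rZero ;; put aLab rV rZero ;; put aSide rV rZero).eval s₁).arr a =
        Function.update (s₁.arr a) j 0 := by
      intro a ha
      simp only [workArrs, List.mem_cons, List.not_mem_nil, or_false] at ha
      rcases ha with rfl | rfl | rfl | rfl | rfl | rfl <;> simp [put, hv, b1, b2, hj]
    simp only [State.setReg_arr]
    rw [key a ha, Function.update_apply]
    split_ifs with e
    · rfl
    · exact hI a ha x (by omega)
  · intro s₁ hF hI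
    refine Runs.of_loopFree rfl (by decide) ⟨fun x hx => ?_, fun a ha => ?_⟩
    · simp only [workRegs, List.mem_cons, List.not_mem_nil, or_false] at hx
      rcases hx with rfl | rfl | rfl | rfl | rfl | rfl | rfl | rfl | rfl | rfl | rfl | rfl | rfl |
        rfl <;> simp
    · funext x
      simpa using hI a ha x (by omega)

/-- The memory in which the flow computation starts. -/
def startState (s : State) (cap : ℕ → ℕ) : State where
  reg x := if x ∈ workRegs then 0 else s.reg x
  arr a := if a ∈ workArrs then 0 else if a = aCap then cap else s.arr a

theorem sameSetup_startState (s : State) (cap : ℕ → ℕ) : SameSetup s (startState s cap) := by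
  constructor
  · intro x hx
    have : x ∉ workRegs := by revert x; decide
    simp [startState, this]
  · intro a ha
    have : a ∉ workArrs ∧ a ≠ aCap := by revert a; decide
    simp [startState, this]

/-- A bound on the running time of the flow computation. -/
def analysisTime (I : MultiBudgetedCut) : ℕ := 220 * (I.n + I.m + 1) * (I.k + 3)

set_option maxRecDepth 8000 in
/-- The result of the flow computation is a function of the capacities. -/
theorem exists_outcome {s : State} (h : Ready I s) : ∃ F : (ℕ → ℕ) → Outcome, ∀ cap,
    (netOf I).Analyzed I.k cap (F cap).side (F cap).lab (F cap).lam ∧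
    ∀ s', SameSetup s s' → s'.arr aCap = cap → (∀ x ∈ workRegs, s'.reg x = 0) →
      (∀ a ∈ workArrs, s'.arr a = 0) → Runs analysis s' (analysisTime I) fun s'' =>
        s''.arr aSide = (F cap).side ∧ s''.arr aLab = (F cap).lab ∧ s''.reg rLam = (F cap).lam := by
  suffices H : ∀ cap, ∃ o : Outcome, (netOf I).Analyzed I.k cap o.side o.lab o.lam ∧
      ∀ s', SameSetup s s' → s'.arr aCap = cap → (∀ x ∈ workRegs, s'.reg x = 0) →
      (∀ a ∈ workArrs, s'.arr a = 0) → Runs analysis s' (analysisTime I) fun s'' =>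
        s''.arr aSide = o.side ∧ s''.arr aLab = o.lab ∧ s''.reg rLam = o.lam by
    choose F hF using H
    exact ⟨F, hF⟩
  intro cap
  have h₁ := h.congr (sameSetup_startState s cap)
  obtain ⟨t, s₂, e, ht, hA⟩ := analysis_spec (k := I.k) h₁.net rfl rfl h₁.k1_eq
  refine ⟨⟨s₂.arr aSide, s₂.arr aLab, s₂.reg rLam⟩, hA, fun s' hs hc hr ha => ?_⟩
  -- Everything named in the program is work space, setup data or the capacities, which is decided
  -- on the text. Hence the run from the canonical memory carries over with the same results.
  have hag : Agree analysis.regs analysis.arrs (startState s cap) s' := by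
    constructor
    · intro x hx
      have : x ∈ workRegs ∨ x ∉ workRegs ∧
          x ∈ [rN, rM, rL, rZero, rOne, rK, rK1, rM2, rB, rLen] := by
        revert x; decide
      rcases this with h | ⟨h, h'⟩
      · simp [startState, h, hr x h]
      · simp [startState, h, hs.reg x h']
    · intro a ha'
      have : a ∈ workArrs ∨ a ∉ workArrs ∧ (a = aCap ∨ a ≠ aCap ∧
          a ∈ [aSrc, aTgt, aX, aY, aBudget, aColor, aFrom, aTo, aRev, aFirst, aNext]) := by
        revert a; decide
      rcases this with h | ⟨h, rfl | ⟨h', h''⟩⟩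
      · simp [startState, h, ha a h]
      · simp [startState, h, hc]
      · simp [startState, h, h', hs.arr a h'']
  obtain ⟨s₃, e', hag'⟩ := e.congr (List.Subset.refl _) (List.Subset.refl _) hag
  exact ⟨t, s₃, e', ht, (hag'.arr aSide (by decide)).symm, (hag'.arr aLab (by decide)).symm,
    (hag'.reg rLam (by decide)).symm⟩

/-- The flow computations that start from the setup `s` have the results `F`. -/
def Computes (I : MultiBudgetedCut) (s : State) (F : (ℕ → ℕ) → Outcome) : Prop :=
  ∀ cap, (netOf I).Analyzed I.k cap (F cap).side (F cap).lab (F cap).lam ∧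
    ∀ s', SameSetup s s' → s'.arr aCap = cap → (∀ x ∈ workRegs, s'.reg x = 0) →
      (∀ a ∈ workArrs, s'.arr a = 0) → Runs analysis s' (analysisTime I) fun s'' =>
        s''.arr aSide = (F cap).side ∧ s''.arr aLab = (F cap).lab ∧ s''.reg rLam = (F cap).lam

/-- A bound on the running time of a phase. -/
def phaseTime (I : MultiBudgetedCut) (b c : ℕ) : ℕ :=
  (14 * b + 16) + (analysisTime I + (((9 * I.ℓ + 14) * (I.m + 1) + 7 * I.ℓ + 10) +
    ((3 * I.ℓ + 5) * c + (10 * I.ℓ + 8) * I.m + 5)))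

/-- Capacities are raised even after a success; this is harmless, since raising writes neither the
output nor `rDone`. Admissibility ensures that a cut found within the bound is colored. -/
theorem phase_spec {s₀ s : State} {F : (ℕ → ℕ) → Outcome} (h₀ : Ready I s₀)
    (hF : Computes I s₀ F) (hs : SameSetup s₀ s) (hc : Clean s) (hadm : Admissible I (s.arr aCap)) :
    Runs phase s (phaseTime I (s₀.reg rB) (I.k + 1)) fun s' =>
      Clean s' ∧ SameSetup s₀ s' ∧ s'.arr aBits = s.arr aBits ∧
      s'.arr aCap = raisedCap I (F (s.arr aCap)).lab (s.arr aBits) (s.reg rP) (s.arr aCap) ∧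
      s'.reg rP = s.reg rP + (F (s.arr aCap)).lam * I.ℓ ∧
      ((F (s.arr aCap)).Success I → s'.reg rDone = 1 ∧ I.IsSolution (I.output s')) ∧
      (¬ (F (s.arr aCap)).Success I → s'.reg rDone = s.reg rDone) := by
  classical
  set cap := s.arr aCap with hcap
  have hb : s.reg rB = s₀.reg rB := hs.reg rB (by decide)
  obtain ⟨hA, hrun⟩ := hF cap
  have hR := h₀.congr hs
  have hprep := prepare_spec hR hc
  rw [hb] at hprep
  have hle : (14 * s₀.reg rB + 16) + (analysisTime I + (((9 * I.ℓ + 14) * (I.m + 1) + 7 * I.ℓ + 10) +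
    ((3 * I.ℓ + 5) * (F cap).lam + (10 * I.ℓ + 8) * I.m + 5))) ≤
      phaseTime I (s₀.reg rB) (I.k + 1) := by
    unfold phaseTime
    have := Nat.mul_le_mul_left (3 * I.ℓ + 5) hA.le_succ
    omega
  refine Runs.mono (Runs.seq (hprep.mono le_rfl ?_)) hle fun _ _ h => h
  rintro s₁ hF₁ ⟨hr, ha⟩
  have hs₁ : SameSetup s₀ s₁ := hs.trans (.of_frame hF₁ rfl)
  have c1 : s₁.arr aCap = cap := hF₁.arr _ rfl
  have hcl : Clean s₁ := fun a h x _ => by rw [ha a h]; rfl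
  have hana : Runs analysis s₁ (analysisTime I) fun s'' => (s''.arr aSide = (F cap).side ∧
      s''.arr aLab = (F cap).lab ∧ s''.reg rLam = (F cap).lam) ∧ Clean s'' := by
    obtain ⟨t, s₂, e, ht, hQ⟩ := hrun s₁ hs₁ c1 hr ha
    exact ⟨t, s₂, e, ht, hQ, hcl.of_bounded bounded_analysis e⟩
  refine Runs.seq (hana.mono le_rfl ?_)
  rintro s₂ hF₂ ⟨⟨o1, o2, o3⟩, hcl₂⟩
  have hs₂ : SameSetup s₀ s₂ := hs₁.trans (.of_frame hF₂ rfl)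
  refine Runs.seq ((check_spec (h₀.congr hs₂)).mono le_rfl ?_)
  rintro s₃ hF₃ ⟨hd, hout⟩
  have hs₃ : SameSetup s₀ s₃ := hs₂.trans (.of_frame hF₃ rfl)
  have l3 : s₃.arr aLab = (F cap).lab := (hF₃.arr _ rfl).trans o2
  have m3 : s₃.reg rLam = (F cap).lam := (hF₃.reg _ rfl).trans o3
  have p3 : s₃.reg rP = s.reg rP := by rw [hF₃.reg _ rfl, hF₂.reg _ rfl, hF₁.reg _ rfl]
  have b3 : s₃.arr aBits = s.arr aBits := by rw [hF₃.arr _ rfl, hF₂.arr _ rfl, hF₁.arr _ rfl]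
  have d3 : s₂.reg rDone = s.reg rDone := by rw [hF₂.reg _ rfl, hF₁.reg _ rfl]
  have cc3 : s₃.arr aCap = cap := by rw [hF₃.arr _ rfl, hF₂.arr _ rfl, c1]
  have hel := elevate_spec (h₀.congr hs₃) (by rw [l3, m3]; exact hA.lab_le)
  rw [l3, m3, p3, b3, cc3] at hel
  refine hel.mono le_rfl ?_
  rintro s₄ hF₄ ⟨q1, q2⟩
  have d4 : s₄.reg rDone = s₃.reg rDone := hF₄.reg _ rfl
  have hs₄ : SameSetup s₀ s₄ := hs₃.trans (.of_frame hF₄ rfl)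
  have b4 : s₄.arr aBits = s.arr aBits := (hF₄.arr _ rfl).trans b3
  have out4 : s₄.arr aOut = s₃.arr aOut := hF₄.arr _ rfl
  rw [o1, o3, d3] at hd
  rw [o1] at hout
  refine ⟨(hcl₂.of_frame hF₃ rfl rfl).of_frame hF₄ rfl rfl, hs₄, b4, q1, q2, fun hsuc => ?_,
    fun hsuc => ?_⟩
  · refine ⟨by rw [d4, hd]; exact if_pos hsuc, ?_⟩
    refine isSolution_of_fits (hA.is_side hsuc.1) hsuc.2
      (fun e he => (colored_of_sum_le hadm (by rw [hA.sum_eq hsuc.1]; exact hsuc.1) he).2) ?_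
    intro e
    simp only [MultiBudgetedCut.output, Finset.mem_filter, Finset.mem_univ, true_and]
    rw [out4, hout e e.2]
    split_ifs with he <;> simp [he]
  · rw [d4, hd]; exact if_neg hsuc

end CutProgram

/-! ## All guesses -/

namespace CutProgram

open RAM RAM.Prog

variable {I : MultiBudgetedCut}

/-- The bits of `v`, below the length `L`. -/
def bitsOf (L v x : ℕ) : ℕ := if x < L ∧ v.testBit x = true then 1 else 0

/-- Divisibility says that the lowest `j` bits of `v` are ones, so `v = 2 ^ j * u + (2 ^ j - 1)`.
Here `u` is even, so the carry stops at position `j`. -/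
theorem testBit_succ_of_dvd {v j : ℕ} (h : 2 ^ j ∣ v + 1) (hb : v.testBit j = false) (x : ℕ) :
    (v + 1).testBit x = if x < j then false else if x = j then true else v.testBit x := by
  obtain ⟨w, hw⟩ := h
  have hw0 : w ≠ 0 := by rintro rfl; simp at hw
  obtain ⟨u, rfl⟩ := Nat.exists_eq_succ_of_ne_zero hw0
  have hp : 0 < 2 ^ j := by positivity
  have hv : v / 2 ^ j = u := by
    have : v = (2 ^ j - 1) + 2 ^ j * u := by rw [Nat.mul_succ] at hw; omega
    rw [this, Nat.add_mul_div_left _ _ hp, Nat.div_eq_of_lt (by omega), zero_add]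
  have key : ∀ y, v.testBit (j + y) = u.testBit y := by
    intro y; rw [← hv, Nat.testBit_div_two_pow, Nat.add_comm]
  have hu : u.testBit 0 = false := by rw [← key 0]; exact hb
  rw [hw]
  by_cases hx : x < j
  · rw [if_pos hx, Nat.testBit_two_pow_mul]
    simp [hx]
  · obtain ⟨y, rfl⟩ := Nat.exists_eq_add_of_le (not_lt.1 hx)
    rw [if_neg hx, Nat.testBit_two_pow_mul, key]
    simp only [ge_iff_le, Nat.le_add_right, decide_true, Bool.true_and, Nat.add_sub_cancel_left]
    rw [Nat.testBit_zero] at hu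
    have hu' : u % 2 = 0 := by simpa using hu
    cases y with
    | zero => simp [Nat.testBit_zero]; omega
    | succ y =>
      rw [if_neg (by omega), Nat.testBit_succ, Nat.testBit_succ]
      congr 1; omega

theorem dvd_succ_of_testBit {v j : ℕ} (h : 2 ^ j ∣ v + 1) (hb : v.testBit j = true) :
    2 ^ (j + 1) ∣ v + 1 := by
  obtain ⟨w, hw⟩ := h
  have hw0 : w ≠ 0 := by rintro rfl; simp at hw
  obtain ⟨u, rfl⟩ := Nat.exists_eq_succ_of_ne_zero hw0
  have hp : 0 < 2 ^ j := by positivity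
  have hv : v / 2 ^ j = u := by
    have : v = (2 ^ j - 1) + 2 ^ j * u := by rw [Nat.mul_succ] at hw; omega
    rw [this, Nat.add_mul_div_left _ _ hp, Nat.div_eq_of_lt (by omega), zero_add]
  have hu : u.testBit 0 = true := by
    rw [← hv, Nat.testBit_div_two_pow]; simpa using hb
  rw [Nat.testBit_zero] at hu
  have hu' : u % 2 = 1 := by simpa using hu
  rw [hw, pow_succ]
  exact Nat.mul_dvd_mul_left _ (by omega)

/-- The loop keeps `2 ^ j ∣ v + 1` with the bits below `j` already cleared. A one extends the
divisibility; a zero ends the carry; reaching `L` means that all guesses are used up. -/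
theorem increment_spec {s : State} {L v : ℕ} (hz : s.reg rZero = 0) (ho : s.reg rOne = 1)
    (hL : s.reg rLen = L) (hv : v < 2 ^ L) (hb : s.arr aBits = bitsOf L v)
    (hd : s.reg rDone = 0) :
    Runs increment s (8 * (L + 2) + 3) fun s' =>
      (s'.reg rDone = 0 ∧ v + 1 < 2 ^ L ∧ s'.arr aBits = bitsOf L (v + 1)) ∨
      (s'.reg rDone = 2 ∧ v + 1 = 2 ^ L) := by
  refine Runs.mono (T := (7 + 1) * (L + 1) + 1 + 1 + 1) (Runs.step (Runs.step (Runs.loop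
    (T := 7) (N := L + 1) (fun c s' =>
      (s'.reg qGo ≠ 0 ∧ s'.reg rDone = 0 ∧ s'.reg qJ ≤ L ∧ 2 ^ s'.reg qJ ∣ v + 1 ∧
        (∀ x, s'.arr aBits x = if x < s'.reg qJ then 0 else bitsOf L v x) ∧
        L - s'.reg qJ + 1 ≤ c) ∨
      (s'.reg qGo = 0 ∧ ((s'.reg rDone = 0 ∧ v + 1 < 2 ^ L ∧ s'.arr aBits = bitsOf L (v + 1)) ∨
        (s'.reg rDone = 2 ∧ v + 1 = 2 ^ L)))) ?_ ?_))) (by omega) ?_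
  · left
    simp [Instr.apply, hb, hd]
  · rintro c s₁ hF h hgo
    have z1 : s₁.reg rZero = 0 := (hF.reg _ rfl).trans (by simp [Instr.apply, hz])
    have o1 : s₁.reg rOne = 1 := (hF.reg _ rfl).trans (by simp [Instr.apply, ho])
    have L1 : s₁.reg rLen = L := (hF.reg _ rfl).trans (by simp [Instr.apply, hL])
    simp only [holds_ne, z1] at hgo
    obtain ⟨-, h1, h2, h3, h4, h5⟩ := h.resolve_right (fun h => hgo h.1)
    refine Runs.of_loopFree rfl (by decide) ?_
    generalize hj : s₁.reg qJ = j at *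
    by_cases hlt : j < L
    · have hbit : s₁.arr aBits j = if v.testBit j = true then 1 else 0 := by
        rw [h4 j, if_neg (lt_irrefl _), bitsOf]; simp [hlt]
      by_cases ht : v.testBit j = true
      · have hbit' : s₁.arr aBits j = 1 := by rw [hbit, if_pos ht]
        refine ⟨c - 1, by omega, Or.inl ?_⟩
        simp [carry, hj, L1, hlt, hbit', z1, hgo, h1]
        refine ⟨dvd_succ_of_testBit h3 ht, fun x => ?_, by omega⟩
        rw [Function.update_apply, h4 x]
        by_cases hx : x = j
        · subst hx; simp
        · rw [if_neg hx]
          by_cases hx' : x < j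
          · rw [if_pos hx', if_pos (by omega)]
          · rw [if_neg hx', if_neg (by omega)]
      · have ht' : v.testBit j = false := by simpa using ht
        have hbit' : s₁.arr aBits j = 0 := by rw [hbit, if_neg ht]
        refine ⟨0, by omega, Or.inr ?_⟩
        have key := testBit_succ_of_dvd h3 ht'
        simp [carry, hj, L1, hlt, hbit', z1, h1, o1]
        refine ⟨?_, funext fun x => ?_⟩
        · rcases Nat.lt_or_ge (v + 1) (2 ^ L) with h | h
          · exact h
          · exfalso
            -- An overflow is impossible here: position `j < L` of the successor is a one, whereas
            -- it is a zero in `2 ^ L`.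
            have he : v + 1 = 2 ^ L := by omega
            have := key j
            rw [he, Nat.testBit_two_pow_of_ne (by omega)] at this
            simp at this
        · rw [Function.update_apply, h4 x, bitsOf, bitsOf, key x]
          by_cases hx : x = j
          · subst hx; simp [hlt]
          · by_cases hx' : x < j
            · simp [hx, hx']
            · simp [hx, hx']
    · have hjL : j = L := by omega
      refine ⟨0, by omega, Or.inr ?_⟩
      simp [carry, hj, L1, hlt]
      rw [hjL] at h3
      exact le_antisymm hv (Nat.le_of_dvd (by omega) h3)
  · rintro s₁ hF ⟨⟨c, h⟩, hgo⟩
    have z1 : s₁.reg rZero = 0 := (hF.reg _ rfl).trans hz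
    simp only [holds_ne, z1, not_not] at hgo
    rcases h with h | h
    · exact absurd hgo h.1
    · exact h.2

/-- The properties of the memory that hold between the iterations. -/
structure Stable (I : MultiBudgetedCut) (s₀ s : State) : Prop where
  same : SameSetup s₀ s
  clean : Clean s
  cap_zero : ∀ e, I.m ≤ e → s.arr aCap e = 0

/-- A bound on the running time of the phases of an iteration. -/
def phasesTime (I : MultiBudgetedCut) (b : ℕ) : ℕ :=
  (((8 * I.ℓ + 4) + 2) * I.m + 4) + ((1 + phaseTime I b (I.k + 1) + 2) * (I.k + 1) + 2)

/-- While unfinished, success of the whole guess is passed on to the phases that remain. After k + 1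
phases none remain, so an unfinished iteration refutes the guess. -/
theorem phases_spec {s₀ s : State} {F : (ℕ → ℕ) → Outcome} (h₀ : Ready I s₀)
    (hF : Computes I s₀ F) (hs : Stable I s₀ s) (hd : s.reg rDone = 0) :
    Runs (initCap ;; Prog.for qR rK1 (.cond (.eq rDone rZero) phase .skip)) s
      (phasesTime I (s₀.reg rB)) fun s' => Stable I s₀ s' ∧ s'.arr aBits = s.arr aBits ∧
        ((s'.reg rDone = 1 ∧ I.IsSolution (I.output s')) ∨
         (s'.reg rDone = 0 ∧ ¬ Succeeds I F (s.arr aBits) (I.k + 1) (initialCap I) 0)) := by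
  refine Runs.seq ((initCap_spec (h₀.congr hs.same) hs.cap_zero).mono le_rfl ?_)
  rintro s₁ hF₁ ⟨hcap₁, hp₁⟩
  have hs₁ : SameSetup s₀ s₁ := hs.same.trans (.of_frame hF₁ rfl)
  have hc₁ : Clean s₁ := hs.clean.of_frame hF₁ rfl rfl
  have hb₁ : s₁.arr aBits = s.arr aBits := hF₁.arr _ rfl
  have hd₁ : s₁.reg rDone = 0 := (hF₁.reg _ rfl).trans hd
  refine (Runs.for (N := I.k + 1) (T := 1 + phaseTime I (s₀.reg rB) (I.k + 1)) (fun r s' =>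
    Stable I s₀ s' ∧ s'.arr aBits = s.arr aBits ∧
      ((s'.reg rDone = 1 ∧ I.IsSolution (I.output s')) ∨
       (s'.reg rDone = 0 ∧ Admissible I (s'.arr aCap) ∧
        (Succeeds I F (s.arr aBits) (I.k + 1) (initialCap I) 0 →
          Succeeds I F (s.arr aBits) (I.k + 1 - r) (s'.arr aCap) (s'.reg rP)))))
    rfl rfl (by decide) (h₀.congr hs₁).k1_eq ?_ ?_).mono le_rfl ?_
  · refine ⟨⟨?_, hc₁, ?_⟩, hb₁, Or.inr ⟨?_, ?_, ?_⟩⟩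
    · exact hs₁.trans (.of_frame (Instr.frame (.const qR 0) s₁) rfl)
    · intro e he
      simp only [State.setReg_arr, hcap₁, initialCap]
      rw [if_neg (by omega)]
    · simpa using hd₁
    · simpa [hcap₁] using admissible_initialCap
    · simp [hcap₁, hp₁]
  · rintro r s₂ hr hv hF₂ ⟨hst, hb, hcase⟩
    have hz := (h₀.congr hst.same).net.search.zero
    have setR : ∀ s' : State, Stable I s₀ s' → Stable I s₀ (s'.setReg qR (r + 1)) := fun s' h =>
      ⟨h.same.trans (.of_frame (Instr.frame (.const qR (r + 1)) s') rfl), h.clean, h.cap_zero⟩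
    refine Runs.cond (fun hb' => ?_) (fun hb' => ?_)
    · simp only [holds_eq, hz] at hb'
      obtain ⟨-, hadm, hsuc⟩ := hcase.resolve_left (fun h => by omega)
      refine (phase_spec h₀ hF hst.same hst.clean hadm).mono le_rfl ?_
      rintro s₃ - ⟨g1, g2, g3, g4, g5, g6, g7⟩
      rw [hb] at g3 g4
      refine ⟨setR _ ⟨g2, g1, fun e he => ?_⟩, g3, ?_⟩
      · rw [g4, raisedCap, if_neg (fun h => by omega), hst.cap_zero e he]
      · by_cases hS : (F (s₂.arr aCap)).Success I
        · exact Or.inl (g6 hS)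
        · refine Or.inr ⟨(g7 hS).trans hb', by rw [State.setReg_arr, g4]; exact hadm.raisedCap,
            fun h => ?_⟩
          have h' := hsuc h
          rw [show I.k + 1 - r = (I.k + 1 - (r + 1)) + 1 by omega, Succeeds] at h'
          have := h'.resolve_left hS
          simp only [State.setReg_arr, State.setReg_reg]
          rw [if_neg (by decide), g4, g5]
          exact this
    · simp only [holds_eq, hz] at hb'
      refine Runs.skip ⟨setR _ hst, hb, ?_⟩ (by unfold phaseTime; omega)
      exact Or.inl (hcase.resolve_right (fun h => hb' h.1))
  · rintro s₂ - ⟨hst, hb, hcase⟩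
    refine ⟨hst, hb, hcase.imp id fun h => ⟨h.1, fun h' => ?_⟩⟩
    have := h.2.2 h'
    rw [Nat.sub_self] at this
    exact this

/-- A bound on the running time of an iteration. -/
def iterationTime (I : MultiBudgetedCut) (b L : ℕ) : ℕ :=
  phasesTime I b + (1 + (8 * (L + 2) + 3))

theorem iteration_spec {s₀ s : State} {F : (ℕ → ℕ) → Outcome} {L v : ℕ} (h₀ : Ready I s₀)
    (hF : Computes I s₀ F) (hs : Stable I s₀ s) (hd : s.reg rDone = 0) (hL : s₀.reg rLen = L)
    (hv : v < 2 ^ L) (hb : s.arr aBits = bitsOf L v) :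
    Runs iteration s (iterationTime I (s₀.reg rB) L) fun s' => Stable I s₀ s' ∧
      ((s'.reg rDone = 1 ∧ I.IsSolution (I.output s')) ∨
       (¬ Succeeds I F (bitsOf L v) (I.k + 1) (initialCap I) 0 ∧
        ((s'.reg rDone = 0 ∧ v + 1 < 2 ^ L ∧ s'.arr aBits = bitsOf L (v + 1)) ∨
         (s'.reg rDone = 2 ∧ v + 1 = 2 ^ L)))) := by
  have hph := phases_spec h₀ hF hs hd
  obtain ⟨t, s', e, ht, hQ⟩ := hph
  -- The sequence is associated differently in `iteration`, so the run is cut in two and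
  -- reassembled.
  cases e with
  | seq e₁ e₂ =>
  rename_i s₁ t₁ t₂
  have : Runs iteration s ((t₁ + t₂) + (1 + (8 * (L + 2) + 3))) fun s' => Stable I s₀ s' ∧
      ((s'.reg rDone = 1 ∧ I.IsSolution (I.output s')) ∨
       (¬ Succeeds I F (bitsOf L v) (I.k + 1) (initialCap I) 0 ∧
        ((s'.reg rDone = 0 ∧ v + 1 < 2 ^ L ∧ s'.arr aBits = bitsOf L (v + 1)) ∨
         (s'.reg rDone = 2 ∧ v + 1 = 2 ^ L)))) := by
    refine Runs.mono (T := t₁ + (t₂ + (1 + (8 * (L + 2) + 3))))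
      (Runs.seq ⟨t₁, s₁, e₁, le_rfl, Runs.seq ⟨t₂, s', e₂, le_rfl, ?_⟩⟩) (by omega) fun _ _ h => h
    obtain ⟨hst, hbits, hcase⟩ := hQ
    have hR := h₀.congr hst.same
    have hz := hR.net.search.zero
    refine Runs.cond (fun hb' => ?_) (fun hb' => ?_)
    · simp only [holds_eq, hz] at hb'
      have hn := (hcase.resolve_left (fun h => by omega)).2
      rw [hb] at hbits hn
      refine (increment_spec hz hR.net.search.one
        ((hst.same.reg rLen (by decide)).trans hL) hv hbits hb').mono le_rfl ?_
      intro s₂ hF₂ h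
      refine ⟨⟨hst.same.trans (.of_frame hF₂ rfl), hst.clean.of_frame hF₂ rfl rfl, ?_⟩,
        Or.inr ⟨hn, h⟩⟩
      rw [hF₂.arr aCap rfl]; exact hst.cap_zero
    · simp only [holds_eq, hz] at hb'
      exact Runs.skip ⟨hst, Or.inl (hcase.resolve_right fun h => hb' h.1)⟩ (by omega)
  refine this.mono ?_ fun _ _ h => h
  unfold iterationTime
  omega

/-- Only whether a bit is zero matters, so the counter enumerates every relevant guess. -/
theorem exists_bits (L : ℕ) (β : ℕ → ℕ) :
    ∃ v < 2 ^ L, ∀ x < L, bitsOf L v x = 0 ↔ β x = 0 := by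
  refine ⟨Nat.ofBits fun i : Fin L => decide (β i ≠ 0), Nat.ofBits_lt_two_pow _, fun x hx => ?_⟩
  rw [bitsOf, Nat.testBit_ofBits_lt _ _ hx]
  by_cases h : β x = 0 <;> simp [h, hx]

/-- If all guesses fail, there is no solution. -/
theorem not_exists_solution {s₀ : State} {F : (ℕ → ℕ) → Outcome} (hF : Computes I s₀ F)
    (h : ∀ v < 2 ^ (∑ r ∈ Finset.range (I.k + 1), r * I.ℓ),
      ¬ Succeeds I F (bitsOf (∑ r ∈ Finset.range (I.k + 1), r * I.ℓ) v) (I.k + 1)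
        (initialCap I) 0) : ¬ ∃ C, I.IsSolution C := by
  classical
  rintro ⟨C, hC⟩
  have hT := target_of_isSolution hC
  obtain ⟨β, -, hβ⟩ := exists_guess (L := ∑ r ∈ Finset.range (I.k + 1), r * I.ℓ)
    (fun cap _ => (hF cap).1) hT (I.k + 1) 0 0 (initialCap I) 0 admissible_initialCap
    (fun e he => by rw [initialCap, if_pos (hT.lt e he), if_pos (hT.colored e he)])
    guarantee_initialCap (by omega)
    (by rw [zero_add]; exact Finset.sum_le_sum_of_subset (Finset.filter_subset _ _))
  obtain ⟨v, hv, hvb⟩ := exists_bits _ β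
  exact h v hv (hβ _ hvb)

/-- The counter starts at 0 and all smaller values have failed, so an overflow refutes every guess.
One outcome function serves all iterations because the setup never changes. -/
theorem search_guesses_spec {s₀ : State} {L : ℕ} (h₀ : Ready I s₀) (hs : Stable I s₀ s₀)
    (hd : s₀.reg rDone = 0) (hb : s₀.arr aBits = 0) (hL : s₀.reg rLen = L) :
    Runs (.loop (.eq rDone rZero) iteration) s₀
      ((iterationTime I (s₀.reg rB) L + 1) * 2 ^ L + 1) fun s' => s'.reg rOne = 1 ∧
        ((s'.reg rDone = 1 ∧ I.IsSolution (I.output s')) ∨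
         (s'.reg rDone = 2 ∧ ¬ ∃ C, I.IsSolution C)) := by
  obtain ⟨F, hF⟩ := exists_outcome h₀
  have hLe : L = ∑ r ∈ Finset.range (I.k + 1), r * I.ℓ := hL.symm.trans h₀.len_eq
  refine (Runs.loop (N := 2 ^ L) (T := iterationTime I (s₀.reg rB) L) (fun c s' =>
    Stable I s₀ s' ∧ ((s'.reg rDone = 1 ∧ I.IsSolution (I.output s')) ∨
      (s'.reg rDone = 2 ∧ ∀ w < 2 ^ L, ¬ Succeeds I F (bitsOf L w) (I.k + 1) (initialCap I) 0) ∨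
      (s'.reg rDone = 0 ∧ ∃ v < 2 ^ L, s'.arr aBits = bitsOf L v ∧ 2 ^ L - v ≤ c ∧
        ∀ w < v, ¬ Succeeds I F (bitsOf L w) (I.k + 1) (initialCap I) 0))) ?_ ?_).mono le_rfl ?_
  · refine ⟨hs, Or.inr (Or.inr ⟨hd, 0, by positivity, ?_, Nat.sub_le _ _, by simp⟩)⟩
    rw [hb]; funext x; simp [bitsOf]
  · rintro c s hFr ⟨hst, hcase⟩ hgo
    have hz := (h₀.congr hst.same).net.search.zero
    simp only [holds_eq, hz] at hgo
    obtain ⟨-, v, hv, hbv, hc, hw⟩ :=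
      (hcase.resolve_left (fun h => by omega)).resolve_left (fun h => by omega)
    refine (iteration_spec h₀ hF hst hgo hL hv hbv).mono le_rfl ?_
    have hw' : ¬ Succeeds I F (bitsOf L v) (I.k + 1) (initialCap I) 0 →
        ∀ w < v + 1, ¬ Succeeds I F (bitsOf L w) (I.k + 1) (initialCap I) 0 := by
      intro hn w hlt
      by_cases e : w = v
      · rwa [e]
      · exact hw w (by omega)
    rintro s' - ⟨hst', h | ⟨hn, ⟨h1, h2, h3⟩ | ⟨h1, h2⟩⟩⟩
    · exact ⟨0, by omega, hst', Or.inl h⟩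
    · exact ⟨c - 1, by omega, hst', Or.inr (Or.inr ⟨h1, v + 1, h2, h3, by omega, hw' hn⟩)⟩
    · exact ⟨0, by omega, hst', Or.inr (Or.inl ⟨h1, by rw [← h2]; exact hw' hn⟩)⟩
  · rintro s - ⟨⟨c, hst, hcase⟩, hgo⟩
    have hR := h₀.congr hst.same
    have hz := hR.net.search.zero
    simp only [holds_eq, hz] at hgo
    refine ⟨hR.net.search.one, ?_⟩
    rcases hcase with h | ⟨h1, h2⟩ | ⟨h1, -⟩
    · exact Or.inl h
    · refine Or.inr ⟨h1, not_exists_solution hF ?_⟩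
      rw [← hLe]; exact h2
    · exact absurd h1 hgo

end CutProgram

/-! ## Setup -/

namespace CutProgram

open RAM RAM.Prog

variable {I : MultiBudgetedCut}

theorem k_eq_sum : I.k = ∑ j ∈ Finset.range I.ℓ, I.input.arr aBudget j := by
  rw [MultiBudgetedCut.k, Finset.sum_range]
  exact Finset.sum_congr rfl fun i _ => (input_budget i).symm

/-- Sums are formed by successors, so a color costs time proportional to its budget, bounded here by
k. -/
theorem setupBudget_spec :
    Runs setupBudget I.input ((3 * I.k + 5) * I.ℓ + 4) fun s' =>
      s'.reg rOne = 1 ∧ s'.reg rK = I.k ∧ s'.reg rK1 = I.k + 1 := by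
  refine Runs.mono (T := (((3 * I.k + 2) + 1 + 2) * I.ℓ + 2 + 1) + 1) (Runs.step (Runs.seq (T' := 1)
    ((Runs.for (N := I.ℓ) (T := (3 * I.k + 2) + 1) (fun j s' => s'.reg rOne = 1 ∧
      s'.reg rK = ∑ i ∈ Finset.range j, I.input.arr aBudget i) rfl rfl (by decide)
      (by simp [Instr.apply, MultiBudgetedCut.input])
      (by simp [Instr.apply, MultiBudgetedCut.input]) ?_).mono le_rfl ?_)))
    (by ring_nf; omega) fun _ _ h => h
  · rintro j s₁ hj hv hF ⟨h1, h2⟩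
    have b1 : s₁.arr aBudget = I.input.arr aBudget :=
      (hF.arr _ rfl).trans (by simp [Instr.apply])
    have hle : I.input.arr aBudget j ≤ I.k := by
      rw [k_eq_sum]
      exact Finset.single_le_sum (f := fun i => I.input.arr aBudget i)
        (fun _ _ => Nat.zero_le _) (Finset.mem_range.2 hj)
    refine Runs.step ((Runs.for (N := I.input.arr aBudget j) (T := 1) (fun i s' =>
      s'.reg rK = ∑ i ∈ Finset.range j, I.input.arr aBudget i + i) rfl rfl (by decide)
      (by simp [Instr.apply, hv, b1]) (by simp [Instr.apply, h2]) ?_).mono (by omega) ?_)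
    · intro i s₂ hi hv₂ hF₂ h
      refine Runs.instr ?_ le_rfl
      simp [Instr.apply, h]; omega
    · intro s₂ hF₂ h
      have c1 : s₂.reg rOne = 1 := (hF₂.reg _ rfl).trans (by simp [Instr.apply, h1])
      simp [c1, h, Finset.sum_range_succ]
  · rintro s' - ⟨h1, h2⟩
    refine Runs.instr ?_ le_rfl
    rw [← k_eq_sum] at h2
    simp [Instr.apply, h1, h2]

theorem setupBounds_spec {s : State} :
    Runs setupBounds s (3 * s.reg rM + 3 * s.reg rN + 6) fun s' =>
      s'.reg rM2 = 2 * s.reg rM ∧ s'.reg rB = 2 * s.reg rM + s.reg rN := by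
  refine Runs.mono (T := ((1 + 2) * s.reg rM + 2 + (((1 + 2) * s.reg rN + 2) + 1)) + 1)
    (Runs.step (Runs.seq ((Runs.for (N := s.reg rM) (T := 1)
      (fun j s' => s'.reg rM2 = s.reg rM + j) rfl rfl (by decide)
      (by simp [Instr.apply]) (by simp [Instr.apply]) ?_).mono le_rfl ?_)))
    (by omega) fun _ _ h => h
  · intro j s₁ hj hv hF h
    refine Runs.instr ?_ le_rfl
    simp [Instr.apply, h]; omega
  · intro s₁ hF h
    have b0 : s₁.reg rN = s.reg rN := (hF.reg _ rfl).trans (by simp [Instr.apply])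
    refine Runs.step ((Runs.for (N := s.reg rN) (T := 1)
      (fun j s' => s'.reg rM2 = 2 * s.reg rM ∧ s'.reg rB = 2 * s.reg rM + j) rfl rfl (by decide)
      (by simp [Instr.apply, b0]) (by simp [Instr.apply, h]; omega) ?_).mono le_rfl
        fun _ _ h => h)
    rintro j s₂ hj hv₂ hF₂ ⟨h1, h2⟩
    refine Runs.instr ?_ le_rfl
    simp [Instr.apply, h1, h2]; omega

theorem setupLength_spec {s : State} {k l : ℕ} (hk : s.reg rK1 = k + 1) (hl : s.reg rL = l)
    (h0 : s.reg rLen = 0) :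
    Runs setupLength s ((((3 * l + 4) * k + 4)) * (k + 1) + 2) fun s' =>
      s'.reg rLen = ∑ r ∈ Finset.range (k + 1), r * l := by
  refine Runs.mono (T := ((((3 * l + 4) * k + 2)) + 2) * (k + 1) + 2) (Runs.for (N := k + 1)
    (T := (3 * l + 4) * k + 2) (fun j s' => s'.reg rLen = ∑ r ∈ Finset.range j, r * l)
    rfl rfl (by decide) hk (by simp [h0]) ?_) le_rfl fun _ _ h => h
  intro j s₁ hj hv hF h
  have b2 : s₁.reg rL = l := (hF.reg _ rfl).trans hl
  refine Runs.mono (T := (((1 + 2) * l + 2) + 2) * j + 2) (Runs.for (N := j)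
    (T := (1 + 2) * l + 2) (fun i s' => s'.reg rLen = ∑ r ∈ Finset.range j, r * l + i * l)
    rfl rfl (by decide) hv (by simp [h]) ?_) ?_ ?_
  · intro i s₂ hi hv₂ hF₂ h₂
    have c2 : s₂.reg rL = l := (hF₂.reg _ rfl).trans b2
    refine (Runs.for (N := l) (T := 1)
      (fun x s' => s'.reg rLen = ∑ r ∈ Finset.range j, r * l + i * l + x)
      rfl rfl (by decide) c2 (by simp [h₂]) ?_).mono le_rfl ?_
    · intro x s₃ hx hv₃ hF₃ h₃
      refine Runs.instr ?_ le_rfl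
      simp [Instr.apply, h₃]; omega
    · intro s₃ hF₃ h₃
      simp [h₃]; ring
  · have : (3 * l + 4) * j ≤ (3 * l + 4) * k := Nat.mul_le_mul_left _ (by omega)
    have e : (1 + 2) * l + 2 + 2 = 3 * l + 4 := by omega
    rw [e]; omega
  · intro s₂ hF₂ h₂
    simp [h₂, Finset.sum_range_succ]

theorem setupArcs_spec {s : State} :
    Runs setupArcs s (11 * s.reg rM + 3) fun s' => ∀ e < s.reg rM,
      (s'.arr aFrom e = s.arr aSrc e ∧ s'.arr aTo e = s.arr aTgt e ∧
        s'.arr aRev e = s.reg rM + e) ∧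
      (s'.arr aFrom (s.reg rM + e) = s.arr aTgt e ∧ s'.arr aTo (s.reg rM + e) = s.arr aSrc e ∧
        s'.arr aRev (s.reg rM + e) = e) := by
  refine Runs.mono (T := ((9 + 2) * s.reg rM + 2) + 1)
    (Runs.step ((Runs.for (N := s.reg rM) (T := 9)
      (fun j s' => s'.reg qY = s.reg rM + j ∧ ∀ e < j,
        (s'.arr aFrom e = s.arr aSrc e ∧ s'.arr aTo e = s.arr aTgt e ∧
          s'.arr aRev e = s.reg rM + e) ∧
        (s'.arr aFrom (s.reg rM + e) = s.arr aTgt e ∧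
          s'.arr aTo (s.reg rM + e) = s.arr aSrc e ∧ s'.arr aRev (s.reg rM + e) = e))
      rfl rfl (by decide) (by simp [Instr.apply]) (by simp [Instr.apply]) ?_).mono le_rfl
        fun _ _ h => h.2))
    (by omega) fun _ _ h => h
  rintro j s₁ hj hv hF ⟨h1, h2⟩
  have b0 : s₁.arr aSrc = s.arr aSrc := (hF.arr _ rfl).trans (by simp [Instr.apply])
  have b1 : s₁.arr aTgt = s.arr aTgt := (hF.arr _ rfl).trans (by simp [Instr.apply])
  refine Runs.of_loopFree rfl (by decide) ?_
  refine ⟨by simp [h1]; omega, fun e he => ?_⟩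
  by_cases hej : e = j
  · subst hej
    have n1 : e ≠ s.reg rM + e := by omega
    have n2 : s.reg rM ≠ 0 := by omega
    simp [hv, h1, b0, b1, Function.update_apply, n1, n2]
  · have n1 : e ≠ s.reg rM + j := by omega
    have n2 : s.reg rM + e ≠ j := by omega
    have := h2 e (by omega)
    simp [hv, h1, b0, b1, Function.update_apply, n1, n2, hej, this]

/-- Arcs are prepended in increasing order, so a list head is always the last arc so far. Storing
the index plus one leaves 0 for the empty list. -/
theorem IsLast.extend {src : ℕ → ℕ} {v j a : ℕ} (h : IsLast src v j a) :
    IsLast src v (j + 1) (if src j = v then j + 1 else a) := by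
  split_ifs with hs
  · exact ⟨le_rfl, fun _ => hs, fun e h1 h2 => by omega⟩
  · refine ⟨h.le.trans (Nat.le_succ j), h.src_eq, fun e h1 h2 => ?_⟩
    by_cases e_eq : e = j
    · rwa [e_eq]
    · exact h.src_ne e h1 (by omega)

theorem setupLists_spec {s : State} (h0 : s.arr aFirst = 0) :
    Runs setupLists s (7 * s.reg rM2 + 2) fun s' =>
      (∀ v, IsLast (s.arr aFrom) v (s.reg rM2) (s'.arr aFirst v)) ∧
      ∀ e < s.reg rM2, IsLast (s.arr aFrom) (s.arr aFrom e) e (s'.arr aNext e) := by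
  refine Runs.mono (T := (5 + 2) * s.reg rM2 + 2) (Runs.for (N := s.reg rM2) (T := 5)
      (fun j s' => (∀ v, IsLast (s.arr aFrom) v j (s'.arr aFirst v)) ∧
        ∀ e < j, IsLast (s.arr aFrom) (s.arr aFrom e) e (s'.arr aNext e))
      rfl rfl (by decide) rfl ?_ ?_) (by omega) fun _ _ h => h
  · refine ⟨fun v => ?_, fun e he => absurd he (Nat.not_lt_zero e)⟩
    simp only [State.setReg_arr, h0]
    exact ⟨le_rfl, fun h => absurd rfl h, fun e _ he => absurd he (Nat.not_lt_zero e)⟩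
  · rintro j s₁ hj hv hF ⟨h1, h2⟩
    have b0 : s₁.arr aFrom = s.arr aFrom := hF.arr _ rfl
    refine Runs.of_loopFree rfl (by decide) ⟨fun v => ?_, fun e he => ?_⟩
    · have := (h1 v).extend
      simp only [setupLists, eval_seq, eval_ld, eval_st, eval_suc] at this ⊢
      simp [hv, b0, Function.update_apply]
      simpa [eq_comm] using this
    · by_cases hej : e = j
      · subst hej
        have := h1 (s.arr aFrom e)
        simpa [hv, b0, Function.update_apply] using this
      · have := h2 e (by omega)
        simpa [hv, b0, Function.update_apply, hej] using this

/-- A bound on the running time of the setup. -/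
def setupTime (I : MultiBudgetedCut) : ℕ :=
  ((3 * I.k + 5) * I.ℓ + 4) + ((3 * I.m + 3 * I.n + 6) +
    (((3 * I.ℓ + 4) * I.k + 4) * (I.k + 1) + 2 + ((11 * I.m + 3) + (7 * (2 * I.m) + 2))))

theorem setup_spec : Runs setup I.input (setupTime I) fun s' =>
    Ready I s' ∧ Stable I s' s' ∧ s'.reg rDone = 0 ∧ s'.arr aBits = 0 ∧
      s'.reg rB = 2 * I.m + I.n := by
  unfold setup setupTime
  refine Runs.seq (setupBudget_spec.mono le_rfl fun s₁ hF₁ ⟨hone₁, hk₁, hk1₁⟩ => ?_)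
  have n₁ : s₁.reg rN = I.n := hF₁.reg _ rfl
  have m₁ : s₁.reg rM = I.m := hF₁.reg _ rfl
  refine Runs.seq ((setupBounds_spec (s := s₁)).mono (by omega) fun s₂ hF₂ ⟨hM₂, hB₂⟩ => ?_)
  have l₂ : s₂.reg rL = I.ℓ := (hF₂.reg _ rfl).trans (hF₁.reg _ rfl)
  have len₂ : s₂.reg rLen = 0 := (hF₂.reg _ rfl).trans (hF₁.reg _ rfl)
  refine Runs.seq ((setupLength_spec ((hF₂.reg _ rfl).trans hk1₁) l₂ len₂).mono le_rfl
    fun s₃ hF₃ hlen₃ => ?_)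
  have m₃ : s₃.reg rM = I.m := (hF₃.reg _ rfl).trans ((hF₂.reg _ rfl).trans m₁)
  refine Runs.seq ((setupArcs_spec (s := s₃)).mono (by omega) fun s₄ hF₄ harcs => ?_)
  have first₄ : s₄.arr aFirst = 0 := (hF₄.arr _ rfl).trans ((hF₃.arr _ rfl).trans
    ((hF₂.arr _ rfl).trans (hF₁.arr _ rfl)))
  have M₄ : s₄.reg rM2 = 2 * I.m :=
    (hF₄.reg _ rfl).trans ((hF₃.reg _ rfl).trans (hM₂.trans (by rw [m₁])))
  refine (setupLists_spec first₄).mono (by rw [M₄]) fun s₅ hF₅ ⟨hfirst, hnext⟩ => ?_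
  have ha : ∀ a, setup.writesArr a = false → s₅.arr a = I.input.arr a := by
    intro a h
    simp only [setup, writesArr, Bool.or_eq_false_iff] at h
    exact (hF₅.arr _ h.2.2.2.2).trans ((hF₄.arr _ h.2.2.2.1).trans ((hF₃.arr _ h.2.2.1).trans
      ((hF₂.arr _ h.2.1).trans (hF₁.arr _ h.1))))
  have hr : ∀ a, setup.writesReg a = false → s₅.reg a = I.input.reg a := by
    intro a h
    simp only [setup, writesReg, Bool.or_eq_false_iff] at h
    exact (hF₅.reg _ h.2.2.2.2).trans ((hF₄.reg _ h.2.2.2.1).trans ((hF₃.reg _ h.2.2.1).trans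
      ((hF₂.reg _ h.2.1).trans (hF₁.reg _ h.1))))
  have src₃ : s₃.arr aSrc = I.input.arr aSrc :=
    (hF₃.arr _ rfl).trans ((hF₂.arr _ rfl).trans (hF₁.arr _ rfl))
  have tgt₃ : s₃.arr aTgt = I.input.arr aTgt :=
    (hF₃.arr _ rfl).trans ((hF₂.arr _ rfl).trans (hF₁.arr _ rfl))
  have from₅ : s₅.arr aFrom = s₄.arr aFrom := hF₅.arr _ rfl
  have to₅ : s₅.arr aTo = s₄.arr aTo := hF₅.arr _ rfl
  have rev₅ : s₅.arr aRev = s₄.arr aRev := hF₅.arr _ rfl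
  have M₅ : s₅.reg rM2 = 2 * I.m := (hF₅.reg _ rfl).trans M₄
  have n₅ : s₅.reg rN = I.n := hr rN rfl
  have B₅ : s₅.reg rB = 2 * I.m + I.n := (hF₅.reg _ rfl).trans ((hF₄.reg _ rfl).trans
    ((hF₃.reg _ rfl).trans (by rw [hB₂, n₁, m₁])))
  have one₅ : s₅.reg rOne = 1 := (hF₅.reg _ rfl).trans ((hF₄.reg _ rfl).trans
    ((hF₃.reg _ rfl).trans ((hF₂.reg _ rfl).trans hone₁)))
  rw [m₃, src₃, tgt₃] at harcs
  rw [M₄, ← from₅] at hfirst hnext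
  have hfw : ∀ e < I.m, s₅.arr aFrom e = I.input.arr aSrc e ∧ s₅.arr aTo e = I.input.arr aTgt e ∧
      s₅.arr aRev e = I.m + e := by
    intro e he; rw [from₅, to₅, rev₅]; exact (harcs e he).1
  have hbw : ∀ e < I.m, s₅.arr aFrom (I.m + e) = I.input.arr aTgt e ∧
      s₅.arr aTo (I.m + e) = I.input.arr aSrc e ∧ s₅.arr aRev (I.m + e) = e := by
    intro e he; rw [from₅, to₅, rev₅]; exact (harcs e he).2
  have hsrc : ∀ e < I.m, I.input.arr aSrc e < I.n := fun e he => by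
    have := input_tail he
    simp only [netOf] at this
    rw [this]; exact (I.src ⟨e, he⟩).2
  have htgt : ∀ e < I.m, I.input.arr aTgt e < I.n := fun e he => by
    have := input_head he
    simp only [netOf] at this
    rw [this]; exact (I.tgt ⟨e, he⟩).2
  have hends : ∀ e < 2 * I.m, s₅.arr aFrom e < I.n ∧ s₅.arr aTo e < I.n := by
    intro e he
    by_cases h : e < I.m
    · rw [(hfw e h).1, (hfw e h).2.1]; exact ⟨hsrc e h, htgt e h⟩
    · obtain ⟨x, rfl⟩ := Nat.exists_eq_add_of_le (not_lt.1 h)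
      have hx : x < I.m := by omega
      rw [(hbw x hx).1, (hbw x hx).2.1]; exact ⟨htgt x hx, hsrc x hx⟩
  have hX : s₅.arr aX = I.input.arr aX := ha _ rfl
  have hY : s₅.arr aY = I.input.arr aY := ha _ rfl
  refine ⟨⟨⟨⟨hr _ rfl, one₅, ⟨?_, ?_, ?_, ?_⟩, by omega, ?_⟩, n₅, hr rM rfl, M₅, by omega, hX, hY,
    hfw, hbw⟩, hr _ rfl, ?_, ?_, ?_, ha _ rfl, ha _ rfl, ha _ rfl, ha _ rfl⟩,
    ⟨.refl _, ?_, ?_⟩, hr _ rfl, ha _ rfl, B₅⟩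
  · intro e he
    simp only [graphOf, M₅, n₅] at he ⊢
    exact (hends e he).1
  · intro e he
    simp only [graphOf, M₅, n₅] at he ⊢
    exact (hends e he).2
  · intro v _
    simp only [graphOf, M₅]
    exact hfirst v
  · intro e he
    simp only [graphOf, M₅] at he ⊢
    exact hnext e he
  · intro v hv hx
    rw [n₅] at hv
    rw [hX] at hx
    rw [hY]
    by_contra hy
    -- Disjointness of X and Y enters here: it makes it sound for the search to start without
    -- inspecting its roots.
    exact Finset.disjoint_left.1 I.disjoint ((input_xs ⟨v, hv⟩).1 hx) ((input_ys ⟨v, hv⟩).1 hy)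
  · exact (hF₅.reg _ rfl).trans ((hF₄.reg _ rfl).trans ((hF₃.reg _ rfl).trans
      ((hF₂.reg _ rfl).trans hk₁)))
  · exact (hF₅.reg _ rfl).trans ((hF₄.reg _ rfl).trans ((hF₃.reg _ rfl).trans
      ((hF₂.reg _ rfl).trans hk1₁)))
  · exact (hF₅.reg _ rfl).trans ((hF₄.reg _ rfl).trans hlen₃)
  · intro a h x _
    fin_cases h <;> rw [ha _ rfl] <;> rfl
  · intro e _
    rw [ha _ rfl]; rfl

end CutProgram

/-! ## The main theorem -/

namespace CutProgram

open RAM RAM.Prog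

variable {I : MultiBudgetedCut}

/-- Budgets are positive. This lets polynomial factors in ℓ be replaced by factors in k. -/
theorem colors_le_k : I.ℓ ≤ I.k := by
  have := Finset.card_nsmul_le_sum Finset.univ I.budget 1 fun i _ => I.budget_pos i
  simpa [MultiBudgetedCut.k] using this

theorem two_mul_sum_range_mul (k l : ℕ) :
    2 * ∑ r ∈ Finset.range (k + 1), r * l = k * (k + 1) * l := by
  rw [← Finset.sum_mul, ← mul_assoc, mul_comm 2, Finset.sum_range_id_mul_two]
  simp [mul_comm]

/-- Writing the positive quantities as `k + 1` and `a + 1` turns the bound into a comparison of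
coefficients of polynomials in `k` and `a`. -/
theorem iterationTime_le (hn : 1 ≤ I.n) (hl : 1 ≤ I.ℓ) {L : ℕ} (hL : L ≤ I.k ^ 3) :
    iterationTime I (2 * I.m + I.n) L + 1 ≤ 10000 * (I.k ^ 3 * (I.n + I.m)) := by
  have hlk := colors_le_k (I := I)
  obtain ⟨k, hk⟩ : ∃ k, I.k = k + 1 := ⟨I.k - 1, by omega⟩
  obtain ⟨a, ha⟩ : ∃ a, I.n + I.m = a + 1 := ⟨I.n + I.m - 1, by omega⟩
  have hl' : I.ℓ ≤ k + 1 := by omega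
  have hm : I.m ≤ a + 1 := by omega
  have hb : 2 * I.m + I.n ≤ 2 * (a + 1) := by omega
  unfold iterationTime phasesTime phaseTime analysisTime
  rw [hk] at hL ⊢
  rw [ha]
  calc _ ≤ (8 * (k + 1) + 4 + 2) * (a + 1) + 4 + ((1 + (14 * (2 * (a + 1)) + 16 +
        (220 * (a + 1 + 1) * (k + 1 + 3) + ((9 * (k + 1) + 14) * (a + 1 + 1) + 7 * (k + 1) + 10 +
          ((3 * (k + 1) + 5) * (k + 1 + 1) + (10 * (k + 1) + 8) * (a + 1) + 5)))) + 2) *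
            (k + 1 + 1) + 2) + (1 + (8 * ((k + 1) ^ 3 + 2) + 3)) + 1 := by gcongr
    _ ≤ _ := by ring_nf; omega

theorem setupTime_le (hn : 1 ≤ I.n) (hl : 1 ≤ I.ℓ) :
    setupTime I ≤ 1000 * (I.k ^ 3 * (I.n + I.m)) := by
  have hlk := colors_le_k (I := I)
  obtain ⟨k, hk⟩ : ∃ k, I.k = k + 1 := ⟨I.k - 1, by omega⟩
  obtain ⟨a, ha⟩ : ∃ a, I.n + I.m = a + 1 := ⟨I.n + I.m - 1, by omega⟩
  have hl' : I.ℓ ≤ k + 1 := by omega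
  have hm : I.m ≤ a + 1 := by omega
  have hn' : I.n ≤ a + 1 := by omega
  unfold setupTime
  rw [hk, ha]
  calc _ ≤ (3 * (k + 1) + 5) * (k + 1) + 4 + (3 * (a + 1) + 3 * (a + 1) + 6 +
        (((3 * (k + 1) + 4) * (k + 1) + 4) * (k + 1 + 1) + 2 +
          (11 * (a + 1) + 3 + (7 * (2 * (a + 1)) + 2)))) := by gcongr
    _ ≤ _ := by ring_nf; omega

theorem length_le_cube (hl : I.ℓ ≤ I.k) :
    ∑ r ∈ Finset.range (I.k + 1), r * I.ℓ ≤ I.k ^ 3 := by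
  have h := two_mul_sum_range_mul I.k I.ℓ
  have h1 : I.k * (I.k + 1) * I.ℓ ≤ I.k * (I.k + 1) * I.k := Nat.mul_le_mul_left _ hl
  have h2 : I.k * (I.k + 1) * I.k ≤ 2 * I.k ^ 3 := by
    rcases Nat.eq_zero_or_pos I.k with e | e
    · simp [e]
    · calc I.k * (I.k + 1) * I.k ≤ I.k * (I.k + I.k) * I.k := by gcongr; exact e
        _ = _ := by ring
  omega

/-- The length is only about half of `k² l`: the gap is `k (k - 1) l / 2`. It absorbs `k² ≤ 2 ^ (2
(k - 1))` up to the factor 4. -/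
theorem sq_mul_two_pow_length_le {k l L : ℕ} (hk : 1 ≤ k) (hl : 1 ≤ l)
    (hL : 2 * L = k * (k + 1) * l) : k ^ 2 * 2 ^ L ≤ 4 * 2 ^ (k ^ 2 * l) := by
  have h1 : k ≤ 2 ^ (k - 1) := by
    have := Nat.lt_two_pow_self (n := k - 1)
    omega
  have h2 : 2 * (k - 1) + L ≤ 2 + k ^ 2 * l := by
    obtain ⟨j, rfl⟩ : ∃ j, k = j + 1 := ⟨k - 1, by omega⟩
    obtain ⟨i, rfl⟩ : ∃ i, l = i + 1 := ⟨l - 1, by omega⟩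
    -- This is the case `l = 1` of the exponent inequality, with `j = k - 1`; a larger `l` only
    -- widens the gap.
    have h3 : 3 * j ≤ 4 + j * j := by
      rcases Nat.lt_or_ge j 3 with h | h
      · interval_cases j <;> omega
      · nlinarith
    have h4 : 0 ≤ (j + 1) * j * i := Nat.zero_le _
    simp only [Nat.add_sub_cancel]
    nlinarith
  calc k ^ 2 * 2 ^ L ≤ (2 ^ (k - 1)) ^ 2 * 2 ^ L := by gcongr
    _ = 2 ^ (2 * (k - 1) + L) := by rw [← pow_mul, ← pow_add, mul_comm (k - 1)]
    _ ≤ 2 ^ (2 + k ^ 2 * l) := Nat.pow_le_pow_right (by norm_num) h2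
    _ = _ := by rw [pow_add]; norm_num

theorem main_spec (I : MultiBudgetedCut) : Runs main I.input
    (setupTime I + (((iterationTime I (2 * I.m + I.n)
      (∑ r ∈ Finset.range (I.k + 1), r * I.ℓ) + 1) *
        2 ^ (∑ r ∈ Finset.range (I.k + 1), r * I.ℓ) + 1) + 3)) I.Answers := by
  unfold main
  refine Runs.seq (setup_spec.mono le_rfl fun s _ ⟨hR, hS, hd, hb, hB⟩ => ?_)
  rw [← hB]
  refine Runs.seq ((search_guesses_spec hR hS hd hb hR.len_eq).mono le_rfl ?_)
  rintro s' - ⟨ho, h⟩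
  refine Runs.of_loopFree rfl (by decide) ?_
  rcases h with ⟨h1, h2⟩ | ⟨h1, h2⟩
  · left
    refine ⟨by simp [finish, ho, h1], ?_⟩
    have : I.output (finish.eval s') = I.output s' := by
      simp [finish, MultiBudgetedCut.output, ho, h1]
    rwa [this]
  · right
    exact ⟨by simp [finish, ho, h1], h2⟩

end CutProgram

/-- A single program solves every instance with at least one vertex and at least one color,
within `c * 2 ^ (k² ℓ) * k * (|V| + |E|)` steps for an absolute constant `c`. -/
theorem theorem1 :
    ∃ (P : RAM.Prog) (c : ℕ), ∀ I : MultiBudgetedCut, 1 ≤ I.n → 1 ≤ I.ℓ →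
      ∃ (t : ℕ) (s : RAM.State), RAM.Exec P I.input t s ∧ I.Answers s ∧
        t ≤ c * (2 ^ (I.k ^ 2 * I.ℓ) * I.k * (I.n + I.m)) := by
  -- The constant is 4 · (1000 + 10000 + 4): setup, iterations, and the last loop test with the
  -- final translation, times the 4 from `sq_mul_two_pow_length_le`.
  refine ⟨CutProgram.main, 44016, fun I hn hl => ?_⟩
  obtain ⟨t, s, hexec, ht, hans⟩ := CutProgram.main_spec I
  refine ⟨t, s, hexec, hans, ht.trans ?_⟩
  have hlk := CutProgram.colors_le_k (I := I)
  have hk : 1 ≤ I.k := hl.trans hlk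
  have hset := CutProgram.setupTime_le hn hl
  have hiter := CutProgram.iterationTime_le hn hl (CutProgram.length_le_cube hlk)
  have hpow := CutProgram.sq_mul_two_pow_length_le hk hl (CutProgram.two_mul_sum_range_mul I.k I.ℓ)
  generalize ∑ r ∈ Finset.range (I.k + 1), r * I.ℓ = L at hiter hpow ⊢
  have h1 : 1 ≤ I.k ^ 3 * (I.n + I.m) := Nat.mul_pos (pow_pos hk 3) (by omega)
  have h2 : 1 ≤ 2 ^ L := Nat.one_le_two_pow
  calc _ ≤ 1000 * (I.k ^ 3 * (I.n + I.m)) * 2 ^ L +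
        (10000 * (I.k ^ 3 * (I.n + I.m)) * 2 ^ L + 4 * (I.k ^ 3 * (I.n + I.m)) * 2 ^ L) := by
        have h3 : 1 ≤ I.k ^ 3 * (I.n + I.m) * 2 ^ L := Nat.mul_pos h1 h2
        refine Nat.add_le_add (hset.trans (Nat.le_mul_of_pos_right _ h2)) ?_
        rw [add_assoc]
        refine Nat.add_le_add (Nat.mul_le_mul_right _ hiter) ?_
        rw [mul_assoc]; omega
    _ = 11004 * (I.k * (I.n + I.m)) * (I.k ^ 2 * 2 ^ L) := by ring
    _ ≤ 11004 * (I.k * (I.n + I.m)) * (4 * 2 ^ (I.k ^ 2 * I.ℓ)) := Nat.mul_le_mul_left _ hpow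
    _ = _ := by ring
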